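/- Let $n,L\ge 1$, $0<q<1$ and $0<\mu_i<\lambda<1$ for $i=1,\dots,L$. Write $(z)_m=\prod_{j=1}^m(1-zq^{j-1})$, $|\alpha|=\alpha_1+\cdots+\alpha_n$, $\binom{m}{k}_q=\frac{(q)_m}{(q)_k(q)_{m-k}}$ for $0\le k\le m$ and $\binom{m}{k}_q=0$ otherwise, and for $\beta,\gamma\in\mathbb Z_{\ge0}^n$ $$\Phi_q(\gamma|\beta;\lambda,\mu)=q^{\sum_{i<j}(\beta_i-\gamma_i)\gamma_j}\Bigl(\frac{\mu}{\lambda}\Bigr)^{|\gamma|}\frac{(\lambda)_{|\gamma|}(\mu/\lambda)_{|\beta|-|\gamma|}}{(\mu)_{|\beta|}}\prod_{i=1}^n\binom{\beta_i}{\gamma_i}_q,$$ which is $0$ unless $\gamma\le\beta$. The discrete-time inhomogeneous $U_q(A^{(1)}_n)$-zero range process on $L$ periodic sites is the evolution $|P(t+1)\rangle=T|P(t)\rangle$ on the space with basis $|\sigma_1,\dots,\sigma_L\rangle$, $\sigma_i\in\mathbb Z_{\ge0}^n$, where $T|\beta_1,\dots,\beta_L\rangle=\sum_\alpha T_{\beta}^{\alpha}|\alpha_1,\dots,\alpha_L\rangle$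 with $$T_{\beta}^{\alpha}=\sum_{\gamma_1,\dots,\gamma_L\in\mathbb Z_{\ge0}^n}\ \prod_{i=1}^L\theta(\gamma_{i-1}+\beta_i=\gamma_i+\alpha_i)\,\Phi_q(\gamma_i|\beta_i;\lambda,\mu_i),\qquad\gamma_0=\gamma_L,$$ and $\theta(\mathrm{true})=1$, $\theta(\mathrm{false})=0$. For $m\in\mathbb Z_{\ge0}^n$ let $S(m)$ be the set of $(\sigma_1,\dots,\sigma_L)$ with $\sigma_1+\cdots+\sigma_L=m$; the sector $m$ is spanned by the $|\sigma\rangle$ with $\sigma\in S(m)$, and it is basic if $m_a\ge1$ for all $a$. Let $F$ be the Fock space with basis $|s\rangle$, $s\in\mathbb Z_{\ge0}$, and operators $\mathbf b|s\rangle=|s+1\rangle$, $\mathbf c|s\rangle=(1-q^s)|s-1\rangle$, $\mathbf k|s\rangle=q^s|s\rangle$. Define operators $Z_\alpha(\zeta)$, $X_\alpha(\zeta)$ on $F^{\otimes n(n-1)/2}$ (as row-finite matrices in the basis of tensor products of the $|s\rangle$), recursively in $n$, by $Z_{\alpha_1}(\zeta)=1$, $$Z_{\alpha_1,\dots,\alpha_n}(\zeta)=\sum_{l\in\mathbb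 Z_{\ge0}^{n-1}}X_l(\zeta)\otimes\mathbf b^{l_1}\mathbf k^{\alpha_1^+}\mathbf c^{\alpha_1}\otimes\cdots\otimes\mathbf b^{l_{n-1}}\mathbf k^{\alpha_{n-1}^+}\mathbf c^{\alpha_{n-1}},\qquad \alpha_i^+=\alpha_{i+1}+\cdots+\alpha_n,$$ $$X_\alpha(\zeta)=\frac{\zeta^{-|\alpha|}(\zeta)_{|\alpha|}}{\prod_i(q)_{\alpha_i}}\,Z_\alpha(\zeta).$$ Then, in every basic sector $m$, for every $\sigma\in S(m)$ the trace $\mathrm{Tr}(X_{\sigma_1}(\mu_1)\cdots X_{\sigma_L}(\mu_L))$ over $F^{\otimes n(n-1)/2}$ converges and is positive, and a vector $\sum_{\sigma\in S(m)}\mathbb P(\sigma)|\sigma\rangle$ with real coefficients is stationary (fixed by $T$) if and only if there is a constant $c$ with $$\mathbb P(\sigma_1,\dots,\sigma_L)=c\,\mathrm{Tr}(X_{\sigma_1}(\mu_1)\cdots X_{\sigma_L}(\mu_L))\qquad\text{for all }\sigma\in S(m).$$ In other words, the stationary state of the sector is unique up to normalization and its (unnormalized) stationary probabilities are these traces. 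-/

import Mathlib

open scoped BigOperators

noncomputable section

namespace ZRP

/-- The `q`-Pochhammer symbol `(z; q)_m = ∏_{j=1}^m (1 - z q^{j-1})`. -/
def qPoch (q z : ℝ) (m : ℕ) : ℝ := ∏ j ∈ Finset.range m, (1 - z * q ^ j)

/-- The `q`-binomial coefficient, equal to `0` unless `0 ≤ k ≤ m`. -/
def qBinom (q : ℝ) (m k : ℕ) : ℝ :=
  if k ≤ m then qPoch q q m / (qPoch q q k * qPoch q q (m - k)) else 0

/-- The size `|α| = α_1 + ⋯ + α_n`. -/
def size {n : ℕ} (α : Fin n → ℕ) : ℕ := ∑ i, α i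

/-- `φ(β, γ) = ∑_{i < j} β_i γ_j`. -/
def phiForm {n : ℕ} (β γ : Fin n → ℕ) : ℕ := ∑ i, ∑ j ∈ Finset.Ioi i, β i * γ j

/-- `Φ_q(γ | β; lam, mu)`. It vanishes unless `γ ≤ β` because of the `q`-binomials, so the
truncated subtractions are genuine ones wherever they matter. -/
def Phi {n : ℕ} (q lam mu : ℝ) (γ β : Fin n → ℕ) : ℝ :=
  q ^ phiForm (β - γ) γ * (mu / lam) ^ size γ *
    (qPoch q lam (size γ) * qPoch q (mu / lam) (size β - size γ) / qPoch q mu (size β)) *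
    ∏ i, qBinom q (β i) (γ i)

/-- The matrix element of the stochastic `R` matrix with incoming pair `α, β` and outgoing pair
`γ, δ`: the coefficient of `|γ⟩ ⊗ |δ⟩` in `S(lam, mu) (|α⟩ ⊗ |β⟩)`. -/
def stochR {n : ℕ} (q lam mu : ℝ) (α β γ δ : Fin n → ℕ) : ℝ :=
  if α + β = γ + δ then Phi q lam mu γ β else 0

/-- Basis vectors of `W^{⊗ L}`: `σ i a` is the number of particles of species `a` at site `i`. -/
abbrev State (n L : ℕ) : Type := Fin L → Fin n → ℕ

/-- The matrix element of the transfer matrix `T(lam | mu_1, …, mu_L)` from the state `β` to the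
state `α`, that is the coefficient of `|α⟩` in `T |β⟩`: the sum over the horizontal edge
variables `γ_1, …, γ_L`, with `γ_0 = γ_L`, of `∏_i S(lam, mu_i)_{γ_{i-1}, β_i}^{γ_i, α_i}`.
Only finitely many `γ` contribute since `γ_i ≤ β_i` is needed for a nonzero summand. -/
def transfer {n L : ℕ} (q lam : ℝ) (mu : Fin L → ℝ) (β α : State n L) : ℝ :=
  ∑ᶠ γ : State n L,
    ∏ i, stochR q lam (mu i) (γ ((finRotate L).symm i)) (β i) (γ i) (α i)

/-- The index set `S(m)` of the sector `m`. -/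
def sector {n : ℕ} (L : ℕ) (m : Fin n → ℕ) : Set (State n L) := {σ | ∑ i, σ i = m}

/-- `P ∈ W^{⊗ L}` is stationary: `T P = P`. -/
def IsStationary {n L : ℕ} (q lam : ℝ) (mu : Fin L → ℝ) (P : State n L →₀ ℝ) : Prop :=
  ∀ α : State n L, (P.sum fun β x => x * transfer q lam mu β α) = P α

/-! The Fock space `F` with basis `|m⟩`, realized as `ℕ →₀ ℝ`, and the `q`-boson operators. -/

/-- `b |m⟩ = |m + 1⟩`. -/
def bOp : Module.End ℝ (ℕ →₀ ℝ) :=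
  Finsupp.linearCombination ℝ fun m : ℕ => Finsupp.single (m + 1) (1 : ℝ)

/-- `c |m⟩ = (1 - q^m) |m - 1⟩`, which is `0` for `m = 0`. -/
def cOp (q : ℝ) : Module.End ℝ (ℕ →₀ ℝ) :=
  Finsupp.linearCombination ℝ fun m : ℕ => Finsupp.single (m - 1) (1 - q ^ m)

/-- `k |m⟩ = q^m |m⟩`. -/
def kOp (q : ℝ) : Module.End ℝ (ℕ →₀ ℝ) :=
  Finsupp.linearCombination ℝ fun m : ℕ => Finsupp.single m (q ^ m)

/-- The coefficient of `|s⟩` in `b^l k^a c^e |s'⟩`. -/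
def wordCoeff (q : ℝ) (l a e s s' : ℕ) : ℝ :=
  (bOp ^ l * kOp q ^ a * cOp q ^ e) (Finsupp.single s' 1) s

/-- The index set of the basis of `F^{⊗ n(n-1)/2}`. Passing from rank `n` to rank `n + 1`
adjoins `n` further tensor factors. -/
def FockIdx : ℕ → Type
  | 0 => Unit
  | n + 1 => FockIdx n × (Fin n → ℕ)

/-- `g_α(ζ) = ζ^{-|α|} (ζ)_{|α|} / ∏_i (q)_{α_i}`. -/
def gCoeff {n : ℕ} (q ζ : ℝ) (α : Fin n → ℕ) : ℝ :=
  (ζ ^ size α)⁻¹ * qPoch q ζ (size α) / ∏ i, qPoch q q (α i)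

/-- The matrix elements `⟨p| Z_α(ζ) |p'⟩` (coefficient of `|p⟩` in the image of `|p'⟩`) of the
operators defined by the recursion
`Z_{α_1, …, α_{n+1}}(ζ) = ∑_{l ∈ ℕ^n} g_l(ζ) Z_l(ζ) ⊗ b^{l_1} k^{α_1^+} c^{α_1} ⊗ ⋯
  ⊗ b^{l_n} k^{α_n^+} c^{α_n}`, where `α_i^+ = α_{i+1} + ⋯ + α_{n+1}`.
The recursion starts from the identity in rank `0`, so that in rank `1` it gives the identity of
the one-dimensional space. For given `p` and `p'` the sum over `l` is finite. -/
def zMat (q ζ : ℝ) : (n : ℕ) → (Fin n → ℕ) → FockIdx n → FockIdx n → ℝ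
  | 0, _, _, _ => 1
  | n + 1, α, (p, s), (p', s') =>
      ∑ᶠ l : Fin n → ℕ, gCoeff q ζ l * zMat q ζ n l p p' *
        ∏ i : Fin n,
          wordCoeff q (l i) (∑ j ∈ Finset.Ioi i.castSucc, α j) (α i.castSucc) (s i) (s' i)

/-- The matrix elements of `X_α(ζ) = g_α(ζ) Z_α(ζ)`. -/
def xMat (q ζ : ℝ) (n : ℕ) (α : Fin n → ℕ) (p p' : FockIdx n) : ℝ :=
  gCoeff q ζ α * zMat q ζ n α p p'

/-- The product of two infinite matrices (used for row-finite ones). -/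
def matMul {I : Type} (A B : I → I → ℝ) : I → I → ℝ := fun p r => ∑ᶠ s, A p s * B s r

open Classical in
/-- The identity matrix. -/
def matOne {I : Type} : I → I → ℝ := fun p r => if p = r then 1 else 0

/-- The matrix of `X_{σ_1}(mu_1) ⋯ X_{σ_L}(mu_L)`. -/
def xProd {n L : ℕ} (q : ℝ) (mu : Fin L → ℝ) (σ : State n L) : FockIdx n → FockIdx n → ℝ :=
  (List.ofFn fun i => xMat q (mu i) n (σ i)).foldr matMul matOne

/-- `Tr (X_{σ_1}(mu_1) ⋯ X_{σ_L}(mu_L))` over `F^{⊗ n(n-1)/2}`, the sum of the diagonal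
matrix elements. -/
def xTrace {n L : ℕ} (q : ℝ) (mu : Fin L → ℝ) (σ : State n L) : ℝ :=
  ∑' p : FockIdx n, xProd q mu σ p p

/-! The sums in the definition of the operators and of their products are finite. -/

theorem bOp_pow_apply (l : ℕ) (v : ℕ →₀ ℝ) (s : ℕ) :
    (bOp ^ l) v s = if l ≤ s then v (s - l) else 0 := by
  induction l generalizing v s with
  | zero => simp
  | succ l ih =>
    rw [pow_succ, Module.End.mul_apply, ih]
    induction v using Finsupp.induction_linear with
    | zero => simp
    | add f g hf hg =>
      rw [map_add, Finsupp.add_apply, Finsupp.add_apply]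
      split_ifs at * <;> simp_all
    | single m x =>
      simp only [bOp, Finsupp.linearCombination_single, Finsupp.smul_single, smul_eq_mul,
        mul_one, Finsupp.single_apply]
      split_ifs <;> first | rfl | omega

theorem kOp_pow_apply (q : ℝ) (a : ℕ) (v : ℕ →₀ ℝ) (s : ℕ) :
    (kOp q ^ a) v s = q ^ (a * s) * v s := by
  induction a generalizing v with
  | zero => simp
  | succ a ih =>
    rw [pow_succ, Module.End.mul_apply, ih]
    have h : kOp q v s = q ^ s * v s := by
      induction v using Finsupp.induction_linear with
      | zero => simp
      | add f g hf hg => rw [map_add, Finsupp.add_apply, Finsupp.add_apply, hf, hg, mul_add]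
      | single m x =>
        simp only [kOp, Finsupp.linearCombination_single, Finsupp.smul_single, smul_eq_mul,
          Finsupp.single_apply]
        split_ifs with hm
        · rw [hm, mul_comm]
        · simp
    rw [h, ← mul_assoc, ← pow_add, Nat.succ_mul]

theorem cOp_pow_single (q : ℝ) (e s' : ℕ) (x : ℝ) :
    (cOp q ^ e) (Finsupp.single s' x) = if e ≤ s' then
      Finsupp.single (s' - e) (x * ∏ t ∈ Finset.range e, (1 - q ^ (s' - t))) else 0 := by
  induction e with
  | zero => simp
  | succ e ih =>
    rw [pow_succ', Module.End.mul_apply, ih]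
    rcases lt_trichotomy s' e with h | h | h
    · rw [if_neg (by omega), if_neg (by omega), map_zero]
    · subst h
      rw [if_pos le_rfl, if_neg (by omega)]
      rw [cOp, Finsupp.linearCombination_single]
      simp
    · rw [if_pos (by omega), if_pos (by omega), cOp, Finsupp.linearCombination_single,
        Finsupp.smul_single, smul_eq_mul, Finset.prod_range_succ, mul_assoc, Nat.sub_sub]

/-- The coefficients of `b^l k^a c^e` in closed form. -/
theorem wordCoeff_eq (q : ℝ) (l a e s s' : ℕ) :
    wordCoeff q l a e s s' = if l ≤ s ∧ s' + l = s + e then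
      q ^ (a * (s - l)) * ∏ t ∈ Finset.range e, (1 - q ^ (s' - t)) else 0 := by
  rw [wordCoeff, Module.End.mul_apply, Module.End.mul_apply, bOp_pow_apply, kOp_pow_apply,
    cOp_pow_single]
  by_cases h1 : l ≤ s
  · by_cases h2 : e ≤ s'
    · by_cases h3 : s' - e = s - l
      · rw [if_pos h1, if_pos h2, if_pos ⟨h1, by omega⟩, h3, Finsupp.single_eq_same, one_mul]
      · rw [if_pos h1, if_pos h2, if_neg (by omega), Finsupp.single_apply, if_neg h3, mul_zero]
    · rw [if_pos h1, if_neg h2, if_neg (by omega)]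
      simp
  · rw [if_neg h1, if_neg (by tauto)]

/-- A nonzero summand in the recursion for `zMat` has `l ≤ s` and `s' + l = s + α`. -/
theorem zMat_term_ne_zero {q : ℝ} {n : ℕ} {α : Fin (n + 1) → ℕ} {l s s' : Fin n → ℕ} {x : ℝ}
    (h : x * ∏ i : Fin n, wordCoeff q (l i) (∑ j ∈ Finset.Ioi i.castSucc, α j)
      (α i.castSucc) (s i) (s' i) ≠ 0) (i : Fin n) :
    l i ≤ s i ∧ s' i + l i = s i + α i.castSucc := by
  have h1 := Finset.prod_ne_zero_iff.mp (right_ne_zero_of_mul h) i (Finset.mem_univ i)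
  rw [wordCoeff_eq] at h1
  exact of_not_not fun hc => h1 (if_neg hc)

theorem exists_ne_zero_of_finsum_ne {I : Type} {f : I → ℝ} (h : ∑ᶠ i, f i ≠ 0) : ∃ i, f i ≠ 0 := by
  by_contra! hc
  exact h (by simp [hc])

theorem zMat_sum_finite (q ζ : ℝ) (n : ℕ) (α : Fin (n + 1) → ℕ) (p p' : FockIdx n)
    (s s' : Fin n → ℕ) :
    (Function.support fun l : Fin n → ℕ => gCoeff q ζ l * zMat q ζ n l p p' *
      ∏ i : Fin n, wordCoeff q (l i) (∑ j ∈ Finset.Ioi i.castSucc, α j)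
        (α i.castSucc) (s i) (s' i)).Finite :=
  (Set.finite_Iic s).subset fun _ hl i => (zMat_term_ne_zero hl i).1

/-- The matrices `zMat` are row-finite. -/
theorem zMat_row_finite (q ζ : ℝ) (n : ℕ) (α : Fin n → ℕ) (p : FockIdx n) :
    {p' | zMat q ζ n α p p' ≠ 0}.Finite := by
  induction n with
  | zero => exact Set.Finite.subset (Set.finite_singleton ()) fun _ _ => rfl
  | succ n ih =>
    obtain ⟨p, s⟩ := p
    refine Set.Finite.subset (((Set.finite_Iic s).biUnion fun l _ => ih l p).prod
      (Set.finite_Iic fun i => s i + α i.castSucc)) ?_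
    rintro ⟨p', s'⟩ h
    obtain ⟨l, hl⟩ := exists_ne_zero_of_finsum_ne h
    refine ⟨Set.mem_biUnion (x := l) (fun i => (zMat_term_ne_zero hl i).1) ?_, fun i => ?_⟩
    · exact right_ne_zero_of_mul (left_ne_zero_of_mul hl)
    · have := (zMat_term_ne_zero hl i).2
      change s' i ≤ s i + α i.castSucc
      omega

theorem matMul_row_finite {I : Type} {A B : I → I → ℝ} (hA : ∀ p, {r | A p r ≠ 0}.Finite)
    (hB : ∀ p, {r | B p r ≠ 0}.Finite) (p : I) : {r | matMul A B p r ≠ 0}.Finite := by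
  refine ((hA p).biUnion fun s _ => hB s).subset fun r h => ?_
  obtain ⟨s, hs⟩ := exists_ne_zero_of_finsum_ne h
  exact Set.mem_biUnion (x := s) (left_ne_zero_of_mul hs) (right_ne_zero_of_mul hs)

theorem xProd_row_finite {n L : ℕ} (q : ℝ) (mu : Fin L → ℝ) (σ : State n L) (p : FockIdx n) :
    {r | xProd q mu σ p r ≠ 0}.Finite := by
  have hone (p : FockIdx n) : {r | matOne p r ≠ 0}.Finite :=
    (Set.finite_singleton p).subset fun r h => by
      by_contra hr
      exact h (if_neg fun hp => hr hp.symm)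
  unfold xProd
  induction L generalizing p with
  | zero => simpa using hone p
  | succ L ih =>
    rw [List.ofFn_succ, List.foldr_cons]
    refine matMul_row_finite (fun p => ?_) (fun p => ih (fun i => mu i.succ) (fun i => σ i.succ) p) p
    exact (zMat_row_finite q (mu 0) n (σ 0) p).subset fun r h => right_ne_zero_of_mul h

theorem transfer_sum_finite {n L : ℕ} (q lam : ℝ) (mu : Fin L → ℝ) (β α : State n L) :
    (Function.support fun γ : State n L =>
      ∏ i, stochR q lam (mu i) (γ ((finRotate L).symm i)) (β i) (γ i) (α i)).Finite := by
  refine (Set.finite_Iic β).subset fun γ h i a => ?_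
  have h1 := Finset.prod_ne_zero_iff.mp h i (Finset.mem_univ i)
  rw [stochR] at h1
  have h2 := Finset.prod_ne_zero_iff.mp (right_ne_zero_of_mul (ne_of_eq_of_ne
    (if_pos (of_not_not fun hc => h1 (if_neg hc))).symm h1 : Phi _ _ _ _ _ ≠ 0)) a (Finset.mem_univ a)
  exact of_not_not fun hc => h2 (if_neg hc)

end ZRP

end

/-!
Write `g_α(μ) D_α Z(μ)` for the operator `X_α(μ)`, where `D_α = ∏_i k_i^{α_i^+} c_i^{α_i}` acts on
the bosons adjoined last and `Z(μ) = Z_0(μ)`. All operators act on row vectors, so that a product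
of matrices becomes the product of the operators in the opposite order.

**Stationarity.** The operators `D_α` multiply up to powers of `q` (`dOp_mul`), hence
`Φ(γ | γ + ε; lam, μ) X_{γ + ε}(μ)` splits into a multiple of `D_γ`, which depends on `lam` but not
on `μ`, times a multiple of `D_ε Z(μ)` (`Phi_smul_xOp`). In the trace of a product over the sites
the edge operators `D_γ` can be shifted to the next site by cyclicity (`opTrace_edge`), and then
the sum over the edge variables factorizes over the sites. The factor at a site with
`α = γ + ε` particles after the transition is, by the Zamolodchikov-Faddeev relation
(`ZFData.zf_relation`), the conjugate `Z(lam) X_α(μ) Z(lam)⁻¹`; a further use of cyclicity removes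
the conjugation, and `T P = P` results (`sum_xTrace_mul_transfer`).

**The Zamolodchikov-Faddeev relation** is proved by induction on the rank. One has
`Z(ζ) = Y(1)⁻¹ Y(1/ζ)` with commuting invertible `Y(t)` that conjugate `D_j` to `D_j + t B_j`, and
`D = ∑ u_j D_j`, `B = ∑ u_j B_j` satisfy `B D = q D B` for commuting parameters `u_j`, here the
creation operators of the bosons adjoined in the next rank. This is recorded in `ZFData`. For such
`D` and `B` the quotients of `q`-exponentials `(X A_t)_∞ / (s X A_t)_∞` of `A_t = D + t B` satisfy
the exchange relation `qSeries_exchange`, a consequence of the factorization of the `q`-exponential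
of a sum of two `q`-commuting elements; its coefficients are the relation wanted. In the next rank,
`Y(t)` is multiplied by the `q`-exponential of `t ∑_k a_k b_k`, where `a_k = D_k + B_k`, and
`(1 - q) B_j` is the commutator of `∑_k a_k b_k` with `D_j`; the properties required of them are the
relations derived from `BosonRel`.

**The trace.** Cyclicity is not automatic for unbounded operators. A product of operators
`∑_l T_l ⊗ ∏_i b_i^{l_i} k_i^{α_i^+} c_i^{α_i}` has as its trace a finite sum of traces of rank `n`
times traces over single bosons (`hasSum_trace`). The latter are dominated by geometric series as
soon as the total charge `∑ α` has no vanishing component. So convergence, cyclicity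
(`isTraceClass_opClass`) and positivity (`opTrace_pos`) follow by induction on the rank.

**Uniqueness** is the Perron-Frobenius argument (`exists_eq_mul_of_fixed`): all weights `Φ(γ | β)`
with `γ ≤ β` are positive, and any state of a sector can be reached from any other one by way of the state with all
particles at one site (`reach_of_mem_sector`).
-/

open scoped BigOperators

noncomputable section

namespace ZRP

/-! ### Noncommutative `q`-exponential series -/

theorem qPoch_succ (q z : ℝ) (m : ℕ) : qPoch q z (m + 1) = qPoch q z m * (1 - z * q ^ m) :=
  Finset.prod_range_succ _ _

theorem qPoch_self_succ (q : ℝ) (m : ℕ) : qPoch q q (m + 1) = qPoch q q m * (1 - q ^ (m + 1)) := by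
  rw [qPoch_succ, pow_succ']

theorem qPoch_pos {q z : ℝ} (hq0 : 0 < q) (hq1 : q < 1) (hz : z < 1) (m : ℕ) :
    0 < qPoch q z m := by
  refine Finset.prod_pos fun j _ => ?_
  have h1 : q ^ j ≤ 1 := pow_le_one₀ hq0.le hq1.le
  have h2 : 0 < q ^ j := pow_pos hq0 j
  nlinarith

theorem qPoch_self_ne {q : ℝ} (hq0 : 0 < q) (hq1 : q < 1) (m : ℕ) : qPoch q q m ≠ 0 :=
  (qPoch_pos hq0 hq1 hq1 m).ne'

/-- The coefficients `∏_{j < N} (s - t q^j) / (q)_N` of the series `(t x)_∞ / (s x)_∞`. -/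
def hCoeff (q s t : ℝ) (N : ℕ) : ℝ := (∏ j ∈ Finset.range N, (s - t * q ^ j)) / qPoch q q N

theorem hCoeff_zero (q s t : ℝ) : hCoeff q s t 0 = 1 := by simp [hCoeff, qPoch]

theorem hCoeff_succ {q : ℝ} (hq0 : 0 < q) (hq1 : q < 1) (s t : ℝ) (N : ℕ) :
    (1 - q ^ (N + 1)) * hCoeff q s t (N + 1) = (s - t * q ^ N) * hCoeff q s t N := by
  have h1 := qPoch_self_ne hq0 hq1 N
  have h2 := qPoch_self_ne hq0 hq1 (N + 1)
  rw [hCoeff, hCoeff, Finset.prod_range_succ]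
  rw [qPoch_self_succ] at h2 ⊢
  have h3 := right_ne_zero_of_mul h2
  field_simp

theorem hCoeff_self (q s : ℝ) (N : ℕ) : hCoeff q s s N = if N = 0 then 1 else 0 := by
  rcases N with _ | N
  · simp [hCoeff_zero]
  · simp [hCoeff, Finset.prod_range_succ']

theorem hCoeff_smul (q c s t : ℝ) (N : ℕ) : hCoeff q (c * s) (c * t) N = c ^ N * hCoeff q s t N := by
  rw [hCoeff, hCoeff, ← mul_div_assoc]
  congr 1
  rw [← Finset.card_range N, ← Finset.prod_const, Finset.card_range, ← Finset.prod_mul_distrib]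
  exact Finset.prod_congr rfl fun j _ => by ring

/-- The `q`-binomial theorem: the functional equation `(1 - s X) φ(X) = (1 - t X) φ(q X)` has a
unique normalized solution, and is multiplicative in the parameter pairs. -/
theorem hCoeff_mul {q : ℝ} (hq0 : 0 < q) (hq1 : q < 1) (s t u : ℝ) :
    (PowerSeries.mk (hCoeff q s t) * PowerSeries.mk (hCoeff q t u) : PowerSeries ℝ) =
      PowerSeries.mk (hCoeff q s u) := by
  have key (s t : ℝ) : (1 - PowerSeries.C s * PowerSeries.X) * PowerSeries.mk (hCoeff q s t) =
      (1 - PowerSeries.C t * PowerSeries.X) *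
        PowerSeries.rescale q (PowerSeries.mk (hCoeff q s t)) := by
    ext N
    rcases N with _ | N
    · have h0 : PowerSeries.constantCoeff
          (PowerSeries.rescale q (PowerSeries.mk (hCoeff q s t))) = hCoeff q s t 0 := by
        rw [← PowerSeries.coeff_zero_eq_constantCoeff_apply, PowerSeries.coeff_rescale]
        simp
      simp [sub_mul, mul_assoc, h0]
    · simp only [sub_mul, one_mul, mul_assoc, map_sub, PowerSeries.coeff_C_mul,
        PowerSeries.coeff_succ_X_mul, PowerSeries.coeff_mk, PowerSeries.coeff_rescale]
      linear_combination hCoeff_succ hq0 hq1 s t N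
  set φ := (PowerSeries.mk (hCoeff q s t) * PowerSeries.mk (hCoeff q t u) : PowerSeries ℝ) with hφ
  have hfun : (1 - PowerSeries.C s * PowerSeries.X) * φ =
      (1 - PowerSeries.C u * PowerSeries.X) * PowerSeries.rescale q φ := by
    rw [hφ, ← mul_assoc, key s t, map_mul, mul_right_comm, mul_comm _ (PowerSeries.mk (hCoeff q t u)),
      ← mul_assoc, mul_comm (PowerSeries.mk (hCoeff q t u)), key t u]
    ring
  ext N
  rw [PowerSeries.coeff_mk]
  induction N with
  | zero => simp [hφ, hCoeff_zero]
  | succ N ih =>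
    have h1 := congrArg (PowerSeries.coeff (N + 1)) hfun
    simp only [sub_mul, one_mul, mul_assoc, map_sub, PowerSeries.coeff_C_mul,
        PowerSeries.coeff_succ_X_mul, PowerSeries.coeff_rescale] at h1
    have h2 : (1 - q ^ (N + 1)) ≠ 0 := (sub_pos.mpr (pow_lt_one₀ hq0.le hq1 (by omega))).ne'
    refine mul_left_cancel₀ h2 ?_
    rw [hCoeff_succ hq0 hq1, ← ih]
    linear_combination h1

section Algebra

variable {R : Type*} [Ring R] [Algebra ℝ R]

/-- The image of a scalar power series `p(X)` under `X ↦ x X`. -/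
def powSeries (x : R) (p : PowerSeries ℝ) : PowerSeries R :=
  PowerSeries.mk fun N => PowerSeries.coeff N p • x ^ N

theorem powSeries_mul (x : R) (p r : PowerSeries ℝ) :
    powSeries x (p * r) = powSeries x p * powSeries x r := by
  ext N
  simp only [powSeries, PowerSeries.coeff_mk, PowerSeries.coeff_mul, Finset.sum_smul]
  refine Finset.sum_congr rfl fun k hk => ?_
  rw [smul_mul_smul_comm, ← pow_add, Finset.HasAntidiagonal.mem_antidiagonal.mp hk]

/-- The series `∑_N ∏_{j < N} (s - t q^j) / (q)_N x^N X^N`, that is `(t x X)_∞ / (s x X)_∞`. -/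
def qSeries (q s t : ℝ) (x : R) : PowerSeries R := PowerSeries.mk fun N => hCoeff q s t N • x ^ N

theorem coeff_qSeries (q s t : ℝ) (x : R) (N : ℕ) :
    PowerSeries.coeff N (qSeries q s t x) = hCoeff q s t N • x ^ N := PowerSeries.coeff_mk _ _

theorem qSeries_eq_powSeries (q s t : ℝ) (x : R) :
    qSeries q s t x = powSeries x (PowerSeries.mk (hCoeff q s t)) := by
  ext N; simp [qSeries, powSeries]

theorem qSeries_mul {q : ℝ} (hq0 : 0 < q) (hq1 : q < 1) (s t u : ℝ) (x : R) :
    qSeries q s t x * qSeries q t u x = qSeries q s u x := by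
  simp only [qSeries_eq_powSeries, ← powSeries_mul, hCoeff_mul hq0 hq1]

theorem qSeries_comm (q s t u v : ℝ) (x : R) :
    qSeries q s t x * qSeries q u v x = qSeries q u v x * qSeries q s t x := by
  simp only [qSeries_eq_powSeries, ← powSeries_mul, mul_comm]

theorem qSeries_mul' {q : ℝ} (hq0 : 0 < q) (hq1 : q < 1) (s t u : ℝ) (x : R) :
    qSeries q t u x * qSeries q s t x = qSeries q s u x := by
  rw [qSeries_comm, qSeries_mul hq0 hq1]

theorem qSeries_self (q s : ℝ) (x : R) : qSeries q s s x = 1 := by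
  ext N
  rw [coeff_qSeries, hCoeff_self, PowerSeries.coeff_one]
  split_ifs with h <;> simp [h]

theorem qSeries_smul (q c s t : ℝ) (x : R) :
    qSeries q s t (c • x) = qSeries q (c * s) (c * t) x := by
  ext N
  rw [coeff_qSeries, coeff_qSeries, hCoeff_smul, smul_pow, smul_smul, mul_comm]

theorem pow_mul_qcomm {q : ℝ} {x y : R} (h : y * x = q • (x * y)) (l : ℕ) :
    y ^ l * x = q ^ l • (x * y ^ l) := by
  induction l with
  | zero => simp
  | succ l ih =>
    rw [pow_succ, mul_assoc, h, mul_smul_comm, ← mul_assoc, ih, smul_mul_assoc, smul_smul,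
      mul_assoc, pow_succ']

/-- The `q`-exponential of a sum of `q`-commuting elements factorizes. -/
theorem qSeries_add {q : ℝ} (hq0 : 0 < q) (hq1 : q < 1) (s : ℝ) {x y : R}
    (h : y * x = q • (x * y)) :
    qSeries q s 0 (x + y) = qSeries q s 0 x * qSeries q s 0 y := by
  have step (k : ℕ) : (1 - q ^ (k + 1)) * hCoeff q s 0 (k + 1) = s * hCoeff q s 0 k := by
    rw [hCoeff_succ hq0 hq1]; ring
  ext N
  rw [coeff_qSeries]
  induction N with
  | zero => simp [PowerSeries.coeff_mul, coeff_qSeries, hCoeff_zero]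
  | succ N ih =>
    have h2 : (1 - q ^ (N + 1)) ≠ 0 := (sub_pos.mpr (pow_lt_one₀ hq0.le hq1 (by omega))).ne'
    rw [← smul_right_inj h2, smul_smul, step, mul_smul, pow_succ, ← smul_mul_assoc, ih,
      PowerSeries.coeff_mul, PowerSeries.coeff_mul, Finset.sum_mul, Finset.smul_sum,
      Finset.smul_sum]
    simp only [coeff_qSeries]
    have e1 : ∀ k ∈ Finset.HasAntidiagonal.antidiagonal (N + 1),
        (1 - q ^ (N + 1)) • ((hCoeff q s 0 k.1 • x ^ k.1) * (hCoeff q s 0 k.2 • y ^ k.2)) =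
        (q ^ k.2 * ((1 - q ^ k.1) * hCoeff q s 0 k.1) * hCoeff q s 0 k.2) • (x ^ k.1 * y ^ k.2) +
        (hCoeff q s 0 k.1 * ((1 - q ^ k.2) * hCoeff q s 0 k.2)) • (x ^ k.1 * y ^ k.2) := by
      intro k hk
      rw [← Finset.HasAntidiagonal.mem_antidiagonal.mp hk, smul_mul_smul_comm, smul_smul,
        ← add_smul]
      congr 1
      ring
    rw [Finset.sum_congr rfl e1, Finset.sum_add_distrib, Finset.Nat.sum_antidiagonal_succ,
      Finset.Nat.sum_antidiagonal_succ' (n := N) (f := fun k => (hCoeff q s 0 k.1 *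
        ((1 - q ^ k.2) * hCoeff q s 0 k.2)) • (x ^ k.1 * y ^ k.2))]
    simp only [pow_zero, sub_self, zero_mul, mul_zero, zero_smul, zero_add, step]
    rw [← Finset.sum_add_distrib]
    refine Finset.sum_congr rfl fun k _ => ?_
    rw [smul_mul_smul_comm, mul_add, smul_mul_assoc, smul_mul_assoc, mul_assoc (x ^ k.1) _ x,
      pow_mul_qcomm h, mul_smul_comm, ← mul_assoc, ← pow_succ, mul_assoc, ← pow_succ, smul_add,
      smul_smul, smul_smul, smul_smul]
    congr 2 <;> ring

/-- With `A_t = D + t B` and `B D = q D B`, the quotients of `q`-exponentials of the `A_t` for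
different `t` satisfy an exchange relation. It follows from `e(c A_t) = e(c D) e(c t B)`. -/
theorem qSeries_exchange {q : ℝ} (hq0 : 0 < q) (hq1 : q < 1) {D B : R}
    (h : B * D = q • (D * B)) (s t : ℝ) :
    qSeries q s 1 (D + t • B) = qSeries q s t (D + B) * qSeries q t 1 (D + s • B) := by
  have fac (c u : ℝ) : qSeries q c 0 (D + u • B) = qSeries q c 0 D * qSeries q (c * u) 0 B := by
    have h1 : u • B * D = q • (D * u • B) := by
      rw [smul_mul_assoc, h, mul_smul_comm, smul_comm]
    rw [qSeries_add hq0 hq1 c h1, qSeries_smul, mul_zero, mul_comm c u]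
  have fac1 (c : ℝ) : qSeries q c 0 (D + B) = qSeries q c 0 D * qSeries q c 0 B := by
    simpa using fac c 1
  have inv (u : ℝ) : qSeries q u 0 B = qSeries q 0 1 D * qSeries q 1 0 (D + u • B) := by
    rw [fac, ← mul_assoc, qSeries_mul hq0 hq1, qSeries_self, one_mul, one_mul]
  have hcan : qSeries q 0 t (D + B) * qSeries q t 0 (D + B) = 1 := by
    rw [qSeries_mul hq0 hq1, qSeries_self]
  have key : qSeries q t 0 (D + B) * qSeries q s 1 (D + t • B) =
      qSeries q t 0 (D + B) * (qSeries q s t (D + B) * qSeries q t 1 (D + s • B)) := by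
    rw [← mul_assoc (qSeries q t 0 (D + B)), qSeries_mul' hq0 hq1, fac1, fac1, inv t, inv s]
    simp only [mul_assoc]
    rw [qSeries_mul' hq0 hq1, qSeries_mul' hq0 hq1, fac, fac]
    simp only [← mul_assoc]
    rw [mul_comm t s]
    congr 1
    simp only [qSeries_eq_powSeries, ← powSeries_mul]
    congr 1
    ring
  rw [← one_mul (qSeries q s 1 _), ← hcan, mul_assoc, key, ← mul_assoc, hcan, one_mul]

end Algebra

/-! ### Evaluation of operator series along a filtration -/

section Filtration

variable {V V' : Type*} [AddCommGroup V] [Module ℝ V] [AddCommGroup V'] [Module ℝ V']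

/-- An exhaustive increasing filtration that starts from `0`. -/
structure IsExhaustive (F : ℕ → Submodule ℝ V) : Prop where
  zero : F 0 = ⊥
  mono : Monotone F
  exists_mem : ∀ v, ∃ k, v ∈ F k

/-- The coefficient of `X^N` lowers the filtration degree by `N`. -/
def Lowers (F : ℕ → Submodule ℝ V) (φ : PowerSeries (Module.End ℝ V)) : Prop :=
  ∀ N k v, v ∈ F k → PowerSeries.coeff N φ v ∈ F (k - N)

variable {F : ℕ → Submodule ℝ V} {φ ψ : PowerSeries (Module.End ℝ V)}

theorem Lowers.coeff_eq_zero (hF : IsExhaustive F) (hφ : Lowers F φ) {N k : ℕ} {v : V}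
    (hv : v ∈ F k) (hk : k ≤ N) : PowerSeries.coeff N φ v = 0 := by
  have h := hφ N k v hv
  rwa [Nat.sub_eq_zero_of_le hk, hF.zero, Submodule.mem_bot] at h

theorem Lowers.finsum_eq (hF : IsExhaustive F) (hφ : Lowers F φ) {k : ℕ} {v : V}
    (hv : v ∈ F k) :
    ∑ᶠ N, PowerSeries.coeff N φ v = ∑ N ∈ Finset.range k, PowerSeries.coeff N φ v := by
  refine finsum_eq_sum_of_support_subset _ fun N hN => ?_
  rw [Finset.coe_range, Set.mem_Iio]
  by_contra hc
  exact hN (hφ.coeff_eq_zero hF hv (not_lt.mp hc))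

open Classical in
/-- The value at `X = 1` of a series of operators that lowers an exhaustive filtration: on each
vector the sum is finite. Series that do not lower the filtration are sent to `0`. -/
def evalOne (F : ℕ → Submodule ℝ V) (φ : PowerSeries (Module.End ℝ V)) : Module.End ℝ V :=
  if h : IsExhaustive F ∧ Lowers F φ then
    { toFun := fun v => ∑ᶠ N, PowerSeries.coeff N φ v
      map_add' := fun v w => by
        obtain ⟨k, hk⟩ := h.1.exists_mem v
        obtain ⟨l, hl⟩ := h.1.exists_mem w
        have hv := h.1.mono (le_max_left k l) hk
        have hw := h.1.mono (le_max_right k l) hl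
        rw [h.2.finsum_eq h.1 hv, h.2.finsum_eq h.1 hw, h.2.finsum_eq h.1 (add_mem hv hw),
          ← Finset.sum_add_distrib]
        simp
      map_smul' := fun c v => by
        obtain ⟨k, hk⟩ := h.1.exists_mem v
        rw [h.2.finsum_eq h.1 hk, h.2.finsum_eq h.1 (Submodule.smul_mem _ c hk),
          Finset.smul_sum]
        simp }
  else 0

theorem evalOne_apply (hF : IsExhaustive F) (hφ : Lowers F φ) {k : ℕ} {v : V} (hv : v ∈ F k) :
    evalOne F φ v = ∑ N ∈ Finset.range k, PowerSeries.coeff N φ v := by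
  rw [evalOne, dif_pos ⟨hF, hφ⟩, ← hφ.finsum_eq hF hv]
  rfl

theorem Lowers.mul (hφ : Lowers F φ) (hψ : Lowers F ψ) : Lowers F (φ * ψ) := by
  intro N k v hv
  rw [PowerSeries.coeff_mul, LinearMap.sum_apply]
  refine Submodule.sum_mem _ fun p hp => ?_
  have h := hφ p.1 _ _ (hψ p.2 k v hv)
  rwa [Nat.sub_sub, add_comm p.2, Finset.HasAntidiagonal.mem_antidiagonal.mp hp] at h

theorem evalOne_mul (hF : IsExhaustive F) (hφ : Lowers F φ) (hψ : Lowers F ψ) :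
    evalOne F (φ * ψ) = evalOne F φ * evalOne F ψ := by
  ext v
  obtain ⟨k, hk⟩ := hF.exists_mem v
  rw [Module.End.mul_apply, evalOne_apply hF hψ hk, evalOne_apply hF (hφ.mul hψ) hk, map_sum]
  have h1 : ∀ M ∈ Finset.range k, evalOne F φ (PowerSeries.coeff M ψ v) =
      ∑ N ∈ Finset.range (k - M), PowerSeries.coeff N φ (PowerSeries.coeff M ψ v) :=
    fun M _ => evalOne_apply hF hφ (hψ M k v hk)
  rw [Finset.sum_congr rfl h1, ← Finset.sum_range_diag_flip]
  refine Finset.sum_congr rfl fun N _ => ?_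
  rw [PowerSeries.coeff_mul, LinearMap.sum_apply,
    ← Finset.Nat.sum_antidiagonal_swap, Finset.Nat.sum_antidiagonal_eq_sum_range_succ_mk]
  rfl

theorem Lowers.one : Lowers F 1 := by
  intro N k v hv
  rw [PowerSeries.coeff_one]
  split_ifs with h
  · simpa [h] using hv
  · exact zero_mem _

theorem evalOne_one (hF : IsExhaustive F) : evalOne F (1 : PowerSeries (Module.End ℝ V)) = 1 := by
  ext v
  obtain ⟨k, hk⟩ := hF.exists_mem v
  rw [evalOne_apply hF Lowers.one (hF.mono (Nat.le_succ k) hk), Finset.sum_range_succ']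
  simp [PowerSeries.coeff_one]

/-- Coefficientwise intertwining passes to the values. -/
theorem evalOne_intertwine {F' : ℕ → Submodule ℝ V'} {ψ : PowerSeries (Module.End ℝ V')}
    (hF : IsExhaustive F) (hF' : IsExhaustive F')
    (hφ : Lowers F φ) (hψ : Lowers F' ψ) {T : V →ₗ[ℝ] V'}
    (h : ∀ N, T ∘ₗ PowerSeries.coeff N φ = PowerSeries.coeff N ψ ∘ₗ T) :
    T ∘ₗ evalOne F φ = evalOne F' ψ ∘ₗ T := by
  ext v
  obtain ⟨k, hk⟩ := hF.exists_mem v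
  obtain ⟨l, hl⟩ := hF'.exists_mem (T v)
  rw [LinearMap.comp_apply, LinearMap.comp_apply,
    evalOne_apply hF hφ (hF.mono (le_max_left k l) hk),
    evalOne_apply hF' hψ (hF'.mono (le_max_right k l) hl), map_sum]
  exact Finset.sum_congr rfl fun N _ => LinearMap.congr_fun (h N) v

theorem pow_lowers {x : Module.End ℝ V} (hx : ∀ k v, v ∈ F (k + 1) → x v ∈ F k)
    (hF : IsExhaustive F) (N k : ℕ) (v : V) (hv : v ∈ F k) : (x ^ N) v ∈ F (k - N) := by
  induction N generalizing v k with
  | zero => simpa using hv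
  | succ N ih =>
    rw [pow_succ, Module.End.mul_apply]
    rcases k with _ | k
    · rw [hF.zero, Submodule.mem_bot] at hv
      simp [hv]
    · simpa using ih k _ (hx k v hv)

theorem lowers_qSeries {x : Module.End ℝ V} (hx : ∀ k v, v ∈ F (k + 1) → x v ∈ F k)
    (hF : IsExhaustive F) (q s t : ℝ) : Lowers F (qSeries q s t x) := by
  intro N k v hv
  rw [coeff_qSeries, LinearMap.smul_apply]
  exact Submodule.smul_mem _ _ (pow_lowers hx hF N k v hv)

end Filtration

/-! ### Operators on the space obtained by adjoining bosons -/

section Fock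

variable {I : Type} {n : ℕ} {X : Type*} [AddCommGroup X] [Module ℝ X]

/-- The embedding `v ↦ v ⊗ ⟨s|`. -/
def embed (s : Fin n → ℕ) : (I →₀ ℝ) →ₗ[ℝ] (I × (Fin n → ℕ) →₀ ℝ) :=
  Finsupp.lmapDomain ℝ ℝ fun p => (p, s)

@[simp] theorem embed_single (s : Fin n → ℕ) (p : I) (c : ℝ) :
    embed s (Finsupp.single p c) = Finsupp.single (p, s) c := Finsupp.mapDomain_single

theorem embed_apply_same (s : Fin n → ℕ) (v : I →₀ ℝ) (p : I) : embed s v (p, s) = v p :=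
  Finsupp.mapDomain_apply (f := fun p : I => (p, s)) (fun _ _ h => congrArg Prod.fst h) v p

theorem embed_apply_ne {s s' : Fin n → ℕ} (h : s' ≠ s) (v : I →₀ ℝ) (p : I) :
    embed s v (p, s') = 0 :=
  Finsupp.mapDomain_of_notMem_range v _ fun ⟨_, hx⟩ => h (congrArg Prod.snd hx).symm

/-- The linear map that is `f s` on the vectors `v ⊗ ⟨s|`. -/
def glue (f : (Fin n → ℕ) → (I →₀ ℝ) →ₗ[ℝ] X) : (I × (Fin n → ℕ) →₀ ℝ) →ₗ[ℝ] X :=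
  Finsupp.linearCombination ℝ fun ps : I × (Fin n → ℕ) => f ps.2 (Finsupp.single ps.1 1)

@[simp] theorem glue_embed (f : (Fin n → ℕ) → (I →₀ ℝ) →ₗ[ℝ] X) (s : Fin n → ℕ) (v : I →₀ ℝ) :
    glue f (embed s v) = f s v := by
  have h : glue f ∘ₗ embed s = f s := by
    refine Finsupp.lhom_ext fun p c => ?_
    rw [LinearMap.comp_apply, embed_single, glue, Finsupp.linearCombination_single, ← map_smul,
      Finsupp.smul_single, smul_eq_mul, mul_one]
  exact LinearMap.congr_fun h v

theorem embed_ext {A B : (I × (Fin n → ℕ) →₀ ℝ) →ₗ[ℝ] X}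
    (h : ∀ s v, A (embed s v) = B (embed s v)) : A = B := by
  refine Finsupp.lhom_ext fun ⟨p, s⟩ c => ?_
  rw [← embed_single, h]

/-- `T ⊗ 1`. -/
def lift (T : Module.End ℝ (I →₀ ℝ)) : Module.End ℝ (I × (Fin n → ℕ) →₀ ℝ) :=
  glue fun s => embed s ∘ₗ T

@[simp] theorem lift_embed (T : Module.End ℝ (I →₀ ℝ)) (s : Fin n → ℕ) (v : I →₀ ℝ) :
    lift T (embed s v) = embed s (T v) := glue_embed _ _ _

theorem lift_one : (lift 1 : Module.End ℝ (I × (Fin n → ℕ) →₀ ℝ)) = 1 :=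
  embed_ext fun s v => by simp

theorem lift_mul (S T : Module.End ℝ (I →₀ ℝ)) :
    (lift (S * T) : Module.End ℝ (I × (Fin n → ℕ) →₀ ℝ)) = lift S * lift T :=
  embed_ext fun s v => by simp

theorem lift_add (S T : Module.End ℝ (I →₀ ℝ)) :
    (lift (S + T) : Module.End ℝ (I × (Fin n → ℕ) →₀ ℝ)) = lift S + lift T :=
  embed_ext fun s v => by simp

theorem lift_smul (c : ℝ) (T : Module.End ℝ (I →₀ ℝ)) :
    (lift (c • T) : Module.End ℝ (I × (Fin n → ℕ) →₀ ℝ)) = c • lift T :=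
  embed_ext fun s v => by simp

open Classical in
/-- The product `∏_i b_i^{l_i}` acting on row vectors: `⟨s| ↦ ⟨s - l|`. -/
def lower (l : Fin n → ℕ) : Module.End ℝ (I × (Fin n → ℕ) →₀ ℝ) :=
  glue fun s => if l ≤ s then embed (s - l) else 0

open Classical in
theorem lower_embed (l s : Fin n → ℕ) (v : I →₀ ℝ) :
    lower l (embed s v) = if l ≤ s then embed (s - l) v else 0 := by
  rw [lower, glue_embed]
  split_ifs <;> rfl

theorem lower_zero : (lower 0 : Module.End ℝ (I × (Fin n → ℕ) →₀ ℝ)) = 1 :=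
  embed_ext fun s v => by rw [lower_embed, if_pos (zero_le (a := s)), tsub_zero]; rfl

theorem lower_mul (l l' : Fin n → ℕ) :
    (lower l * lower l' : Module.End ℝ (I × (Fin n → ℕ) →₀ ℝ)) = lower (l' + l) := by
  refine embed_ext fun s v => ?_
  rw [Module.End.mul_apply, lower_embed, lower_embed]
  by_cases h : l' ≤ s
  · rw [if_pos h, lower_embed]
    by_cases h2 : l ≤ s - l'
    · rw [if_pos h2, if_pos, tsub_tsub]
      intro i; have := h i; have := h2 i; simp only [Pi.add_apply, Pi.sub_apply] at *; omega
    · rw [if_neg h2, if_neg]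
      refine fun h3 => h2 fun i => ?_
      have := h3 i; simp only [Pi.add_apply, Pi.sub_apply] at *; omega
  · rw [if_neg h, map_zero, if_neg]
    exact fun h3 => h fun i => le_trans (Nat.le_add_right _ _) (h3 i)

theorem lower_lift (l : Fin n → ℕ) (T : Module.End ℝ (I →₀ ℝ)) :
    lower l * lift T = lift T * lower l := by
  refine embed_ext fun s v => ?_
  rw [Module.End.mul_apply, Module.End.mul_apply, lift_embed, lower_embed, lower_embed]
  split_ifs <;> simp

/-! The filtration by the total number of quanta in the new bosons. -/

theorem size_add (α β : Fin n → ℕ) : size (α + β) = size α + size β := Finset.sum_add_distrib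

theorem size_single (i : Fin n) : size (Pi.single i 1 : Fin n → ℕ) = 1 := by
  simp [size]

/-- The vectors with less than `k` quanta in the adjoined bosons. -/
def degFilt (I : Type) (n k : ℕ) : Submodule ℝ (I × (Fin n → ℕ) →₀ ℝ) :=
  Finsupp.supported ℝ ℝ {ps | size ps.2 < k}

theorem embed_mem_degFilt {s : Fin n → ℕ} {k : ℕ} (h : size s < k) (v : I →₀ ℝ) :
    embed s v ∈ degFilt I n k := by
  rw [degFilt, Finsupp.mem_supported']
  rintro ⟨p, s'⟩ hs
  refine embed_apply_ne (fun e => hs ?_) v p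
  simpa [e] using h

theorem degFilt_exhaustive : IsExhaustive (degFilt I n) where
  zero := by simp [degFilt]
  mono k l h := Finsupp.supported_mono fun ps hps => lt_of_lt_of_le hps h
  exists_mem v := by
    refine ⟨v.support.sup (fun ps => size ps.2) + 1, ?_⟩
    rw [degFilt, Finsupp.mem_supported]
    exact fun ps hps => Nat.lt_succ_of_le (Finset.le_sup (f := fun ps : I × _ => size ps.2) hps)

theorem map_degFilt {A : (I × (Fin n → ℕ) →₀ ℝ) →ₗ[ℝ] X} {k : ℕ} {M : Submodule ℝ X}
    (h : ∀ s v, size s < k → A (embed s v) ∈ M) {w : I × (Fin n → ℕ) →₀ ℝ}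
    (hw : w ∈ degFilt I n k) : A w ∈ M := by
  rw [degFilt, Finsupp.supported_eq_span_single] at hw
  revert w
  change _ ≤ M.comap A
  rw [Submodule.span_le]
  rintro _ ⟨⟨p, s⟩, hs, rfl⟩
  change A (Finsupp.single (p, s) 1) ∈ M
  rw [← embed_single]
  exact h s _ hs

/-- The position operator `∑_k a_k b_k`. -/
def linOp (a : Fin n → Module.End ℝ (I →₀ ℝ)) : Module.End ℝ (I × (Fin n → ℕ) →₀ ℝ) :=
  ∑ k, lower (Pi.single k 1) * lift (a k)

theorem single_le_iff {k : Fin n} {s : Fin n → ℕ} : Pi.single k 1 ≤ s ↔ 1 ≤ s k := by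
  constructor
  · intro h; simpa using h k
  · intro h i
    by_cases hi : i = k
    · subst hi; simpa using h
    · simp [hi]

theorem linOp_degFilt (a : Fin n → Module.End ℝ (I →₀ ℝ)) (k : ℕ)
    (w : I × (Fin n → ℕ) →₀ ℝ) (hw : w ∈ degFilt I n (k + 1)) : linOp a w ∈ degFilt I n k := by
  refine map_degFilt (fun s v hs => ?_) hw
  rw [linOp, LinearMap.sum_apply]
  refine Submodule.sum_mem _ fun i _ => ?_
  rw [Module.End.mul_apply, lift_embed, lower_embed]
  split_ifs with h
  · refine embed_mem_degFilt ?_ _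
    have h1 := size_add (s - Pi.single i 1) (Pi.single i 1)
    rw [tsub_add_cancel_of_le h, size_single] at h1
    omega
  · exact zero_mem _

/-- `(t x)_∞ / (s x)_∞` for `x = ∑_k a_k b_k`. -/
def linSeries (q s t : ℝ) (a : Fin n → Module.End ℝ (I →₀ ℝ)) :
    Module.End ℝ (I × (Fin n → ℕ) →₀ ℝ) :=
  evalOne (degFilt I n) (qSeries q s t (linOp a))

theorem lowers_linOp (q s t : ℝ) (a : Fin n → Module.End ℝ (I →₀ ℝ)) :
    Lowers (degFilt I n) (qSeries q s t (linOp a)) :=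
  lowers_qSeries (linOp_degFilt a) degFilt_exhaustive q s t

theorem linSeries_apply (q s t : ℝ) (a : Fin n → Module.End ℝ (I →₀ ℝ)) {k : ℕ}
    {w : I × (Fin n → ℕ) →₀ ℝ} (hw : w ∈ degFilt I n k) :
    linSeries q s t a w = ∑ N ∈ Finset.range k, hCoeff q s t N • (linOp a ^ N) w := by
  rw [linSeries, evalOne_apply degFilt_exhaustive (lowers_linOp _ _ _ _) hw]
  exact Finset.sum_congr rfl fun N _ => LinearMap.congr_fun (coeff_qSeries q s t (linOp a) N) w

theorem linSeries_mul {q : ℝ} (hq0 : 0 < q) (hq1 : q < 1) (s t u : ℝ)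
    (a : Fin n → Module.End ℝ (I →₀ ℝ)) :
    linSeries q s t a * linSeries q t u a = linSeries q s u a := by
  rw [linSeries, linSeries, ← evalOne_mul degFilt_exhaustive (lowers_linOp _ _ _ _) (lowers_linOp _ _ _ _),
    qSeries_mul hq0 hq1, linSeries]

theorem linSeries_self (q s : ℝ) (a : Fin n → Module.End ℝ (I →₀ ℝ)) :
    linSeries q s s a = 1 := by
  rw [linSeries, qSeries_self, evalOne_one degFilt_exhaustive]

theorem linSeries_comm (q s t u v : ℝ) (a : Fin n → Module.End ℝ (I →₀ ℝ)) :
    linSeries q s t a * linSeries q u v a = linSeries q u v a * linSeries q s t a := by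
  simp only [linSeries, ← evalOne_mul degFilt_exhaustive (lowers_linOp _ _ _ _) (lowers_linOp _ _ _ _)]
  rw [qSeries_comm]

theorem linSeries_intertwine (q s t : ℝ) {a a' : Fin n → Module.End ℝ (I →₀ ℝ)}
    {T : Module.End ℝ (I →₀ ℝ)} (h : ∀ k, T * a k = a' k * T) :
    lift T * linSeries q s t a = linSeries q s t a' * lift T := by
  have h1 : lift T * linOp a = linOp a' * lift T := by
    rw [linOp, linOp, Finset.mul_sum, Finset.sum_mul]
    refine Finset.sum_congr rfl fun k _ => ?_
    rw [← mul_assoc, ← lower_lift, mul_assoc, ← lift_mul, h, lift_mul, ← mul_assoc]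
  refine evalOne_intertwine degFilt_exhaustive degFilt_exhaustive (lowers_linOp _ _ _ _)
    (lowers_linOp _ _ _ _) fun N => ?_
  have h2 := (SemiconjBy.pow_right (show SemiconjBy (lift T) (linOp a) (linOp a') from h1) N).eq
  have h3 : lift T * (hCoeff q s t N • linOp a ^ N) = (hCoeff q s t N • linOp a' ^ N) * lift T := by
    rw [mul_smul_comm, smul_mul_assoc, h2]
  exact (congrArg (lift T * ·) (coeff_qSeries q s t (linOp a) N)).trans
    (h3.trans (congrArg (· * lift T) (coeff_qSeries q s t (linOp a') N)).symm)

theorem linOp_add_smul (a b : Fin n → Module.End ℝ (I →₀ ℝ)) (c : ℝ) :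
    linOp (fun k => a k + c • b k) = linOp a + c • linOp b := by
  simp only [linOp, lift_add, lift_smul, mul_add, mul_smul_comm, Finset.sum_add_distrib,
    Finset.smul_sum]

theorem linOp_mul (a b : Fin n → Module.End ℝ (I →₀ ℝ)) :
    linOp a * linOp b = ∑ i, ∑ j, lower (Pi.single i 1 + Pi.single j 1) * lift (a i * b j) := by
  rw [linOp, linOp, Finset.sum_mul_sum]
  refine Finset.sum_congr rfl fun i _ => Finset.sum_congr rfl fun j _ => ?_
  rw [mul_assoc, ← mul_assoc (lift (a i)), ← lower_lift, mul_assoc, ← mul_assoc, lower_mul,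
    lift_mul, add_comm]

/-- The polarized relation between `D` and `B` is the `q`-commutation of the generic linear
combinations. -/
theorem linOp_qcomm {q : ℝ} {d b : Fin n → Module.End ℝ (I →₀ ℝ)}
    (h : ∀ i j, b j * d i + b i * d j = q • (d j * b i + d i * b j)) :
    linOp b * linOp d = q • (linOp d * linOp b) := by
  have sym (f : Fin n → Fin n → Module.End ℝ (I →₀ ℝ)) :
      (2 : ℝ) • ∑ i, ∑ j, lower (Pi.single i 1 + Pi.single j 1) * lift (f i j) =
        (∑ i, ∑ j, lower (Pi.single i 1 + Pi.single j 1) * lift (f j i + f i j) :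
          Module.End ℝ (I × (Fin n → ℕ) →₀ ℝ)) := by
    simp only [lift_add, mul_add, Finset.sum_add_distrib]
    rw [two_smul]
    congr 1
    rw [Finset.sum_comm]
    exact Finset.sum_congr rfl fun i _ => Finset.sum_congr rfl fun j _ => by rw [add_comm]
  have h2 : (2 : ℝ) ≠ 0 := two_ne_zero
  rw [← smul_right_inj h2, smul_comm, linOp_mul, linOp_mul, sym (fun i j => b i * d j),
    sym (fun i j => d i * b j), Finset.smul_sum]
  refine Finset.sum_congr rfl fun i _ => ?_
  rw [Finset.smul_sum]
  refine Finset.sum_congr rfl fun j _ => ?_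
  rw [h i j, lift_smul, mul_smul_comm]

/-- The exchange relation of `qSeries_exchange` for the generic linear combinations. -/
theorem linSeries_exchange {q : ℝ} (hq0 : 0 < q) (hq1 : q < 1)
    {d b : Fin n → Module.End ℝ (I →₀ ℝ)}
    (h : ∀ i j, b j * d i + b i * d j = q • (d j * b i + d i * b j)) (s t : ℝ) :
    linSeries q s 1 (fun k => d k + t • b k) =
      linSeries q s t (fun k => d k + (1 : ℝ) • b k) * linSeries q t 1 (fun k => d k + s • b k) := by
  rw [linSeries, linSeries, linSeries,
    ← evalOne_mul degFilt_exhaustive (lowers_linOp _ _ _ _) (lowers_linOp _ _ _ _)]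
  simp only [linOp_add_smul]
  rw [one_smul, qSeries_exchange hq0 hq1 (linOp_qcomm h)]

theorem linSeries_add {q : ℝ} (hq0 : 0 < q) (hq1 : q < 1)
    {d b : Fin n → Module.End ℝ (I →₀ ℝ)}
    (h : ∀ i j, b j * d i + b i * d j = q • (d j * b i + d i * b j)) (s t : ℝ) :
    linSeries q s 0 (fun k => d k + t • b k) =
      linSeries q s 0 d * linSeries q (s * t) 0 b := by
  have h1 : t • linOp b * linOp d = q • (linOp d * t • linOp b) := by
    rw [smul_mul_assoc, linOp_qcomm h, mul_smul_comm, smul_comm]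
  have h2 : qSeries q (s * t) 0 (linOp b) = qSeries q s 0 (t • linOp b) := by
    rw [qSeries_smul, mul_zero, mul_comm]
  rw [linSeries, linSeries, linSeries,
    ← evalOne_mul degFilt_exhaustive (lowers_linOp _ _ _ _) (lowers_linOp _ _ _ _), linOp_add_smul,
    qSeries_add hq0 hq1 s h1, h2]

end Fock

/-! ### Consequences of the relations between the boson operators -/

section Serre

variable {R : Type*} [Ring R] [Algebra ℝ R] {m : ℕ}

/-- The relations between the operators `D_j`, the position operators `x_k = a_k b_k`, the
diagonal operators `κ_j` and the coefficients `a_k` of `x_k`. -/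
structure BosonRel (q : ℝ) (D x κ a : Fin m → R) : Prop where
  xD_lt : ∀ {k j}, k < j → x k * D j = q • (D j * x k)
  xD_gt : ∀ {k j}, j < k → x k * D j = D j * x k
  xD_eq : ∀ j, x j * D j = D j * x j + (1 - q) • (κ j * a j)
  aD : ∀ k j, a k * D j = D j * a k
  aκ : ∀ k j, a k * κ j = κ j * a k
  xx : ∀ {i j}, i < j → x j * x i = q • (x i * x j)
  ax : ∀ {i j}, i < j → a j * x i = q • (x i * a j)
  xa : ∀ {i j}, i < j → x j * a i = q • (a i * x j)
  xa_eq : ∀ j, x j * a j = a j * x j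
  xκ_le : ∀ {k j}, k ≤ j → x k * κ j = q • (κ j * x k)
  xκ_gt : ∀ {k j}, j < k → x k * κ j = κ j * x k
  κD_lt : ∀ {i j}, i < j → κ j * D i = q • (D i * κ j)
  κD_eq : ∀ i, κ i * D i * a i = q • (D i * κ i * a i)
  κD_gt : ∀ {i j}, j < i → κ j * D i = D i * κ j
  DD : ∀ {i j}, i < j → D j * D i = q • (D i * D j)

/-- The operator `B_j = κ_j a_j - D_j ∑_{k < j} x_k`. -/
def bElt (D x κ a : Fin m → R) (j : Fin m) : R := κ j * a j - D j * ∑ k ∈ Finset.Iio j, x k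

theorem sum_qcomm {s : Finset (Fin m)} {x : Fin m → R} {y : R} {c : ℝ}
    (h : ∀ k ∈ s, x k * y = c • (y * x k)) : (∑ k ∈ s, x k) * y = c • (y * ∑ k ∈ s, x k) := by
  rw [Finset.sum_mul, Finset.mul_sum, Finset.smul_sum]
  exact Finset.sum_congr rfl h

theorem sum_qcomm' {s : Finset (Fin m)} {x : Fin m → R} {y : R} {c : ℝ}
    (h : ∀ k ∈ s, y * x k = c • (x k * y)) : y * (∑ k ∈ s, x k) = c • ((∑ k ∈ s, x k) * y) := by
  rw [Finset.sum_mul, Finset.mul_sum, Finset.smul_sum]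
  exact Finset.sum_congr rfl h

omit [Algebra ℝ R] in
theorem sum_comm_mul {s : Finset (Fin m)} {x : Fin m → R} {y : R}
    (h : ∀ k ∈ s, x k * y = y * x k) : (∑ k ∈ s, x k) * y = y * ∑ k ∈ s, x k := by
  rw [Finset.sum_mul, Finset.mul_sum]
  exact Finset.sum_congr rfl h

omit [Algebra ℝ R] in
theorem sum_split (x : Fin m → R) (j : Fin m) :
    ∑ k, x k = ∑ k ∈ Finset.Iio j, x k + x j + ∑ k ∈ Finset.Ioi j, x k := by
  have h1 : (Finset.univ : Finset (Fin m)) = (insert j (Finset.Iio j)) ∪ Finset.Ioi j := by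
    ext k; simp; omega
  rw [h1, Finset.sum_union, Finset.sum_insert (by simp), add_comm (x j)]
  rw [Finset.disjoint_left]
  intro k; simp only [Finset.mem_insert, Finset.mem_Iio, Finset.mem_Ioi]; omega

variable {q : ℝ} {D x κ a : Fin m → R} (h : BosonRel q D x κ a)
include h

/-- The operator `B_j` is the commutator of `∑_k x_k` with `D_j`, up to the factor `1 - q`. -/
theorem BosonRel.sum_mul_D (j : Fin m) :
    (∑ k, x k) * D j = D j * ∑ k, x k + (1 - q) • bElt D x κ a j := by
  have h1 : (∑ k ∈ Finset.Iio j, x k) * D j = q • (D j * ∑ k ∈ Finset.Iio j, x k) :=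
    sum_qcomm fun k hk => h.xD_lt (Finset.mem_Iio.mp hk)
  have h2 : (∑ k ∈ Finset.Ioi j, x k) * D j = D j * ∑ k ∈ Finset.Ioi j, x k :=
    sum_comm_mul fun k hk => h.xD_gt (Finset.mem_Ioi.mp hk)
  rw [sum_split x j, bElt, add_mul, add_mul, h1, h2, h.xD_eq, mul_add, mul_add]
  module

/-- The operator `B_j` in turn `q`-commutes with `∑_k x_k`. The terms below, at and above `j` are
moved through `B_j` separately. -/
theorem BosonRel.sum_mul_bElt (j : Fin m) :
    (∑ k, x k) * bElt D x κ a j = q • (bElt D x κ a j * ∑ k, x k) := by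
  rw [sum_split x j, bElt]
  have PD : (∑ k ∈ Finset.Iio j, x k) * D j = q • (D j * ∑ k ∈ Finset.Iio j, x k) :=
    sum_qcomm fun k hk => h.xD_lt (Finset.mem_Iio.mp hk)
  have QD : (∑ k ∈ Finset.Ioi j, x k) * D j = D j * ∑ k ∈ Finset.Ioi j, x k :=
    sum_comm_mul fun k hk => h.xD_gt (Finset.mem_Ioi.mp hk)
  have Pκ : (∑ k ∈ Finset.Iio j, x k) * κ j = q • (κ j * ∑ k ∈ Finset.Iio j, x k) :=
    sum_qcomm fun k hk => h.xκ_le (Finset.mem_Iio.mp hk).le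
  have Qκ : (∑ k ∈ Finset.Ioi j, x k) * κ j = κ j * ∑ k ∈ Finset.Ioi j, x k :=
    sum_comm_mul fun k hk => h.xκ_gt (Finset.mem_Ioi.mp hk)
  have aP : a j * (∑ k ∈ Finset.Iio j, x k) = q • ((∑ k ∈ Finset.Iio j, x k) * a j) :=
    sum_qcomm' fun k hk => h.ax (Finset.mem_Iio.mp hk)
  have Qa : (∑ k ∈ Finset.Ioi j, x k) * a j = q • (a j * ∑ k ∈ Finset.Ioi j, x k) :=
    sum_qcomm fun k hk => h.xa (Finset.mem_Ioi.mp hk)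
  have xP : x j * (∑ k ∈ Finset.Iio j, x k) = q • ((∑ k ∈ Finset.Iio j, x k) * x j) :=
    sum_qcomm' fun k hk => h.xx (Finset.mem_Iio.mp hk)
  have QP : (∑ k ∈ Finset.Ioi j, x k) * (∑ k ∈ Finset.Iio j, x k) =
      q • ((∑ k ∈ Finset.Iio j, x k) * (∑ k ∈ Finset.Ioi j, x k)) :=
    sum_qcomm fun k hk => sum_qcomm' fun i hi =>
      h.xx ((Finset.mem_Iio.mp hi).trans (Finset.mem_Ioi.mp hk))
  have xκ := h.xκ_le (le_refl j)
  have xD := h.xD_eq j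
  have aκ := h.aκ j j
  have xa := h.xa_eq j
  generalize ∑ k ∈ Finset.Iio j, x k = P at *
  generalize ∑ k ∈ Finset.Ioi j, x k = Q at *
  have e1 : (P + x j + Q) * (κ j * a j) =
      κ j * (q • (P * a j) + q • (a j * x j) + q • (a j * Q)) := by
    rw [← mul_assoc, add_mul _ Q (κ j), add_mul P _ (κ j), Pκ, xκ, Qκ]
    simp only [add_mul, mul_add, smul_mul_assoc, mul_smul_comm, mul_assoc, xa, Qa]
  have e2 : (κ j * a j) * (P + x j + Q) = κ j * (q • (P * a j) + a j * x j + a j * Q) := by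
    rw [mul_assoc, mul_add (a j), mul_add (a j), aP]
  have e3 : (P + x j + Q) * (D j * P) =
      D j * (q • (P * P) + q • (P * x j) + q • (P * Q)) + ((1 - q) * q) • (κ j * (P * a j)) := by
    rw [← mul_assoc, add_mul _ Q (D j), add_mul P _ (D j), PD, xD, QD]
    simp only [add_mul, mul_add, smul_mul_assoc, mul_smul_comm, mul_assoc, aP, xP, QP, smul_smul]
    module
  rw [mul_sub, sub_mul, e1, e2, e3]
  simp only [mul_add, mul_smul_comm, mul_assoc]
  module

theorem BosonRel.serre_lt {i j : Fin m} (hij : i < j) :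
    bElt D x κ a i * D j = D j * bElt D x κ a i ∧
    bElt D x κ a j * D i = q • (D i * bElt D x κ a j) + (q - 1) • (D j * bElt D x κ a i) := by
  have PD : (∑ k ∈ Finset.Iio i, x k) * D j = q • (D j * ∑ k ∈ Finset.Iio i, x k) :=
    sum_qcomm fun k hk => h.xD_lt ((Finset.mem_Iio.mp hk).trans hij)
  have PD' : (∑ k ∈ Finset.Iio j, x k) * D i =
      D i * ∑ k ∈ Finset.Iio j, x k + (1 - q) • bElt D x κ a i := by
    have h0 : Finset.Iio j = insert i (Finset.Iio i) ∪ Finset.Ioo i j := by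
      ext k; simp; omega
    have h1 : ∑ k ∈ Finset.Iio j, x k =
        ∑ k ∈ Finset.Iio i, x k + x i + ∑ k ∈ Finset.Ioo i j, x k := by
      rw [h0, Finset.sum_union, Finset.sum_insert (by simp), add_comm (x i)]
      rw [Finset.disjoint_left]
      intro k; simp; omega
    have h2 : (∑ k ∈ Finset.Iio i, x k) * D i = q • (D i * ∑ k ∈ Finset.Iio i, x k) :=
      sum_qcomm fun k hk => h.xD_lt (Finset.mem_Iio.mp hk)
    have h3 : (∑ k ∈ Finset.Ioo i j, x k) * D i = D i * ∑ k ∈ Finset.Ioo i j, x k :=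
      sum_comm_mul fun k hk => h.xD_gt (Finset.mem_Ioo.mp hk).1
    rw [h1, bElt, add_mul, add_mul, h2, h3, h.xD_eq, mul_add, mul_add]
    module
  constructor
  · rw [bElt, sub_mul, mul_sub, mul_assoc, mul_assoc, PD, h.aD, ← mul_assoc (κ i), h.κD_gt hij,
      mul_smul_comm, ← mul_assoc (D j) (D i), h.DD hij]
    simp only [mul_assoc, smul_mul_assoc]
  · rw [bElt, sub_mul, mul_assoc, mul_assoc, PD', h.aD, ← mul_assoc (κ j), h.κD_lt hij, mul_add,
      ← mul_assoc (D j) (D i), h.DD hij, mul_sub]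
    simp only [mul_assoc, smul_mul_assoc, mul_smul_comm]
    module

theorem BosonRel.serre_eq (i : Fin m) :
    bElt D x κ a i * D i = q • (D i * bElt D x κ a i) := by
  have h2 : (∑ k ∈ Finset.Iio i, x k) * D i = q • (D i * ∑ k ∈ Finset.Iio i, x k) :=
    sum_qcomm fun k hk => h.xD_lt (Finset.mem_Iio.mp hk)
  rw [bElt, sub_mul, mul_assoc, mul_assoc, h2, h.aD, ← mul_assoc (κ i), h.κD_eq, mul_sub]
  simp only [mul_assoc, mul_smul_comm]
  module

/-- The polarized form of `B D = q D B` for the linear combinations of the `D_j` and `B_j`. -/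
theorem BosonRel.serre (i j : Fin m) :
    bElt D x κ a j * D i + bElt D x κ a i * D j =
      q • (D j * bElt D x κ a i + D i * bElt D x κ a j) := by
  rcases lt_trichotomy i j with hij | hij | hij
  · rw [(h.serre_lt hij).1, (h.serre_lt hij).2]; module
  · subst hij; rw [h.serre_eq]; module
  · rw [(h.serre_lt hij).1, (h.serre_lt hij).2]; module

end Serre

/-! ### The operators `D_α` -/

section Fock

variable {I : Type} {n : ℕ}

/-- The weight of `∏_i k_i^{α_i^+} c_i^{α_i}` on the row vector `⟨u|`. -/
def wt (q : ℝ) (α : Fin (n + 1) → ℕ) (u : Fin n → ℕ) : ℝ :=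
  ∏ i : Fin n, (q ^ ((∑ j ∈ Finset.Ioi i.castSucc, α j) * u i) *
    ∏ t ∈ Finset.range (α i.castSucc), (1 - q ^ (u i + α i.castSucc - t)))

/-- The operator `D_α = ∏_i k_i^{α_i^+} c_i^{α_i}` on row vectors. -/
def dOp (q : ℝ) (α : Fin (n + 1) → ℕ) : Module.End ℝ (I × (Fin n → ℕ) →₀ ℝ) :=
  glue fun s => wt q α s • embed (s + α ∘ Fin.castSucc)

theorem dOp_embed (q : ℝ) (α : Fin (n + 1) → ℕ) (s : Fin n → ℕ) (v : I →₀ ℝ) :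
    dOp q α (embed s v) = wt q α s • embed (s + α ∘ Fin.castSucc) v := glue_embed _ _ _

theorem phiForm_single {m : ℕ} (i j : Fin m) :
    phiForm (Pi.single i 1) (Pi.single j 1) = if i < j then 1 else 0 := by
  rw [phiForm, Finset.sum_eq_single i]
  · rw [← Finset.mul_sum]
    simp [Pi.single_apply]
  · intro k _ hk; simp [hk]
  · simp

theorem wt_zero (q : ℝ) (u : Fin n → ℕ) : wt q 0 u = 1 := by
  simp [wt]

theorem phiForm_eq_castSucc (α β : Fin (n + 1) → ℕ) :
    phiForm α β = ∑ i : Fin n, (∑ j ∈ Finset.Ioi i.castSucc, β j) * α i.castSucc := by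
  rw [phiForm, Fin.sum_univ_castSucc]
  have h : Finset.Ioi (Fin.last n) = ∅ := by ext k; simp [Fin.le_last]
  rw [h, Finset.sum_empty, add_zero]
  exact Finset.sum_congr rfl fun i _ => by rw [← Finset.mul_sum, mul_comm]

/-- The powers of `q` in the product of the operators `D_α` and `D_β`. -/
theorem wt_add (q : ℝ) (α β : Fin (n + 1) → ℕ) (u : Fin n → ℕ) :
    wt q α u * wt q β (u + α ∘ Fin.castSucc) = q ^ phiForm α β * wt q (α + β) u := by
  rw [wt, wt, wt, phiForm_eq_castSucc, ← Finset.prod_pow_eq_pow_sum, ← Finset.prod_mul_distrib,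
    ← Finset.prod_mul_distrib]
  refine Finset.prod_congr rfl fun i _ => ?_
  simp only [Pi.add_apply, Function.comp_apply, Finset.sum_add_distrib]
  rw [add_comm (α i.castSucc) (β i.castSucc), Finset.prod_range_add]
  have h1 : ∀ t ∈ Finset.range (α i.castSucc),
      1 - q ^ (u i + (β i.castSucc + α i.castSucc) - (β i.castSucc + t)) =
      1 - q ^ (u i + α i.castSucc - t) := fun t ht => by
    rw [show u i + (β i.castSucc + α i.castSucc) - (β i.castSucc + t) =
      u i + α i.castSucc - t by omega]
  have h2 : ∀ t ∈ Finset.range (β i.castSucc),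
      1 - q ^ (u i + (β i.castSucc + α i.castSucc) - t) =
      1 - q ^ (u i + α i.castSucc + β i.castSucc - t) := fun t ht => by
    rw [show u i + (β i.castSucc + α i.castSucc) - t =
      u i + α i.castSucc + β i.castSucc - t by omega]
  rw [Finset.prod_congr rfl h1, Finset.prod_congr rfl h2, add_mul, mul_add, pow_add, pow_add]
  ring

theorem dOp_zero (q : ℝ) : (dOp q 0 : Module.End ℝ (I × (Fin n → ℕ) →₀ ℝ)) = 1 :=
  embed_ext fun s v => by
    rw [dOp_embed, wt_zero, one_smul]
    rfl

theorem dOp_mul (q : ℝ) (α β : Fin (n + 1) → ℕ) :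
    (dOp q β * dOp q α : Module.End ℝ (I × (Fin n → ℕ) →₀ ℝ)) =
      q ^ phiForm α β • dOp q (α + β) := by
  refine embed_ext fun s v => ?_
  rw [Module.End.mul_apply, dOp_embed, map_smul, dOp_embed, smul_smul, wt_add, LinearMap.smul_apply,
    dOp_embed, smul_smul, add_assoc]
  rfl

theorem dOp_lift (q : ℝ) (α : Fin (n + 1) → ℕ) (T : Module.End ℝ (I →₀ ℝ)) :
    lift T * dOp q α = dOp q α * lift T := by
  refine embed_ext fun s v => ?_
  rw [Module.End.mul_apply, Module.End.mul_apply, lift_embed, dOp_embed, dOp_embed, map_smul,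
    lift_embed]

/-- The diagonal operator `∏_{i ≤ j} k_i`. -/
def kappa (q : ℝ) (j : Fin (n + 1)) : Module.End ℝ (I × (Fin n → ℕ) →₀ ℝ) :=
  glue fun s => q ^ (∑ i : Fin n, if i.castSucc ≤ j then s i else 0) • embed s

theorem kappa_embed (q : ℝ) (j : Fin (n + 1)) (s : Fin n → ℕ) (v : I →₀ ℝ) :
    kappa q j (embed s v) = q ^ (∑ i : Fin n, if i.castSucc ≤ j then s i else 0) • embed s v :=
  glue_embed _ _ _

theorem kappa_lift (q : ℝ) (j : Fin (n + 1)) (T : Module.End ℝ (I →₀ ℝ)) :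
    lift T * kappa q j = kappa q j * lift T := by
  refine embed_ext fun s v => ?_
  rw [Module.End.mul_apply, Module.End.mul_apply, lift_embed, kappa_embed, kappa_embed, map_smul,
    lift_embed]

theorem count_add (S : Fin n → Prop) [DecidablePred S] (s t : Fin n → ℕ) :
    (∑ i, if S i then (s + t) i else 0) = (∑ i, if S i then s i else 0) +
      ∑ i, if S i then t i else 0 := by
  rw [← Finset.sum_add_distrib]
  exact Finset.sum_congr rfl fun i _ => by split_ifs <;> simp

theorem count_single (S : Fin n → Prop) [DecidablePred S] (k : Fin n) :
    (∑ i, if S i then (Pi.single k 1 : Fin n → ℕ) i else 0) = if S k then 1 else 0 := by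
  rw [Finset.sum_eq_single k]
  · simp
  · intro i _ hi; simp [hi]
  · simp

theorem single_castSucc_comp (k : Fin n) :
    (Pi.single k.castSucc 1 : Fin (n + 1) → ℕ) ∘ Fin.castSucc = Pi.single k 1 := by
  ext i; simp [Pi.single_apply]

theorem sum_Ioi_single (i : Fin n) (j : Fin (n + 1)) :
    ∑ k ∈ Finset.Ioi i.castSucc, (Pi.single j 1 : Fin (n + 1) → ℕ) k =
      if i.castSucc < j then 1 else 0 := by
  simp [Pi.single_apply]

theorem wt_single_last (q : ℝ) (u : Fin n → ℕ) :
    wt q (Pi.single (Fin.last n) 1) u = q ^ ∑ i : Fin n, if i.castSucc < Fin.last n then u i else 0 := by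
  rw [wt, ← Finset.prod_pow_eq_pow_sum]
  refine Finset.prod_congr rfl fun i _ => ?_
  rw [sum_Ioi_single]
  simp [Fin.castSucc_lt_last, Fin.castSucc_ne_last]

theorem wt_single_castSucc (q : ℝ) (k : Fin n) (u : Fin n → ℕ) :
    wt q (Pi.single k.castSucc 1) u =
      q ^ (∑ i : Fin n, if i.castSucc < k.castSucc then u i else 0) * (1 - q ^ (u k + 1)) := by
  rw [wt, Finset.prod_mul_distrib, ← Finset.prod_pow_eq_pow_sum]
  congr 1
  · refine Finset.prod_congr rfl fun i _ => ?_
    rw [sum_Ioi_single]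
    split_ifs <;> simp
  · rw [Finset.prod_eq_single k]
    · simp
    · intro i _ hi
      have : i.castSucc ≠ k.castSucc := fun h => hi (Fin.castSucc_injective _ h)
      simp [this]
    · simp

end Fock

/-! ### The boson operators on the Fock space -/

section Fock

variable {I : Type} {n : ℕ}

/-- The extension by `0` of a family indexed by `Fin n` to the last index of `Fin (n + 1)`. -/
def extZero {R : Type*} [Zero R] (f : Fin n → R) : Fin (n + 1) → R :=
  Fin.snoc (α := fun _ => R) f 0

@[simp] theorem extZero_castSucc {R : Type*} [Zero R] (f : Fin n → R) (k : Fin n) :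
    extZero f k.castSucc = f k := Fin.snoc_castSucc (α := fun _ => R) _ _ _

@[simp] theorem extZero_last {R : Type*} [Zero R] (f : Fin n → R) :
    extZero f (Fin.last n) = 0 := Fin.snoc_last (α := fun _ => R) _ _

theorem lower_kappa (q : ℝ) (k : Fin n) (j : Fin (n + 1)) :
    (lower (Pi.single k 1) * kappa q j : Module.End ℝ (I × (Fin n → ℕ) →₀ ℝ)) =
      (if k.castSucc ≤ j then q else 1) • (kappa q j * lower (Pi.single k 1)) := by
  refine embed_ext fun s v => ?_
  rw [LinearMap.smul_apply, Module.End.mul_apply, Module.End.mul_apply, kappa_embed, map_smul,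
    lower_embed]
  by_cases hs : Pi.single k 1 ≤ s
  · rw [if_pos hs, kappa_embed, smul_smul]
    congr 1
    have h1 := count_add (fun i : Fin n => i.castSucc ≤ j) (s - Pi.single k 1) (Pi.single k 1)
    rw [tsub_add_cancel_of_le hs, count_single] at h1
    rw [h1, pow_add]
    split_ifs <;> simp [mul_comm]
  · rw [if_neg hs]
    simp

theorem kappa_dOp (q : ℝ) (i j : Fin (n + 1)) :
    (kappa q j * dOp q (Pi.single i 1) : Module.End ℝ (I × (Fin n → ℕ) →₀ ℝ)) =
      (if i ≤ j ∧ i ≠ Fin.last n then q else 1) • (dOp q (Pi.single i 1) * kappa q j) := by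
  refine embed_ext fun s v => ?_
  rw [LinearMap.smul_apply, Module.End.mul_apply, Module.End.mul_apply, dOp_embed, map_smul,
    kappa_embed, kappa_embed, map_smul, dOp_embed, count_add, pow_add, smul_smul, smul_smul,
    smul_smul]
  congr 1
  induction i using Fin.lastCases with
  | last => simp [mul_comm]
  | cast k =>
    rw [single_castSucc_comp, count_single]
    simp only [ne_eq, Fin.castSucc_ne_last, not_false_eq_true, and_true]
    split_ifs <;> ring

/-- Passing a lowering operator through `D_j`. -/
theorem lower_dOp_ne (q : ℝ) {k : Fin n} {j : Fin (n + 1)} (hkj : k.castSucc ≠ j) :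
    (lower (Pi.single k 1) * dOp q (Pi.single j 1) : Module.End ℝ (I × (Fin n → ℕ) →₀ ℝ)) =
      (if k.castSucc < j then q else 1) • (dOp q (Pi.single j 1) * lower (Pi.single k 1)) := by
  refine embed_ext fun s v => ?_
  rw [LinearMap.smul_apply, Module.End.mul_apply, Module.End.mul_apply, dOp_embed, map_smul,
    lower_embed, lower_embed]
  have hk : (Pi.single j 1 : Fin (n + 1) → ℕ) k.castSucc = 0 := by simp [hkj]
  have hiff : Pi.single k 1 ≤ s + (Pi.single j 1 : Fin (n + 1) → ℕ) ∘ Fin.castSucc ↔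
      Pi.single k 1 ≤ s := by
    rw [single_le_iff, single_le_iff, Pi.add_apply, Function.comp_apply, hk, add_zero]
  by_cases hs : Pi.single k 1 ≤ s
  · rw [if_pos hs, if_pos (hiff.mpr hs), dOp_embed, smul_smul]
    congr 1
    · have h1 := count_add (fun i : Fin n => i.castSucc < j) (s - Pi.single k 1) (Pi.single k 1)
      rw [tsub_add_cancel_of_le hs, count_single] at h1
      induction j using Fin.lastCases with
      | last =>
        rw [wt_single_last, wt_single_last, h1, pow_add]
        split_ifs <;> simp [mul_comm]
      | cast j =>
        have hjk : j ≠ k := fun h => hkj (by rw [h])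
        rw [wt_single_castSucc, wt_single_castSucc, h1, pow_add]
        have h2 : (s - Pi.single k 1 : Fin n → ℕ) j = s j := by simp [hjk]
        rw [h2]
        split_ifs <;> ring
    · congr 2
      rw [tsub_add_eq_add_tsub hs]
  · rw [if_neg hs, if_neg (fun h => hs (hiff.mp h))]
    simp

theorem lower_dOp_eq (q : ℝ) (k : Fin n) :
    (lower (Pi.single k 1) * dOp q (Pi.single k.castSucc 1) :
        Module.End ℝ (I × (Fin n → ℕ) →₀ ℝ)) =
      dOp q (Pi.single k.castSucc 1) * lower (Pi.single k 1) + (1 - q) • kappa q k.castSucc := by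
  refine embed_ext fun s v => ?_
  rw [LinearMap.add_apply, LinearMap.smul_apply, Module.End.mul_apply, Module.End.mul_apply,
    dOp_embed, map_smul, lower_embed, lower_embed, kappa_embed, single_castSucc_comp,
    if_pos (by rw [single_le_iff]; simp), add_tsub_cancel_right]
  have hκ : (∑ i : Fin n, if i.castSucc ≤ k.castSucc then s i else 0) =
      (∑ i : Fin n, if i.castSucc < k.castSucc then s i else 0) + s k := by
    have : s k = ∑ i : Fin n, if i = k then s i else 0 := by simp
    rw [this, ← Finset.sum_add_distrib]
    refine Finset.sum_congr rfl fun i _ => ?_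
    rcases lt_trichotomy i k with h | h | h
    · simp [h, h.le, h.ne]
    · simp [h]
    · simp [h.ne', not_le.mpr h, not_lt.mpr h.le]
  rw [hκ, smul_smul]
  by_cases hs : Pi.single k 1 ≤ s
  · have h1 := count_add (fun i : Fin n => i.castSucc < k.castSucc) (s - Pi.single k 1)
      (Pi.single k 1)
    rw [tsub_add_cancel_of_le hs, count_single, if_neg (lt_irrefl _), add_zero] at h1
    rw [if_pos hs, dOp_embed, single_castSucc_comp, tsub_add_cancel_of_le hs, ← add_smul,
      wt_single_castSucc, wt_single_castSucc, ← h1]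
    congr 1
    have h2 : (s - Pi.single k 1 : Fin n → ℕ) k + 1 = s k := by
      have := single_le_iff.mp hs
      simp; omega
    rw [h2]
    ring
  · rw [if_neg hs, map_zero, zero_add, wt_single_castSucc]
    congr 1
    have h2 : s k = 0 := by
      have := mt single_le_iff.mpr hs; omega
    rw [h2]
    ring

/-- The boson operators satisfy the relations of `BosonRel`. -/
theorem bosonRel_fock {q : ℝ} {a : Fin n → Module.End ℝ (I →₀ ℝ)}
    (ha : ∀ i j, i < j → a j * a i = q • (a i * a j)) :
    BosonRel q (fun j => dOp q (Pi.single j 1)) (extZero fun k => lower (Pi.single k 1) * lift (a k))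
      (kappa q) (extZero fun k => (lift (a k) : Module.End ℝ (I × (Fin n → ℕ) →₀ ℝ))) where
  xD_lt {k j} hkj := by
    induction k using Fin.lastCases with
    | last => simp
    | cast k =>
      rw [extZero_castSucc, mul_assoc, dOp_lift, ← mul_assoc, lower_dOp_ne q hkj.ne, if_pos hkj,
        smul_mul_assoc, mul_assoc]
  xD_gt {k j} hkj := by
    induction k using Fin.lastCases with
    | last => simp
    | cast k =>
      rw [extZero_castSucc, mul_assoc, dOp_lift, ← mul_assoc, lower_dOp_ne q hkj.ne',
        if_neg hkj.not_gt, one_smul, mul_assoc]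
  xD_eq j := by
    induction j using Fin.lastCases with
    | last => simp
    | cast j =>
      rw [extZero_castSucc, extZero_castSucc, mul_assoc, dOp_lift, ← mul_assoc, lower_dOp_eq,
        add_mul, smul_mul_assoc, mul_assoc]
  aD k j := by
    induction k using Fin.lastCases with
    | last => simp
    | cast k => rw [extZero_castSucc, dOp_lift]
  aκ k j := by
    induction k using Fin.lastCases with
    | last => simp
    | cast k => rw [extZero_castSucc, kappa_lift]
  xx {i j} hij := by
    induction j using Fin.lastCases with
    | last => simp
    | cast j =>
      induction i using Fin.lastCases with
      | last => exact absurd hij (not_lt.mpr (Fin.le_last _))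
      | cast i =>
        rw [extZero_castSucc, extZero_castSucc, mul_assoc, ← mul_assoc (lift (a j)), ← lower_lift,
          mul_assoc, mul_assoc, ← mul_assoc (lift (a i)), ← lower_lift, ← lift_mul,
          ha i j (by simpa using hij), lift_smul, lift_mul, mul_smul_comm, mul_smul_comm,
          ← mul_assoc, lower_mul, mul_assoc (lower _) (lift (a i)), ← mul_assoc (lower (Pi.single i 1)),
          lower_mul, add_comm]
  ax {i j} hij := by
    induction j using Fin.lastCases with
    | last => simp
    | cast j =>
      induction i using Fin.lastCases with
      | last => exact absurd hij (not_lt.mpr (Fin.le_last _))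
      | cast i =>
        rw [extZero_castSucc, extZero_castSucc, ← mul_assoc, ← lower_lift, mul_assoc, ← lift_mul,
          ha i j (by simpa using hij), lift_smul, lift_mul, mul_smul_comm, mul_assoc]
  xa {i j} hij := by
    induction j using Fin.lastCases with
    | last => simp
    | cast j =>
      induction i using Fin.lastCases with
      | last => exact absurd hij (not_lt.mpr (Fin.le_last _))
      | cast i =>
        rw [extZero_castSucc, extZero_castSucc, mul_assoc, ← lift_mul,
          ha i j (by simpa using hij), lift_smul, lift_mul, mul_smul_comm, ← mul_assoc, lower_lift,
          mul_assoc]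
  xa_eq j := by
    induction j using Fin.lastCases with
    | last => simp
    | cast j => rw [extZero_castSucc, extZero_castSucc, ← mul_assoc, ← lower_lift]
  xκ_le {k j} hkj := by
    induction k using Fin.lastCases with
    | last => simp
    | cast k =>
      rw [extZero_castSucc, mul_assoc, kappa_lift, ← mul_assoc, lower_kappa, if_pos hkj,
        smul_mul_assoc, mul_assoc]
  xκ_gt {k j} hkj := by
    induction k using Fin.lastCases with
    | last => simp
    | cast k =>
      rw [extZero_castSucc, mul_assoc, kappa_lift, ← mul_assoc, lower_kappa, if_neg hkj.not_ge,
        one_smul, mul_assoc]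
  κD_lt {i j} hij := by
    rw [kappa_dOp, if_pos ⟨hij.le, (hij.trans_le (Fin.le_last _)).ne⟩]
  κD_eq i := by
    induction i using Fin.lastCases with
    | last => simp
    | cast i => rw [kappa_dOp, if_pos ⟨le_rfl, Fin.castSucc_ne_last _⟩, smul_mul_assoc]
  κD_gt {i j} hij := by
    rw [kappa_dOp, if_neg fun h => hij.not_ge h.1, one_smul]
  DD {i j} hij := by
    rw [dOp_mul, dOp_mul, phiForm_single, phiForm_single, if_pos hij, if_neg hij.not_gt, pow_one,
      pow_zero, one_smul, add_comm]

/-! ### Zamolodchikov-Faddeev families -/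

/-- The data from which the matrix product operators of rank `n` are built: the operators `D_α`,
the operators `Y(t)` and the operators `B_j` that describe how they commute. All operators act on
row vectors, so products are in the order opposite to that of the matrices. The last field is the
polarized form of the relation `B D = q D B` for linear combinations of the `D_j` and `B_j`. -/
structure ZFData (q : ℝ) (I : Type) (n : ℕ) where
  D : (Fin n → ℕ) → Module.End ℝ (I →₀ ℝ)
  B : Fin n → Module.End ℝ (I →₀ ℝ)
  Y : ℝ → Module.End ℝ (I →₀ ℝ)
  /-- The inverse of `Y`. -/
  Yi : ℝ → Module.End ℝ (I →₀ ℝ)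
  D_zero : D 0 = 1
  D_mul : ∀ α β, D β * D α = q ^ phiForm α β • D (α + β)
  Y_mul_D : ∀ t j, Y t * D (Pi.single j 1) = (D (Pi.single j 1) + t • B j) * Y t
  Y_comm : ∀ s t, Y s * Y t = Y t * Y s
  Y_mul_Yi : ∀ t, Y t * Yi t = 1
  Yi_mul_Y : ∀ t, Yi t * Y t = 1
  serre : ∀ i j, B j * D (Pi.single i 1) + B i * D (Pi.single j 1) =
    q • (D (Pi.single j 1) * B i + D (Pi.single i 1) * B j)

namespace ZFData

variable {q : ℝ} (z : ZFData q I n)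

/-- The conjugate `A_α(t) = Y(t) D_α Y(t)⁻¹`, which is `D_j + t B_j` for a unit vector `α`. -/
def A (t : ℝ) (α : Fin n → ℕ) : Module.End ℝ (I →₀ ℝ) := z.Y t * z.D α * z.Yi t

theorem A_single (t : ℝ) (j : Fin n) :
    z.A t (Pi.single j 1) = z.D (Pi.single j 1) + t • z.B j := by
  rw [A, Y_mul_D, mul_assoc, Y_mul_Yi, mul_one]

theorem A_zero (t : ℝ) : z.A t 0 = 1 := by
  rw [A, D_zero, mul_one, Y_mul_Yi]

theorem A_mul (t : ℝ) (α β : Fin n → ℕ) :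
    z.A t β * z.A t α = q ^ phiForm α β • z.A t (α + β) := by
  have : z.A t β * z.A t α = z.Y t * z.D β * (z.Yi t * z.Y t) * z.D α * z.Yi t := by
    simp only [A, mul_assoc]
  rw [this, Yi_mul_Y, mul_one, mul_assoc (z.Y t), D_mul, mul_smul_comm, smul_mul_assoc, A]

theorem Y_mul_D_eq (t : ℝ) (α : Fin n → ℕ) : z.Y t * z.D α = z.A t α * z.Y t := by
  rw [A, mul_assoc _ (z.Yi t), Yi_mul_Y, mul_one]

theorem Yi_mul_A (t : ℝ) (α : Fin n → ℕ) : z.Yi t * z.A t α = z.D α * z.Yi t := by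
  rw [A, mul_assoc, ← mul_assoc (z.Yi t), Yi_mul_Y, one_mul]

theorem Y_comm_Yi (s t : ℝ) : z.Y s * z.Yi t = z.Yi t * z.Y s := by
  calc z.Y s * z.Yi t = z.Yi t * z.Y t * (z.Y s * z.Yi t) := by rw [Yi_mul_Y, one_mul]
    _ = z.Yi t * (z.Y t * z.Y s) * z.Yi t := by simp only [mul_assoc]
    _ = z.Yi t * z.Y s * (z.Y t * z.Yi t) := by rw [Y_comm]; simp only [mul_assoc]
    _ = _ := by rw [Y_mul_Yi, mul_one]

/-- The position operators of the next rank. -/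
def a (k : Fin n) : Module.End ℝ (I →₀ ℝ) := z.A 1 (Pi.single k 1)

theorem a_qcomm (i j : Fin n) (hij : i < j) : z.a j * z.a i = q • (z.a i * z.a j) := by
  rw [a, a, A_mul, A_mul, phiForm_single, phiForm_single, if_pos hij, if_neg hij.not_gt, pow_one,
    pow_zero, one_smul, add_comm]

/-- The operators `B_j` of the next rank. -/
def nextB (j : Fin (n + 1)) : Module.End ℝ (I × (Fin n → ℕ) →₀ ℝ) :=
  bElt (fun j => dOp q (Pi.single j 1)) (extZero fun k => lower (Pi.single k 1) * lift (z.a k))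
      (kappa q) (extZero fun k => (lift (z.a k) : Module.End ℝ (I × (Fin n → ℕ) →₀ ℝ))) j

theorem sum_extZero : ∑ k, (extZero fun k => lower (Pi.single k 1) * lift (z.a k) :
    Fin (n + 1) → Module.End ℝ (I × (Fin n → ℕ) →₀ ℝ)) k = linOp z.a := by
  rw [Fin.sum_univ_castSucc]
  simp [linOp]

theorem linOp_mul_dOp (j : Fin (n + 1)) :
    linOp z.a * dOp q (Pi.single j 1) =
      dOp q (Pi.single j 1) * linOp z.a + (1 - q) • z.nextB j := by
  have h := (bosonRel_fock z.a_qcomm).sum_mul_D j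
  rwa [sum_extZero] at h

theorem linOp_mul_nextB (j : Fin (n + 1)) :
    linOp z.a * z.nextB j = q • (z.nextB j * linOp z.a) := by
  have h := (bosonRel_fock z.a_qcomm).sum_mul_bElt j
  rwa [sum_extZero] at h

theorem linOp_pow_mul_dOp (j : Fin (n + 1)) (N : ℕ) :
    linOp z.a ^ (N + 1) * dOp q (Pi.single j 1) = dOp q (Pi.single j 1) * linOp z.a ^ (N + 1) +
      (1 - q ^ (N + 1)) • (z.nextB j * linOp z.a ^ N) := by
  induction N with
  | zero => simp [linOp_mul_dOp]
  | succ N ih =>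
    rw [pow_succ', mul_assoc, ih, mul_add, ← mul_assoc, linOp_mul_dOp, mul_smul_comm,
      ← mul_assoc (linOp z.a) (z.nextB j), linOp_mul_nextB, add_mul, smul_mul_assoc,
      smul_mul_assoc, mul_assoc, ← pow_succ', mul_assoc, ← pow_succ', pow_succ' q (N + 1)]
    module

/-- Commuting `D_j` through the `q`-exponential of the position operator. -/
theorem linSeries_mul_dOp (hq0 : 0 < q) (hq1 : q < 1) (t : ℝ) (j : Fin (n + 1)) :
    linSeries q t 0 z.a * dOp q (Pi.single j 1) =
      (dOp q (Pi.single j 1) + t • z.nextB j) * linSeries q t 0 z.a := by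
  refine LinearMap.ext fun v => ?_
  obtain ⟨k, hk⟩ := degFilt_exhaustive.exists_mem v
  obtain ⟨l, hl⟩ := degFilt_exhaustive.exists_mem (dOp q (Pi.single j 1) v)
  have hv := degFilt_exhaustive.mono (le_max_left k l) hk
  have hv' := degFilt_exhaustive.mono (Nat.le_succ _) hv
  have hD := degFilt_exhaustive.mono ((le_max_right k l).trans (Nat.le_succ _)) hl
  have e0 := linSeries_apply q t 0 z.a hv
  have e1 := linSeries_apply q t 0 z.a hv'
  have eD := linSeries_apply q t 0 z.a hD
  rw [Finset.sum_range_succ'] at e1 eD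
  rw [add_mul, LinearMap.add_apply, Module.End.mul_apply, Module.End.mul_apply,
    Module.End.mul_apply, LinearMap.smul_apply, eD, congrArg (dOp q (Pi.single j 1)) e1,
    congrArg (z.nextB j) e0, map_add, map_sum, map_sum,
    Finset.smul_sum, add_right_comm, ← Finset.sum_add_distrib, pow_zero, Module.End.one_apply,
    Module.End.one_apply, map_smul]
  congr 1
  refine Finset.sum_congr rfl fun N _ => ?_
  have h := LinearMap.congr_fun (z.linOp_pow_mul_dOp j N) v
  have hc := hCoeff_succ hq0 hq1 t 0 N
  rw [zero_mul, sub_zero] at hc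
  simp only [Module.End.mul_apply, LinearMap.add_apply, LinearMap.smul_apply] at h
  rw [h, map_smul, map_smul, smul_smul, ← hc, smul_add, smul_smul, mul_comm (1 - q ^ (N + 1))]

/-- Passing from rank `n` to rank `n + 1`: the operator `Y(t)` is multiplied by the `q`-exponential
`1 / (t x)_∞` of the position operator `x = ∑_k a_k b_k`. -/
def next (hq0 : 0 < q) (hq1 : q < 1) : ZFData q (I × (Fin n → ℕ)) (n + 1) where
  D := dOp q
  B := z.nextB
  Y t := linSeries q t 0 z.a * lift (z.Y t)
  Yi t := lift (z.Yi t) * linSeries q 0 t z.a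
  D_zero := dOp_zero q
  D_mul := dOp_mul q
  Y_mul_D t j := by
    rw [mul_assoc, dOp_lift, ← mul_assoc, z.linSeries_mul_dOp hq0 hq1, mul_assoc]
  Y_comm s t := by
    -- after conjugation by `Y(1)` the position operators become `D_k`, and the product is
    -- visibly symmetric
    have conj (s : ℝ) : linSeries q s 0 z.a =
        lift (z.Y 1) * linSeries q s 0 (fun k => z.D (Pi.single k 1)) * lift (z.Yi 1) := by
      rw [linSeries_intertwine q s 0 (a' := z.a) fun k => z.Y_mul_D_eq 1 _, mul_assoc, ← lift_mul,
        Y_mul_Yi, lift_one, mul_one]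
    have pass (s t : ℝ) : lift (z.Y s) * linSeries q t 0 (fun k => z.D (Pi.single k 1)) =
        linSeries q t 0 (fun k => z.D (Pi.single k 1)) * linSeries q (t * s) 0 z.B *
          lift (z.Y s) := by
      rw [linSeries_intertwine q t 0 fun k => z.Y_mul_D s k, linSeries_add hq0 hq1 z.serre]
    have form (s t : ℝ) : linSeries q s 0 z.a * lift (z.Y s) *
        (linSeries q t 0 z.a * lift (z.Y t)) = lift (z.Y 1) *
          (linSeries q s 0 (fun k => z.D (Pi.single k 1)) *
            linSeries q t 0 (fun k => z.D (Pi.single k 1))) * linSeries q (t * s) 0 z.B *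
              lift (z.Y s * z.Y t) * lift (z.Yi 1) := by
      have h1 : (lift (z.Yi 1) * lift (z.Y s) * lift (z.Y 1) :
          Module.End ℝ (I × (Fin n → ℕ) →₀ ℝ)) = lift (z.Y s) := by
        rw [← lift_mul, ← lift_mul, mul_assoc, Y_comm, ← mul_assoc, Yi_mul_Y, one_mul]
      have h2 : (lift (z.Yi 1) * lift (z.Y t) : Module.End ℝ (I × (Fin n → ℕ) →₀ ℝ)) =
          lift (z.Y t) * lift (z.Yi 1) := by
        rw [← lift_mul, ← lift_mul, Y_comm_Yi]
      calc linSeries q s 0 z.a * lift (z.Y s) * (linSeries q t 0 z.a * lift (z.Y t))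
          = lift (z.Y 1) * linSeries q s 0 (fun k => z.D (Pi.single k 1)) *
            (lift (z.Yi 1) * lift (z.Y s) * lift (z.Y 1)) *
            linSeries q t 0 (fun k => z.D (Pi.single k 1)) * (lift (z.Yi 1) * lift (z.Y t)) := by
            rw [conj s, conj t]; simp only [mul_assoc]
        _ = lift (z.Y 1) * linSeries q s 0 (fun k => z.D (Pi.single k 1)) *
            (lift (z.Y s) * linSeries q t 0 (fun k => z.D (Pi.single k 1))) *
            (lift (z.Y t) * lift (z.Yi 1)) := by
            rw [h1, h2]; simp only [mul_assoc]
        _ = _ := by rw [pass s t, lift_mul]; simp only [mul_assoc]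
    rw [form, form, linSeries_comm, mul_comm t s, z.Y_comm]
  Y_mul_Yi t := by
    rw [mul_assoc, ← mul_assoc (lift _), ← lift_mul, Y_mul_Yi, lift_one, one_mul,
      linSeries_mul hq0 hq1, linSeries_self]
  Yi_mul_Y t := by
    rw [mul_assoc, ← mul_assoc (linSeries _ _ _ _), linSeries_mul hq0 hq1, linSeries_self, one_mul,
      ← lift_mul, Yi_mul_Y, lift_one]
  serre := (bosonRel_fock z.a_qcomm).serre

end ZFData

end Fock

/-! ### The multinomial theorem for `q`-commuting families -/

theorem sum_one_sub_telescope (q : ℝ) {n : ℕ} (β : Fin n → ℕ) :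
    ∑ j, (1 - q ^ β j) * q ^ (∑ i ∈ Finset.Ioi j, β i) = 1 - q ^ size β := by
  induction n with
  | zero => simp [size]
  | succ n ih =>
    rw [Fin.sum_univ_succ, size, Fin.sum_univ_succ]
    have h0 : ∑ i ∈ Finset.Ioi (0 : Fin (n + 1)), β i = ∑ i : Fin n, β i.succ := by
      rw [Fin.sum_Ioi_zero]
    have h1 (j : Fin n) : ∑ i ∈ Finset.Ioi j.succ, β i = ∑ i ∈ Finset.Ioi j, β i.succ := by
      rw [Fin.sum_Ioi_succ]
    simp only [h0, h1]
    rw [ih fun i => β i.succ, size, pow_add]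
    ring

theorem phiForm_single_left {n : ℕ} (j : Fin n) (β : Fin n → ℕ) :
    phiForm (Pi.single j 1) β = ∑ i ∈ Finset.Ioi j, β i := by
  rw [phiForm, Finset.sum_eq_single j]
  · simp
  · intro k _ hk; simp [hk]
  · simp

/-- The coefficient `∏_{j < |l|} (s - t q^j) / ∏_i (q)_{l_i}`. -/
def mCoeff {n : ℕ} (q s t : ℝ) (l : Fin n → ℕ) : ℝ :=
  (∏ j ∈ Finset.range (size l), (s - t * q ^ j)) / ∏ i, qPoch q q (l i)

theorem mCoeff_inv {n : ℕ} {q ζ : ℝ} (hζ : ζ ≠ 0) (l : Fin n → ℕ) :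
    mCoeff q ζ⁻¹ 1 l = gCoeff q ζ l := by
  rw [mCoeff, gCoeff]
  congr 1
  rw [← inv_pow, qPoch]
  conv_rhs => rw [← Finset.card_range (size l), ← Finset.prod_const, Finset.card_range]
  rw [← Finset.prod_mul_distrib]
  refine Finset.prod_congr rfl fun j _ => ?_
  rw [mul_sub, ← mul_assoc, inv_mul_cancel₀ hζ]
  ring

/-- The multinomial theorem for a family that multiplies like the operators `D_α`. -/
theorem qmultinomial {q : ℝ} (hq0 : 0 < q) (hq1 : q < 1) {R : Type*} [Ring R] [Algebra ℝ R]
    {n : ℕ} {E : (Fin n → ℕ) → R} (h0 : E 0 = 1)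
    (hmul : ∀ α β, E β * E α = q ^ phiForm α β • E (α + β)) (N : ℕ) :
    (∑ j, E (Pi.single j 1)) ^ N = qPoch q q N •
      ∑ l ∈ Finset.piAntidiag Finset.univ N, (∏ i, qPoch q q (l i))⁻¹ • E l := by
  induction N with
  | zero => simp [qPoch, h0]
  | succ N ih =>
    rw [pow_succ, ih, smul_mul_assoc, qPoch_self_succ, mul_smul]
    congr 1
    have h1 : ∀ l ∈ Finset.piAntidiag Finset.univ (N + 1),
        (1 - q ^ (N + 1)) • ((∏ i, qPoch q q (l i))⁻¹ • E l) =
          ∑ j, (((1 - q ^ l j) * q ^ (∑ i ∈ Finset.Ioi j, l i)) * (∏ i, qPoch q q (l i))⁻¹) •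
            E l := by
      intro l hl
      have hs : size l = N + 1 := (Finset.mem_piAntidiag.mp hl).1
      rw [← hs, ← sum_one_sub_telescope, ← Finset.sum_smul, ← Finset.sum_mul, mul_smul]
    rw [Finset.smul_sum, Finset.sum_congr rfl h1, Finset.sum_comm, Finset.mul_sum]
    refine Finset.sum_congr rfl fun j _ => ?_
    rw [Finset.sum_mul]
    refine Finset.sum_of_injOn (fun l => l + Pi.single j 1) ?_ ?_ ?_ ?_
    · exact fun a _ b _ h => add_right_cancel h
    · intro l hl
      have hl' := (Finset.mem_piAntidiag.mp (Finset.mem_coe.mp hl)).1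
      refine Finset.mem_coe.mpr (Finset.mem_piAntidiag.mpr ⟨?_, fun _ _ => Finset.mem_univ _⟩)
      simp only [Pi.add_apply, Finset.sum_add_distrib, hl']
      simp
    · intro l hl hl'
      have h2 : l j = 0 := by
        by_contra hc
        have hle : Pi.single j 1 ≤ l := single_le_iff.mpr (by omega)
        refine hl' ⟨l - Pi.single j 1, ?_, tsub_add_cancel_of_le hle⟩
        refine Finset.mem_coe.mpr (Finset.mem_piAntidiag.mpr ⟨?_, fun _ _ => Finset.mem_univ _⟩)
        have h3 := size_add (l - Pi.single j 1) (Pi.single j 1)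
        rw [tsub_add_cancel_of_le hle, size_single] at h3
        have h4 : size l = N + 1 := (Finset.mem_piAntidiag.mp hl).1
        change size (l - Pi.single j 1) = N
        omega
      simp [h2]
    · intro l _
      rw [smul_mul_assoc, hmul, smul_smul, add_comm (Pi.single j 1) l, phiForm_single_left]
      congr 1
      have h2 : ∏ i, qPoch q q ((l + Pi.single j 1 : Fin n → ℕ) i) =
          (1 - q ^ (l j + 1)) * ∏ i, qPoch q q (l i) := by
        rw [← Finset.mul_prod_erase _ _ (Finset.mem_univ j),
          ← Finset.mul_prod_erase _ (fun i => qPoch q q (l i)) (Finset.mem_univ j), ← mul_assoc]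
        congr 1
        · simp [qPoch_self_succ, mul_comm]
        · refine Finset.prod_congr rfl fun i hi => ?_
          simp [Finset.ne_of_mem_erase hi]
      have h3 : ∑ i ∈ Finset.Ioi j, (l + Pi.single j 1 : Fin n → ℕ) i = ∑ i ∈ Finset.Ioi j, l i :=
        Finset.sum_congr rfl fun i hi => by simp [(Finset.mem_Ioi.mp hi).ne']
      have h4 : (1 - q ^ (l j + 1)) ≠ 0 := (sub_pos.mpr (pow_lt_one₀ hq0.le hq1 (by omega))).ne'
      have h5 : (∏ i, qPoch q q (l i)) ≠ 0 :=
        Finset.prod_ne_zero_iff.mpr fun i _ => qPoch_self_ne hq0 hq1 _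
      rw [h2, h3]
      simp only [Pi.add_apply, Pi.single_eq_same]
      field_simp

section Fock

variable {I : Type} {n : ℕ}

/-- The series in the position operators, expanded in multi-indices. -/
theorem linSeries_embed {q : ℝ} (hq0 : 0 < q) (hq1 : q < 1)
    {E : (Fin n → ℕ) → Module.End ℝ (I →₀ ℝ)} (h0 : E 0 = 1)
    (hmul : ∀ α β, E β * E α = q ^ phiForm α β • E (α + β)) (s t : ℝ) (u : Fin n → ℕ)
    (v : I →₀ ℝ) :
    linSeries q s t (fun k => E (Pi.single k 1)) (embed u v) =
      ∑ l ∈ Finset.Iic u, mCoeff q s t l • embed (u - l) (E l v) := by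
  have hE0 : lower 0 * lift (E 0) = (1 : Module.End ℝ (I × (Fin n → ℕ) →₀ ℝ)) := by
    rw [h0, lower_zero, lift_one, one_mul]
  have hEm (α β : Fin n → ℕ) : lower β * lift (E β) * (lower α * lift (E α)) =
      q ^ phiForm α β •
        (lower (α + β) * lift (E (α + β)) : Module.End ℝ (I × (Fin n → ℕ) →₀ ℝ)) := by
    rw [mul_assoc, ← mul_assoc (lift (E β)), ← lower_lift, mul_assoc, ← lift_mul, hmul,
      ← mul_assoc, lower_mul, lift_smul, mul_smul_comm]
  have hpow := qmultinomial hq0 hq1 (E := fun l => (lower l * lift (E l) :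
    Module.End ℝ (I × (Fin n → ℕ) →₀ ℝ))) hE0 hEm
  rw [linSeries_apply q s t _ (embed_mem_degFilt (Nat.lt_succ_self (size u)) v),
    ← Finset.sum_fiberwise_of_maps_to (s := Finset.Iic u) (t := Finset.range (size u).succ)
      (g := size)]
  · refine Finset.sum_congr rfl fun N _ => ?_
    rw [linOp, hpow N, LinearMap.smul_apply, LinearMap.sum_apply, smul_smul, Finset.smul_sum]
    classical
    refine (Finset.sum_subset_zero_on_sdiff (s₁ := (Finset.Iic u).filter fun l => size l = N)
      ?_ ?_ ?_).symm
    · intro l hl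
      rw [Finset.mem_filter] at hl
      exact Finset.mem_piAntidiag.mpr ⟨hl.2, fun _ _ => Finset.mem_univ _⟩
    · intro l hl
      rw [Finset.mem_sdiff, Finset.mem_filter, Finset.mem_Iic] at hl
      have hs : size l = N := (Finset.mem_piAntidiag.mp hl.1).1
      rw [LinearMap.smul_apply, Module.End.mul_apply, lift_embed, lower_embed,
        if_neg fun h => hl.2 ⟨h, hs⟩, smul_zero, smul_zero]
    · intro l hl
      rw [Finset.mem_filter, Finset.mem_Iic] at hl
      rw [LinearMap.smul_apply, Module.End.mul_apply, lift_embed, lower_embed, if_pos hl.1,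
        smul_smul, mCoeff, hCoeff, hl.2, div_mul_cancel₀ _ (qPoch_self_ne hq0 hq1 N),
        div_eq_mul_inv]
  · intro l hl
    rw [Finset.mem_range, Nat.lt_succ_iff]
    exact Finset.sum_le_sum fun i _ => (Finset.mem_Iic.mp hl) i

namespace ZFData

variable {q : ℝ} (z : ZFData q I n)

theorem linSeries_A_embed (hq0 : 0 < q) (hq1 : q < 1) (r s t : ℝ) (u : Fin n → ℕ) (v : I →₀ ℝ) :
    linSeries q s t (fun k => z.D (Pi.single k 1) + r • z.B k) (embed u v) =
      ∑ l ∈ Finset.Iic u, mCoeff q s t l • embed (u - l) (z.A r l v) := by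
  rw [← linSeries_embed hq0 hq1 (z.A_zero r) (z.A_mul r) s t u v]
  simp only [A_single]

/-- The exchange relation, one multi-index at a time. It is a matrix element of
`linSeries_exchange` from `⟨α|` to `⟨0|`. -/
theorem A_exchange (hq0 : 0 < q) (hq1 : q < 1) (s t : ℝ) (α : Fin n → ℕ) :
    mCoeff q s 1 α • z.A t α =
      ∑ l ∈ Finset.Iic α, (mCoeff q s t (α - l) * mCoeff q t 1 l) • (z.A 1 (α - l) * z.A s l) := by
  have coef (r s t : ℝ) (u : Fin n → ℕ) (v : I →₀ ℝ) (p : I) :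
      linSeries q s t (fun k => z.D (Pi.single k 1) + r • z.B k) (embed u v) (p, 0) =
        mCoeff q s t u * z.A r u v p := by
    rw [z.linSeries_A_embed hq0 hq1, Finset.sum_apply', Finset.sum_eq_single u]
    · rw [tsub_self, Finsupp.smul_apply, embed_apply_same, smul_eq_mul]
    · intro l hl hne
      rw [Finsupp.smul_apply, embed_apply_ne, smul_zero]
      exact fun h => hne (le_antisymm (Finset.mem_Iic.mp hl) (tsub_eq_zero_iff_le.mp h.symm))
    · simp
  refine LinearMap.ext fun v => Finsupp.ext fun p => ?_
  have h := LinearMap.congr_fun (linSeries_exchange hq0 hq1 z.serre s t) (embed α v)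
  rw [Module.End.mul_apply, z.linSeries_A_embed hq0 hq1 s, map_sum] at h
  have h2 := DFunLike.congr_fun h (p, 0)
  rw [coef, Finset.sum_apply'] at h2
  rw [LinearMap.smul_apply, Finsupp.smul_apply, smul_eq_mul, h2, LinearMap.sum_apply,
    Finset.sum_apply']
  refine Finset.sum_congr rfl fun l _ => ?_
  rw [map_smul, Finsupp.smul_apply, coef, LinearMap.smul_apply, Finsupp.smul_apply,
    Module.End.mul_apply, smul_eq_mul, smul_eq_mul]
  ring

/-- The operator `Z_0(ζ)`. -/
def Z (ζ : ℝ) : Module.End ℝ (I →₀ ℝ) := z.Yi 1 * z.Y ζ⁻¹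

/-- The inverse of `Z_0(ζ)`. -/
def Zi (ζ : ℝ) : Module.End ℝ (I →₀ ℝ) := z.Yi ζ⁻¹ * z.Y 1

theorem Z_mul_Zi (ζ : ℝ) : z.Z ζ * z.Zi ζ = 1 := by
  rw [Z, Zi, mul_assoc, ← mul_assoc (z.Y _), Y_mul_Yi, one_mul, Yi_mul_Y]

theorem Zi_mul_Z (ζ : ℝ) : z.Zi ζ * z.Z ζ = 1 := by
  rw [Z, Zi, mul_assoc, ← mul_assoc (z.Y _), Y_mul_Yi, one_mul, Yi_mul_Y]

/-- The Zamolodchikov-Faddeev relation with the structure constants resolved. -/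
theorem zf_relation (hq0 : 0 < q) (hq1 : q < 1) (lam mu : ℝ) (α : Fin n → ℕ) :
    z.Z lam * (mCoeff q mu⁻¹ 1 α • (z.D α * z.Z mu)) =
      (∑ l ∈ Finset.Iic α, (mCoeff q mu⁻¹ lam⁻¹ (α - l) * mCoeff q lam⁻¹ 1 l) •
        (z.D (α - l) * z.Z mu * z.D l)) * z.Z lam := by
  have h1 : z.Z lam * (z.D α * z.Z mu) =
      z.Yi 1 * z.A lam⁻¹ α * (z.Y mu⁻¹ * z.Y lam⁻¹ * z.Yi 1) := by
    rw [Z, Z, ← mul_assoc, mul_assoc (z.Yi 1), Y_mul_D_eq, Y_comm z mu⁻¹, mul_assoc (z.Y lam⁻¹),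
      Y_comm_Yi]
    simp only [mul_assoc]
  rw [mul_smul_comm, h1, ← smul_mul_assoc, ← mul_smul_comm, z.A_exchange hq0 hq1, Finset.mul_sum,
    Finset.sum_mul, Finset.sum_mul]
  refine Finset.sum_congr rfl fun l _ => ?_
  rw [mul_smul_comm, smul_mul_assoc, smul_mul_assoc]
  congr 1
  calc z.Yi 1 * (z.A 1 (α - l) * z.A mu⁻¹ l) * (z.Y mu⁻¹ * z.Y lam⁻¹ * z.Yi 1)
      = (z.Yi 1 * z.A 1 (α - l)) * (z.A mu⁻¹ l * z.Y mu⁻¹) * (z.Y lam⁻¹ * z.Yi 1) := by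
        simp only [mul_assoc]
    _ = (z.D (α - l) * z.Yi 1) * (z.Y mu⁻¹ * z.D l) * (z.Yi 1 * z.Y lam⁻¹) := by
        rw [Yi_mul_A, ← Y_mul_D_eq, Y_comm_Yi]
    _ = _ := by rw [Z, Z]; simp only [mul_assoc]

/-- The recursion for `D_α Z_0(ζ)` from rank `n` to rank `n + 1`. -/
theorem next_Z (hq0 : 0 < q) (hq1 : q < 1) (ζ : ℝ) :
    (z.next hq0 hq1).Z ζ = linSeries q ζ⁻¹ 1 (fun k => z.D (Pi.single k 1)) * lift (z.Z ζ) := by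
  have h1 : linSeries q ζ⁻¹ 1 (fun k => z.D (Pi.single k 1)) * lift (z.Yi 1) =
      lift (z.Yi 1) * linSeries q ζ⁻¹ 1 z.a :=
    (linSeries_intertwine q _ _ fun k => z.Yi_mul_A 1 _).symm
  have h2 : (z.next hq0 hq1).Z ζ = lift (z.Yi 1) * linSeries q 0 1 z.a *
      (linSeries q ζ⁻¹ 0 z.a * lift (z.Y ζ⁻¹)) := rfl
  rw [h2, Z, lift_mul, ← mul_assoc, ← mul_assoc, h1, mul_assoc (lift _) (linSeries _ _ _ _),
    linSeries_comm, linSeries_mul hq0 hq1]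

theorem next_Zi (hq0 : 0 < q) (hq1 : q < 1) (ζ : ℝ) :
    (z.next hq0 hq1).Zi ζ = lift (z.Zi ζ) * linSeries q 1 ζ⁻¹ (fun k => z.D (Pi.single k 1)) := by
  have h1 : linSeries q 1 ζ⁻¹ z.a * lift (z.Y 1) =
      lift (z.Y 1) * linSeries q 1 ζ⁻¹ (fun k => z.D (Pi.single k 1)) :=
    (linSeries_intertwine q _ _ fun k => z.Y_mul_D_eq 1 _).symm
  have h2 : (z.next hq0 hq1).Zi ζ = lift (z.Yi ζ⁻¹) * linSeries q 0 ζ⁻¹ z.a *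
      (linSeries q 1 0 z.a * lift (z.Y 1)) := rfl
  rw [h2, Zi, lift_mul, mul_assoc (lift _), mul_assoc (lift _), ← h1, ← mul_assoc (linSeries _ _ _ _),
    linSeries_comm, linSeries_mul hq0 hq1]

end ZFData

/-- The coefficients of `∏_i k_i^{α_i^+} c_i^{α_i}` after `∏_i b_i^{l_i}`. -/
theorem next_D_mul_Z_embed {q : ℝ} (hq0 : 0 < q) (hq1 : q < 1) (z : ZFData q I n) {ζ : ℝ}
    (hζ : ζ ≠ 0) (α : Fin (n + 1) → ℕ) (s : Fin n → ℕ) (v : I →₀ ℝ) :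
    ((z.next hq0 hq1).D α * (z.next hq0 hq1).Z ζ) (embed s v) =
      ∑ l ∈ Finset.Iic s, wt q α (s - l) •
        embed (s - l + α ∘ Fin.castSucc) ((gCoeff q ζ l • (z.D l * z.Z ζ)) v) := by
  rw [z.next_Z hq0 hq1, Module.End.mul_apply, Module.End.mul_apply, lift_embed,
    linSeries_embed hq0 hq1 z.D_zero z.D_mul, map_sum]
  refine Finset.sum_congr rfl fun l _ => ?_
  rw [map_smul, LinearMap.smul_apply, map_smul, mCoeff_inv hζ, smul_comm (wt _ _ _)]
  congr 1
  exact dOp_embed q α (s - l) _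

end Fock

/-- The trivial data in rank `0`. -/
def zfZero (q : ℝ) : ZFData q Unit 0 where
  D _ := 1
  B := Fin.elim0
  Y _ := 1
  Yi _ := 1
  D_zero := rfl
  D_mul α β := by simp [phiForm]
  Y_mul_D _ j := j.elim0
  Y_comm _ _ := rfl
  Y_mul_Yi _ := one_mul _
  Yi_mul_Y _ := one_mul _
  serre i := i.elim0

/-- The operators of rank `n` on the Fock space `F^{⊗ n(n-1)/2}`. -/
def zf {q : ℝ} (hq0 : 0 < q) (hq1 : q < 1) : (n : ℕ) → ZFData q (FockIdx n) n
  | 0 => zfZero q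
  | n + 1 => (zf hq0 hq1 n).next hq0 hq1

/-! ### Traces of words in a single boson -/

/-- The weight of the path of a boson from `⟨s|` under a word in the `b^l k^a c^e`; it is `0` as
soon as some `b^l` meets less than `l` quanta. -/
def bosonWt (q : ℝ) : List (ℕ × ℕ × ℕ) → ℕ → ℝ
  | [], _ => 1
  | x :: w, s => if x.1 ≤ s then
      q ^ (x.2.1 * (s - x.1)) * (∏ t ∈ Finset.range x.2.2, (1 - q ^ (s - x.1 + x.2.2 - t))) *
        bosonWt q w (s - x.1 + x.2.2) else 0

section Boson

variable {q : ℝ}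

theorem prod_one_sub_pow_mem (hq0 : 0 < q) (hq1 : q < 1) (e u : ℕ) :
    0 < ∏ t ∈ Finset.range e, (1 - q ^ (u + e - t)) ∧
      ∏ t ∈ Finset.range e, (1 - q ^ (u + e - t)) ≤ 1 := by
  have h : ∀ t ∈ Finset.range e, 0 < 1 - q ^ (u + e - t) := fun t ht => by
    have := Finset.mem_range.mp ht
    exact sub_pos.mpr (pow_lt_one₀ hq0.le hq1 (by omega))
  refine ⟨Finset.prod_pos h, Finset.prod_le_one (fun t ht => (h t ht).le) fun t _ => ?_⟩
  linarith [pow_pos hq0 (u + e - t)]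

theorem bosonWt_bounds (hq0 : 0 < q) (hq1 : q < 1) (w : List (ℕ × ℕ × ℕ)) (s : ℕ) :
    0 ≤ bosonWt q w s ∧ bosonWt q w s ≤
      q ^ ((w.map fun x => x.2.1).sum * (s - (w.map fun x => x.1).sum)) := by
  induction w generalizing s with
  | nil => simp [bosonWt]
  | cons x w ih =>
    obtain ⟨l, a, e⟩ := x
    rw [bosonWt]
    simp only [List.map_cons, List.sum_cons]
    split_ifs with h
    · obtain ⟨h1, h2⟩ := ih (s - l + e)
      obtain ⟨h3, h4⟩ := prod_one_sub_pow_mem hq0 hq1 e (s - l)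
      have h5 : 0 < q ^ (a * (s - l)) := pow_pos hq0 _
      refine ⟨by positivity, ?_⟩
      set A := (w.map fun x => x.2.1).sum
      set L := (w.map fun x => x.1).sum
      calc q ^ (a * (s - l)) * (∏ t ∈ Finset.range e, (1 - q ^ (s - l + e - t))) *
            bosonWt q w (s - l + e) ≤ q ^ (a * (s - l)) * 1 * q ^ (A * (s - l + e - L)) := by
            gcongr
        _ = q ^ (a * (s - l) + A * (s - l + e - L)) := by rw [mul_one, pow_add]
        _ ≤ q ^ ((a + A) * (s - (l + L))) := by
            refine pow_le_pow_of_le_one hq0.le hq1.le ?_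
            rw [add_mul]
            exact add_le_add (Nat.mul_le_mul_left _ (by omega)) (Nat.mul_le_mul_left _ (by omega))
    · exact ⟨le_rfl, (pow_pos hq0 _).le⟩

theorem bosonWt_pos (hq0 : 0 < q) (hq1 : q < 1) (w : List (ℕ × ℕ × ℕ)) (s : ℕ)
    (hs : (w.map fun x => x.1).sum ≤ s) : 0 < bosonWt q w s := by
  induction w generalizing s with
  | nil => simp [bosonWt]
  | cons x w ih =>
    obtain ⟨l, a, e⟩ := x
    simp only [List.map_cons, List.sum_cons] at hs
    rw [bosonWt, if_pos (by omega)]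
    exact mul_pos (mul_pos (pow_pos hq0 _) (prod_one_sub_pow_mem hq0 hq1 e _).1)
      (ih _ (by omega))

theorem bosonWt_summable (hq0 : 0 < q) (hq1 : q < 1) (w : List (ℕ × ℕ × ℕ))
    (hw : 1 ≤ (w.map fun x => x.2.1).sum) : Summable (bosonWt q w) := by
  refine Summable.of_nonneg_of_le (fun s => (bosonWt_bounds hq0 hq1 w s).1) (fun s =>
    (bosonWt_bounds hq0 hq1 w s).2.trans (pow_le_pow_of_le_one hq0.le hq1.le
      (Nat.le_mul_of_pos_left (s - (w.map fun x => x.1).sum) hw))) ?_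
  rw [← summable_nat_add_iff (w.map fun x => x.1).sum]
  simpa using summable_geometric_of_lt_one hq0.le hq1

theorem bosonWt_tsum_pos (hq0 : 0 < q) (hq1 : q < 1) (w : List (ℕ × ℕ × ℕ))
    (hw : 1 ≤ (w.map fun x => x.2.1).sum) : 0 < ∑' s, bosonWt q w s :=
  (bosonWt_summable hq0 hq1 w hw).tsum_pos (fun s => (bosonWt_bounds hq0 hq1 w s).1) _
    (bosonWt_pos hq0 hq1 w _ le_rfl)

/-- The number of quanta at the end of a path. -/
def bosonEnd : List (ℕ × ℕ × ℕ) → ℕ → ℕ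
  | [], s => s
  | x :: w, s => bosonEnd w (s - x.1 + x.2.2)

theorem bosonWt_append (q : ℝ) (w w' : List (ℕ × ℕ × ℕ)) (s : ℕ) :
    bosonWt q (w ++ w') s = bosonWt q w s * bosonWt q w' (bosonEnd w s) := by
  induction w generalizing s with
  | nil => simp [bosonWt, bosonEnd]
  | cons x w ih =>
    rw [List.cons_append, bosonWt, bosonWt, bosonEnd, ih]
    split_ifs <;> ring

theorem bosonEnd_add (q : ℝ) (w : List (ℕ × ℕ × ℕ)) (s : ℕ) (h : bosonWt q w s ≠ 0) :
    bosonEnd w s + (w.map fun x => x.1).sum = s + (w.map fun x => x.2.2).sum := by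
  induction w generalizing s with
  | nil => simp [bosonEnd]
  | cons x w ih =>
    rw [bosonWt] at h
    have h1 : x.1 ≤ s := by
      by_contra hc
      exact h (if_neg hc)
    rw [if_pos h1] at h
    have h2 := ih _ (right_ne_zero_of_mul h)
    rw [bosonEnd]
    simp only [List.map_cons, List.sum_cons]
    omega

theorem tsum_shift {f : ℕ → ℝ} {k : ℕ} (h : ∀ s, s < k → f s = 0) :
    ∑' s, f s = ∑' u, f (u + k) := by
  refine (Function.Injective.tsum_eq (add_left_injective k) fun s hs => ?_).symm
  refine ⟨s - k, Nat.sub_add_cancel ?_⟩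
  by_contra hc
  exact hs (h s (not_le.mp hc))

/-- The trace over a single boson is cyclic. -/
theorem bosonWt_tsum_rotate (q : ℝ) (x : ℕ × ℕ × ℕ) (w : List (ℕ × ℕ × ℕ))
    (h : ((x :: w).map fun x => x.1).sum = ((x :: w).map fun x => x.2.2).sum) :
    ∑' s, bosonWt q (x :: w) s = ∑' s, bosonWt q (w ++ [x]) s := by
  simp only [List.map_cons, List.sum_cons] at h
  have hend (s : ℕ) (hs : bosonWt q w s ≠ 0) : bosonEnd w s + x.2.2 = s + x.1 := by
    have := bosonEnd_add q w s hs
    omega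
  rw [tsum_shift (k := x.1), tsum_shift (k := x.2.2) (f := bosonWt q (w ++ [x]))]
  · congr 1
    ext u
    rw [bosonWt_append, bosonWt, if_pos (Nat.le_add_left _ _), Nat.add_sub_cancel]
    by_cases hz : bosonWt q w (u + x.2.2) = 0
    · rw [hz, mul_zero, zero_mul]
    · have h1 : bosonEnd w (u + x.2.2) = u + x.1 := by
        have := hend _ hz
        omega
      rw [h1, bosonWt, if_pos (Nat.le_add_left _ _), Nat.add_sub_cancel, bosonWt]
      ring
  · intro s hs
    rw [bosonWt_append]
    by_cases hz : bosonWt q w s = 0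
    · rw [hz, zero_mul]
    · have := hend _ hz
      rw [bosonWt, if_neg (by omega), mul_zero]
  · intro s hs
    rw [bosonWt, if_neg (by omega)]

theorem hasSum_pi_prod {n : ℕ} {f : Fin n → ℕ → ℝ} (h0 : ∀ i s, 0 ≤ f i s)
    (hf : ∀ i, Summable (f i)) :
    HasSum (fun s : Fin n → ℕ => ∏ i, f i (s i)) (∏ i, ∑' s, f i s) := by
  induction n with
  | zero => simp [hasSum_unique]
  | succ n ih =>
    have h1 := ih (f := fun i => f i.succ) (fun i => h0 i.succ) (fun i => hf i.succ)
    have h2 := (hf 0).mul_of_nonneg h1.summable (h0 0)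
      (fun s => Finset.prod_nonneg fun i _ => h0 i.succ _)
    have h3 := (hf 0).hasSum.mul h1 h2
    rw [Fin.prod_univ_succ]
    rw [← (Fin.consEquiv fun _ : Fin (n + 1) => ℕ).hasSum_iff]
    have h4 : (fun s : Fin (n + 1) → ℕ => ∏ i, f i (s i)) ∘ (Fin.consEquiv fun _ => ℕ) =
        fun x => f 0 x.1 * ∏ i : Fin n, f i.succ (x.2 i) := by
      ext ⟨a, s⟩
      simp [Fin.prod_univ_succ, Fin.consEquiv]
    rw [h4]
    exact h3

end Boson

/-! ### Sums over lists of fixed length -/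

section ListSum

variable {X A : Type*} [AddCommMonoid A]

/-- The sum of `f` over the lists of length `N` with entries in `B`. -/
def listSum (B : Finset X) : ℕ → (List X → A) → A
  | 0, f => f []
  | N + 1, f => ∑ l ∈ B, listSum B N fun ls => f (l :: ls)

theorem listSum_congr {B : Finset X} {N : ℕ} {f g : List X → A}
    (h : ∀ ls, ls.length = N → f ls = g ls) : listSum B N f = listSum B N g := by
  induction N generalizing f g with
  | zero => exact h [] rfl
  | succ N ih =>
    exact Finset.sum_congr rfl fun l _ => ih fun ls hls => h _ (by simp [hls])

theorem listSum_zero (B : Finset X) (N : ℕ) : listSum B N (fun _ => (0 : A)) = 0 := by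
  induction N with
  | zero => rfl
  | succ N ih => exact Finset.sum_eq_zero fun l _ => ih

theorem map_listSum {A' : Type*} [AddCommMonoid A'] (φ : A →+ A') (B : Finset X) (N : ℕ)
    (f : List X → A) : φ (listSum B N f) = listSum B N fun ls => φ (f ls) := by
  induction N generalizing f with
  | zero => rfl
  | succ N ih => simp only [listSum, map_sum, ih]

/-- The last entry may be summed first. -/
theorem listSum_succ_last (B : Finset X) (N : ℕ) (f : List X → A) :
    listSum B (N + 1) f = ∑ l ∈ B, listSum B N fun ls => f (ls ++ [l]) := by
  induction N generalizing f with
  | zero => rfl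
  | succ N ih =>
    rw [listSum]
    rw [Finset.sum_congr rfl fun l _ => ih fun ls => f (l :: ls), Finset.sum_comm]
    rfl

theorem listSum_subset {B B' : Finset X} (hB : B ⊆ B') {N : ℕ} {f : List X → A}
    (h : ∀ ls, (∃ l ∈ ls, l ∉ B) → f ls = 0) : listSum B' N f = listSum B N f := by
  induction N generalizing f with
  | zero => rfl
  | succ N ih =>
    rw [listSum, listSum, ← Finset.sum_subset hB]
    · refine Finset.sum_congr rfl fun l _ => ih fun ls ⟨l', hl', hn⟩ => ?_
      exact h _ ⟨l', List.mem_cons_of_mem _ hl', hn⟩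
    · intro l _ hl
      have : ∀ ls, f (l :: ls) = 0 := fun ls => h _ ⟨l, List.mem_cons_self, hl⟩
      simp only [this, listSum_zero]

theorem listSum_pos {B : Finset X} {N : ℕ} {f : List X → ℝ}
    (h0 : ∀ ls, ls.length = N → 0 ≤ f ls)
    (h1 : ∃ ls : List X, ls.length = N ∧ (∀ l ∈ ls, l ∈ B) ∧ 0 < f ls) : 0 < listSum B N f := by
  have nonneg : ∀ (N : ℕ) (f : List X → ℝ), (∀ ls, ls.length = N → 0 ≤ f ls) →
      0 ≤ listSum B N f := by
    intro N
    induction N with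
    | zero => exact fun f h => h [] rfl
    | succ N ih => exact fun f h => Finset.sum_nonneg fun l _ => ih _ fun ls hls => h _ (by simp [hls])
  induction N generalizing f with
  | zero =>
    obtain ⟨ls, hls, -, hpos⟩ := h1
    rw [List.length_eq_zero_iff] at hls
    subst hls
    exact hpos
  | succ N ih =>
    obtain ⟨ls, hls, hB, hpos⟩ := h1
    obtain ⟨l, ls, rfl⟩ := List.exists_cons_of_length_eq_add_one hls
    refine Finset.sum_pos' (fun l _ => nonneg N _ fun ls hls => h0 _ (by simp [hls]))
      ⟨l, hB l List.mem_cons_self, ih (fun ls hls => h0 _ (by simp [hls])) ⟨ls, ?_, ?_, hpos⟩⟩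
    · simpa using hls
    · exact fun l' hl' => hB l' (List.mem_cons_of_mem _ hl')

theorem hasSum_listSum {Y : Type*} {B : Finset X} {N : ℕ} {F : List X → Y → ℝ} {G : List X → ℝ}
    (h : ∀ ls, ls.length = N → HasSum (F ls) (G ls)) :
    HasSum (fun y => listSum B N fun ls => F ls y) (listSum B N G) := by
  induction N generalizing F G with
  | zero => exact h [] rfl
  | succ N ih => exact hasSum_sum fun l _ => ih fun ls hls => h _ (by simp [hls])

end ListSum

/-! ### The trace formula -/

/-- The product of a list of operators on row vectors, the first one acting first. -/
def rowProd {R : Type*} [Monoid R] (xs : List R) : R := xs.foldr (fun x y => y * x) 1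

theorem rowProd_nil {R : Type*} [Monoid R] : rowProd ([] : List R) = 1 := rfl

theorem rowProd_cons {R : Type*} [Monoid R] (x : R) (xs : List R) :
    rowProd (x :: xs) = rowProd xs * x := rfl

theorem rowProd_append {R : Type*} [Monoid R] (xs ys : List R) :
    rowProd (xs ++ ys) = rowProd ys * rowProd xs := by
  induction xs with
  | nil => rw [List.nil_append, rowProd_nil, mul_one]
  | cons x xs ih => rw [List.cons_append, rowProd_cons, rowProd_cons, ih, mul_assoc]

/-- The trace, as the sum of the diagonal matrix elements. -/
def opTrace {I : Type} (T : Module.End ℝ (I →₀ ℝ)) : ℝ := ∑' p, T (Finsupp.single p 1) p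

theorem hasSum_mul_prod {X Y : Type*} {f : X → ℝ} {g : Y → ℝ} {b : ℝ} (hf : Summable f)
    (hg : HasSum g b) : HasSum (fun x : X × Y => f x.1 * g x.2) ((∑' x, f x) * b) :=
  hf.hasSum.mul hg (summable_mul_of_summable_norm hf.norm hg.summable.norm)

section Step

variable {I : Type} {n : ℕ}

/-- The operator `∑_l T_l ⊗ ∏_i b_i^{l_i} k_i^{α_i^+} c_i^{α_i}`. -/
def entryOp (q : ℝ) (α : Fin (n + 1) → ℕ) :
    ((Fin n → ℕ) → Module.End ℝ (I →₀ ℝ)) →ₗ[ℝ] Module.End ℝ (I × (Fin n → ℕ) →₀ ℝ) where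
  toFun T := glue fun s => ∑ l ∈ Finset.Iic s,
    wt q α (s - l) • (embed (s - l + α ∘ Fin.castSucc) ∘ₗ T l)
  map_add' S T := embed_ext fun s v => by
    simp only [glue_embed, LinearMap.sum_apply, LinearMap.smul_apply, LinearMap.add_apply,
      LinearMap.comp_apply, Pi.add_apply, map_add, smul_add, Finset.sum_add_distrib]
  map_smul' c T := embed_ext fun s v => by
    simp only [glue_embed, LinearMap.sum_apply, LinearMap.smul_apply, LinearMap.comp_apply,
      Pi.smul_apply, map_smul, Finset.smul_sum, RingHom.id_apply]
    exact Finset.sum_congr rfl fun l _ => smul_comm _ _ _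

theorem entryOp_embed (q : ℝ) (α : Fin (n + 1) → ℕ) (T : (Fin n → ℕ) → Module.End ℝ (I →₀ ℝ))
    (s : Fin n → ℕ) (v : I →₀ ℝ) : entryOp q α T (embed s v) =
      ∑ l ∈ Finset.Iic s, wt q α (s - l) • embed (s - l + α ∘ Fin.castSucc) (T l v) := by
  have h : entryOp q α T = glue fun s => ∑ l ∈ Finset.Iic s,
    wt q α (s - l) • (embed (s - l + α ∘ Fin.castSucc) ∘ₗ T l) := rfl
  rw [h, glue_embed, LinearMap.sum_apply]
  rfl

/-- A term of the recursion: a multi-index `α` and the family of coefficient operators. -/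
abbrev Entry (I : Type) (n : ℕ) : Type :=
  (Fin (n + 1) → ℕ) × ((Fin n → ℕ) → Module.End ℝ (I →₀ ℝ))

open Classical in
/-- The weight of the path of the adjoined bosons with steps `ls`. -/
def pathWt (q : ℝ) : List (Entry I n) → List (Fin n → ℕ) → (Fin n → ℕ) → ℝ
  | y :: ys, l :: ls, s => if l ≤ s then
      wt q y.1 (s - l) * pathWt q ys ls (s - l + y.1 ∘ Fin.castSucc) else 0
  | _, _, _ => 1

/-- The end of the path of the adjoined bosons with steps `ls`. -/
def pathEnd : List (Entry I n) → List (Fin n → ℕ) → (Fin n → ℕ) → (Fin n → ℕ)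
  | y :: ys, l :: ls, s => pathEnd ys ls (s - l + y.1 ∘ Fin.castSucc)
  | _, _, s => s

/-- The coefficient operators selected by `ls`. -/
def pathOps (ys : List (Entry I n)) (ls : List (Fin n → ℕ)) : List (Module.End ℝ (I →₀ ℝ)) :=
  List.zipWith (fun y l => y.2 l) ys ls

/-- The word in the `i`-th boson selected by `ls`. -/
def pathWord (i : Fin n) (ys : List (Entry I n)) (ls : List (Fin n → ℕ)) : List (ℕ × ℕ × ℕ) :=
  List.zipWith (fun y l => (l i, ∑ j ∈ Finset.Ioi i.castSucc, y.1 j, y.1 i.castSucc)) ys ls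

/-- The total of the multi-indices of a list, restricted to the adjoined bosons. -/
def charge (ys : List (Entry I n)) : Fin n → ℕ := (ys.map fun y => y.1 ∘ Fin.castSucc).sum

/-- The image of `v ⊗ ⟨s|` under a product, as a sum over paths. The bound `M` only has to exceed
all multi-indices that can contribute. -/
theorem rowProd_entryOp_embed (q : ℝ) (M : Fin n → ℕ) (ys : List (Entry I n)) (s : Fin n → ℕ)
    (v : I →₀ ℝ) (hM : s + charge ys ≤ M) :
    rowProd (ys.map fun y => entryOp q y.1 y.2) (embed s v) =
      listSum (Finset.Iic M) ys.length fun ls =>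
        pathWt q ys ls s • embed (pathEnd ys ls s) (rowProd (pathOps ys ls) v) := by
  induction ys generalizing s v with
  | nil => simp [listSum, pathWt, pathEnd, pathOps, rowProd_nil]
  | cons y ys ih =>
    rw [List.map_cons, rowProd_cons, Module.End.mul_apply, entryOp_embed, map_sum, List.length_cons,
      listSum]
    have hcons : charge (y :: ys) = y.1 ∘ Fin.castSucc + charge ys := by simp [charge]
    rw [hcons] at hM
    have hs : Finset.Iic s ⊆ Finset.Iic M :=
      Finset.Iic_subset_Iic.mpr (le_trans (le_add_of_nonneg_right (zero_le)) hM)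
    rw [← Finset.sum_subset hs]
    · refine Finset.sum_congr rfl fun l hl => ?_
      have hl' := Finset.mem_Iic.mp hl
      rw [map_smul, ih]
      · rw [← DistribSMul.toAddMonoidHom_apply, map_listSum]
        refine listSum_congr fun ls _ => ?_
        rw [pathWt, if_pos hl', pathEnd, mul_smul]
        rfl
      · rw [add_assoc]
        exact le_trans (add_le_add_left tsub_le_self _) hM
    · intro l _ hl
      rw [Finset.mem_Iic] at hl
      simp only [pathWt, if_neg hl, zero_smul, listSum_zero]

theorem pathEnd_add (q : ℝ) (ys : List (Entry I n)) (ls : List (Fin n → ℕ)) (s : Fin n → ℕ)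
    (hlen : ls.length = ys.length) (h : pathWt q ys ls s ≠ 0) :
    pathEnd ys ls s + ls.sum = s + charge ys := by
  induction ys generalizing ls s with
  | nil =>
    rw [List.length_nil, List.length_eq_zero_iff] at hlen
    subst hlen
    simp [pathEnd, charge]
  | cons y ys ih =>
    obtain ⟨l, ls, rfl⟩ := List.exists_cons_of_length_eq_add_one hlen
    rw [pathWt] at h
    have h1 : l ≤ s := by
      by_contra hc
      exact h (if_neg hc)
    rw [if_pos h1] at h
    have h2 := ih ls _ (by simpa using hlen) (right_ne_zero_of_mul h)
    have hcons : charge (y :: ys) = y.1 ∘ Fin.castSucc + charge ys := by simp [charge]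
    rw [pathEnd, List.sum_cons, hcons, add_left_comm, h2, ← add_assoc, ← add_assoc,
      add_tsub_cancel_of_le h1, add_assoc]

theorem pathWt_eq_prod (q : ℝ) (ys : List (Entry I n)) (ls : List (Fin n → ℕ)) (s : Fin n → ℕ)
    (hlen : ls.length = ys.length) :
    pathWt q ys ls s = ∏ i, bosonWt q (pathWord i ys ls) (s i) := by
  induction ys generalizing ls s with
  | nil => simp [pathWt, pathWord, bosonWt]
  | cons y ys ih =>
    obtain ⟨l, ls, rfl⟩ := List.exists_cons_of_length_eq_add_one hlen
    rw [pathWt]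
    simp only [pathWord, List.zipWith_cons_cons, bosonWt]
    split_ifs with h
    · rw [ih ls _ (by simpa using hlen), wt, ← Finset.prod_mul_distrib]
      exact Finset.prod_congr rfl fun i _ => by rw [if_pos (h i)]; rfl
    · rw [Pi.le_def, not_forall] at h
      obtain ⟨i, hi⟩ := h
      exact (Finset.prod_eq_zero (Finset.mem_univ i) (if_neg hi)).symm

open Classical in
/-- A diagonal matrix element of a product, as a sum over a set of steps that does not depend on
the matrix element. -/
theorem rowProd_entryOp_diag (q : ℝ) (ys : List (Entry I n)) (p : I) (s : Fin n → ℕ) :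
    rowProd (ys.map fun y => entryOp q y.1 y.2) (Finsupp.single (p, s) 1) (p, s) =
      listSum (Finset.Iic (charge ys)) ys.length fun ls => if ls.sum = charge ys then
        rowProd (pathOps ys ls) (Finsupp.single p 1) p *
          ∏ i, bosonWt q (pathWord i ys ls) (s i) else 0 := by
  rw [← embed_single, rowProd_entryOp_embed q (s + charge ys) ys s _ le_rfl]
  have h1 := map_listSum (Finsupp.applyAddHom ((p, s) : I × (Fin n → ℕ))) (Finset.Iic (s + charge ys))
    ys.length fun ls => pathWt q ys ls s •
      embed (pathEnd ys ls s) (rowProd (pathOps ys ls) (Finsupp.single p (1 : ℝ)))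
  refine h1.trans ?_
  rw [← listSum_subset (B := Finset.Iic (charge ys)) (B' := Finset.Iic (s + charge ys))]
  · refine listSum_congr fun ls hls => ?_
    change (pathWt q ys ls s • embed (pathEnd ys ls s) _) (p, s) = _
    rw [Finsupp.smul_apply, smul_eq_mul]
    by_cases hz : pathWt q ys ls s = 0
    · rw [hz, zero_mul, ← pathWt_eq_prod q ys ls s hls, hz, mul_zero, ite_self]
    · have h2 := pathEnd_add q ys ls s hls hz
      split_ifs with h3
      · rw [h3] at h2
        rw [add_right_cancel h2, embed_apply_same, ← pathWt_eq_prod q ys ls s hls, mul_comm]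
      · rw [embed_apply_ne, mul_zero]
        intro h4
        rw [← h4] at h2
        exact h3 (add_left_cancel h2)
  · exact Finset.Iic_subset_Iic.mpr (le_add_of_nonneg_left zero_le)
  · rintro ls ⟨l, hl, hn⟩
    rw [if_neg]
    intro h
    refine hn (Finset.mem_Iic.mpr ?_)
    rw [← h]
    exact List.le_sum_of_mem hl

/-- The properties of a graded family of classes of operators that the cyclicity of the trace
rests on: a product of operators whose total charge has no vanishing component has an absolutely
summable diagonal, and its trace is invariant under rotations. -/
structure IsTraceClass (C : (Fin n → ℕ) → Submodule ℝ (Module.End ℝ (I →₀ ℝ))) : Prop where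
  summable : ∀ xs : List ((Fin n → ℕ) × Module.End ℝ (I →₀ ℝ)), (∀ x ∈ xs, x.2 ∈ C x.1) →
    (∀ a, 1 ≤ (xs.map Prod.fst).sum a) →
    Summable fun p => rowProd (xs.map Prod.snd) (Finsupp.single p 1) p
  rotate : ∀ x (xs : List ((Fin n → ℕ) × Module.End ℝ (I →₀ ℝ))), (∀ y ∈ x :: xs, y.2 ∈ C y.1) →
    (∀ a, 1 ≤ ((x :: xs).map Prod.fst).sum a) →
    opTrace (rowProd ((x :: xs).map Prod.snd)) = opTrace (rowProd ((xs ++ [x]).map Prod.snd))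

/-- The class of charge `α` in the next rank: the sums `∑_l T_l ⊗ ∏_i b_i^{l_i} k_i^{α_i^+} c_i^{α_i}`
with `T_l` in the class of charge `l`. -/
def nextClass (q : ℝ) (C : (Fin n → ℕ) → Submodule ℝ (Module.End ℝ (I →₀ ℝ)))
    (α : Fin (n + 1) → ℕ) : Submodule ℝ (Module.End ℝ (I × (Fin n → ℕ) →₀ ℝ)) :=
  (Submodule.pi Set.univ C).map (entryOp q α)

variable {C : (Fin n → ℕ) → Submodule ℝ (Module.End ℝ (I →₀ ℝ))} {q : ℝ}

theorem exists_entries {xs : List ((Fin (n + 1) → ℕ) × Module.End ℝ (I × (Fin n → ℕ) →₀ ℝ))}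
    (h : ∀ x ∈ xs, x.2 ∈ nextClass q C x.1) :
    ∃ ys : List (Entry I n), (ys.map fun y => (y.1, entryOp q y.1 y.2)) = xs ∧
      ∀ y ∈ ys, ∀ l, y.2 l ∈ C l := by
  induction xs with
  | nil => exact ⟨[], rfl, by simp⟩
  | cons x xs ih =>
    obtain ⟨ys, rfl, hys⟩ := ih fun y hy => h y (List.mem_cons_of_mem _ hy)
    obtain ⟨T, hT, hx⟩ := h x List.mem_cons_self
    refine ⟨(x.1, T) :: ys, ?_, ?_⟩
    · rw [List.map_cons, hx]
    · intro y hy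
      rcases List.mem_cons.mp hy with rfl | hy
      · exact fun l => hT l trivial
      · exact hys y hy

theorem charge_apply (ys : List (Entry I n)) (i : Fin n) :
    charge ys i = (ys.map Prod.fst).sum i.castSucc := by
  induction ys with
  | nil => rfl
  | cons y ys ih =>
    simp only [charge, List.map_cons, List.sum_cons, Pi.add_apply] at ih ⊢
    rw [ih]; rfl

theorem pathWord_sums (i : Fin n) (ys : List (Entry I n)) (ls : List (Fin n → ℕ))
    (hlen : ls.length = ys.length) :
    ((pathWord i ys ls).map fun x => x.1).sum = ls.sum i ∧
    ((pathWord i ys ls).map fun x => x.2.2).sum = charge ys i ∧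
    ((pathWord i ys ls).map fun x => x.2.1).sum =
      ∑ j ∈ Finset.Ioi i.castSucc, (ys.map Prod.fst).sum j := by
  induction ys generalizing ls with
  | nil =>
    rw [List.length_nil, List.length_eq_zero_iff] at hlen
    subst hlen
    simp [pathWord, charge]
  | cons y ys ih =>
    obtain ⟨l, ls, rfl⟩ := List.exists_cons_of_length_eq_add_one hlen
    obtain ⟨h1, h2, h3⟩ := ih ls (by simpa using hlen)
    simp only [pathWord] at h1 h2 h3
    simp only [pathWord, List.zipWith_cons_cons, List.map_cons, List.sum_cons, h1, h2, h3,
      Pi.add_apply, charge, Finset.sum_add_distrib, Function.comp_apply, and_self]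

theorem pathWord_basic {ys : List (Entry I n)} (hb : ∀ a, 1 ≤ (ys.map Prod.fst).sum a)
    {ls : List (Fin n → ℕ)} (hlen : ls.length = ys.length) (i : Fin n) :
    1 ≤ ((pathWord i ys ls).map fun x => x.2.1).sum := by
  rw [(pathWord_sums i ys ls hlen).2.2]
  exact (hb (Fin.last n)).trans (Finset.single_le_sum
    (f := fun j => (ys.map Prod.fst).sum j) (fun j _ => Nat.zero_le _)
    (Finset.mem_Ioi.mpr (Fin.castSucc_lt_last i)))

/-- The pairs of charges and operators selected by `ls`. -/
def pathPairs (ys : List (Entry I n)) (ls : List (Fin n → ℕ)) :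
    List ((Fin n → ℕ) × Module.End ℝ (I →₀ ℝ)) :=
  List.zipWith (fun y l => (l, y.2 l)) ys ls

theorem pathPairs_snd (ys : List (Entry I n)) (ls : List (Fin n → ℕ)) :
    (pathPairs ys ls).map Prod.snd = pathOps ys ls := by
  rw [pathPairs, pathOps, List.map_zipWith]

theorem pathPairs_fst (ys : List (Entry I n)) (ls : List (Fin n → ℕ))
    (hlen : ls.length = ys.length) : (pathPairs ys ls).map Prod.fst = ls := by
  induction ys generalizing ls with
  | nil =>
    rw [List.length_nil, List.length_eq_zero_iff] at hlen
    subst hlen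
    rfl
  | cons y ys ih =>
    obtain ⟨l, ls, rfl⟩ := List.exists_cons_of_length_eq_add_one hlen
    have := ih ls (by simpa using hlen)
    simp only [pathPairs, List.zipWith_cons_cons, List.map_cons] at this ⊢
    rw [this]

theorem pathPairs_mem {ys : List (Entry I n)} (hys : ∀ y ∈ ys, ∀ l, y.2 l ∈ C l)
    (ls : List (Fin n → ℕ)) : ∀ x ∈ pathPairs ys ls, x.2 ∈ C x.1 := by
  intro x hx
  rw [pathPairs, ← List.map_uncurry_zip_eq_zipWith, List.mem_map] at hx
  obtain ⟨⟨y, l⟩, hyl, rfl⟩ := hx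
  exact hys y (List.of_mem_zip hyl).1 l

open Classical in
/-- The trace of a product is a finite sum of products of traces of rank `n` and of traces over
single bosons. -/
theorem hasSum_trace (hC : IsTraceClass C) (hq0 : 0 < q) (hq1 : q < 1) {ys : List (Entry I n)}
    (hys : ∀ y ∈ ys, ∀ l, y.2 l ∈ C l) (hb : ∀ a, 1 ≤ (ys.map Prod.fst).sum a) :
    HasSum (fun p => rowProd (ys.map fun y => entryOp q y.1 y.2) (Finsupp.single p 1) p)
      (listSum (Finset.Iic (charge ys)) ys.length fun ls => if ls.sum = charge ys then
        opTrace (rowProd (pathOps ys ls)) *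
          ∏ i, ∑' s, bosonWt q (pathWord i ys ls) s else 0) := by
  have h1 : (fun p => rowProd (ys.map fun y => entryOp q y.1 y.2) (Finsupp.single p 1) p) =
      fun p : I × (Fin n → ℕ) => listSum (Finset.Iic (charge ys)) ys.length fun ls =>
        if ls.sum = charge ys then rowProd (pathOps ys ls) (Finsupp.single p.1 1) p.1 *
          ∏ i, bosonWt q (pathWord i ys ls) (p.2 i) else 0 :=
    funext fun p => rowProd_entryOp_diag q ys p.1 p.2
  rw [h1]
  refine hasSum_listSum fun ls hls => ?_
  split_ifs with hsum
  · have h2 : Summable fun p => rowProd (pathOps ys ls) (Finsupp.single p 1) p := by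
      rw [← pathPairs_snd]
      refine hC.summable _ (pathPairs_mem hys ls) fun a => ?_
      rw [pathPairs_fst ys ls hls, hsum, charge_apply]
      exact hb _
    have h3 := hasSum_pi_prod (f := fun i => bosonWt q (pathWord i ys ls))
      (fun i s => (bosonWt_bounds hq0 hq1 _ s).1)
      (fun i => bosonWt_summable hq0 hq1 _ (pathWord_basic hb hls i))
    have h4 := hasSum_mul_prod h2 h3
    unfold opTrace
    generalize (fun p => rowProd (pathOps ys ls) (Finsupp.single p 1) p) = f at h4 ⊢
    exact h4
  · exact hasSum_zero

theorem charge_rotate (y : Entry I n) (ys : List (Entry I n)) :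
    charge (y :: ys) = charge (ys ++ [y]) := by
  simp [charge, add_comm]

/-- The properties of the trace pass to the next rank: the trace formula reduces them to those of
rank `n` and of single bosons. The steps `ls` rotate along with the operators. -/
theorem isTraceClass_next (hC : IsTraceClass C) (hq0 : 0 < q) (hq1 : q < 1) :
    IsTraceClass (nextClass q C) where
  summable xs hxs hb := by
    obtain ⟨ys, rfl, hys⟩ := exists_entries hxs
    rw [List.map_map] at hb ⊢
    exact (hasSum_trace hC hq0 hq1 hys hb).summable
  rotate x xs hxs hb := by
    classical
    obtain ⟨zs, hzs, hys⟩ := exists_entries hxs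
    obtain ⟨y, ys, rfl, rfl, rfl⟩ := List.map_eq_cons_iff.mp hzs
    rw [← List.map_cons (f := fun y : Entry I n => (y.1, entryOp q y.1 y.2)), List.map_map] at hb
    have hb' : ∀ a, 1 ≤ ((ys ++ [y]).map Prod.fst).sum a := by
      intro a
      have h0 : 1 ≤ ((y :: ys).map Prod.fst).sum a := hb a
      rw [List.map_append, List.sum_append, add_comm]
      simpa using h0
    have hys' : ∀ z ∈ ys ++ [y], ∀ l, z.2 l ∈ C l := fun z hz => hys z (by
      simp only [List.mem_append, List.mem_cons, List.not_mem_nil, or_false] at hz ⊢; tauto)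
    have t1 := (hasSum_trace hC hq0 hq1 hys hb).tsum_eq
    have t2 := (hasSum_trace hC hq0 hq1 hys' hb').tsum_eq
    have e1 : ((y.1, entryOp q y.1 y.2) :: ys.map fun y => (y.1, entryOp q y.1 y.2)).map Prod.snd =
        (y :: ys).map fun y => entryOp q y.1 y.2 := by simp
    have e2 : ((ys.map fun y => (y.1, entryOp q y.1 y.2)) ++ [(y.1, entryOp q y.1 y.2)]).map
        Prod.snd = (ys ++ [y]).map fun y => entryOp q y.1 y.2 := by simp
    rw [e1, e2, opTrace, opTrace, t1, t2, ← charge_rotate, List.length_cons, List.length_append,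
      List.length_singleton]
    refine Eq.trans ?_ (listSum_succ_last _ _ _).symm
    rw [listSum]
    refine Finset.sum_congr rfl fun l _ => listSum_congr fun ls hls => ?_
    have hsum : (ls ++ [l]).sum = (l :: ls).sum := by simp [add_comm]
    rw [hsum]
    split_ifs with h
    · have hops : pathOps (ys ++ [y]) (ls ++ [l]) = pathOps ys ls ++ [y.2 l] := by
        rw [pathOps, List.zipWith_append hls.symm]; rfl
      have hword (i : Fin n) : pathWord i (ys ++ [y]) (ls ++ [l]) = pathWord i ys ls ++
          [(l i, ∑ j ∈ Finset.Ioi i.castSucc, y.1 j, y.1 i.castSucc)] := by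
        rw [pathWord, List.zipWith_append hls.symm]; rfl
      have hlen : (l :: ls).length = (y :: ys).length := by simp [hls]
      congr 1
      · have h4 := hC.rotate (l, y.2 l) (pathPairs ys ls) (pathPairs_mem hys (l :: ls)) (by
          intro a
          have h5 := pathPairs_fst (y :: ys) (l :: ls) hlen
          have h6 : (l, y.2 l) :: pathPairs ys ls = pathPairs (y :: ys) (l :: ls) := rfl
          rw [h6, h5, h, charge_apply]
          exact hb _)
        rw [List.map_append, List.map_cons, pathPairs_snd] at h4
        rw [hops]
        exact h4
      · refine Finset.prod_congr rfl fun i _ => ?_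
        rw [hword]
        refine bosonWt_tsum_rotate q _ _ ?_
        obtain ⟨h5, h6, -⟩ := pathWord_sums i (y :: ys) (l :: ls) hlen
        exact h5.trans ((congrFun h i).trans h6.symm)
    · rfl

end Step

/-! ### Cyclicity and positivity of the trace in every rank -/

theorem IsTraceClass.rotate_append {I : Type} {n : ℕ}
    {C : (Fin n → ℕ) → Submodule ℝ (Module.End ℝ (I →₀ ℝ))} (hC : IsTraceClass C)
    (xs ys : List ((Fin n → ℕ) × Module.End ℝ (I →₀ ℝ))) (h : ∀ x ∈ xs ++ ys, x.2 ∈ C x.1)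
    (hb : ∀ a, 1 ≤ ((xs ++ ys).map Prod.fst).sum a) :
    opTrace (rowProd ((xs ++ ys).map Prod.snd)) = opTrace (rowProd ((ys ++ xs).map Prod.snd)) := by
  induction xs generalizing ys with
  | nil => rw [List.nil_append, List.append_nil]
  | cons x xs ih =>
    rw [List.cons_append] at h hb ⊢
    rw [hC.rotate x (xs ++ ys) h hb, List.append_assoc, ih (ys ++ [x])]
    · rw [List.append_assoc, List.singleton_append]
    · intro y hy
      refine h y ?_
      simp only [List.mem_append, List.mem_cons, List.not_mem_nil, or_false] at hy ⊢
      tauto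
    · intro a
      have h1 : (((x :: (xs ++ ys)).map Prod.fst).sum : Fin n → ℕ) =
          ((xs ++ (ys ++ [x])).map Prod.fst).sum := by
        simp only [List.map_cons, List.map_append, List.sum_cons, List.sum_append, List.map_nil,
          List.sum_nil, add_zero]
        abel
      rw [← h1]
      exact hb a

/-- The graded classes of operators on `F^{⊗ n(n-1)/2}` for which the trace is cyclic. -/
def opClass (q : ℝ) : (n : ℕ) → (Fin n → ℕ) → Submodule ℝ (Module.End ℝ (FockIdx n →₀ ℝ))
  | 0, _ => ⊤
  | n + 1, α => nextClass q (opClass q n) α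

theorem end_unit_comm (S T : Module.End ℝ (Unit →₀ ℝ)) : S * T = T * S := by
  have h (T : Module.End ℝ (Unit →₀ ℝ)) (v : Unit →₀ ℝ) :
      T v = T (Finsupp.single () 1) () • v := by
    have h1 (w : Unit →₀ ℝ) : w = w () • Finsupp.single () (1 : ℝ) := by
      ext; simp
    conv_lhs => rw [h1 v, map_smul, h1 (T _), smul_comm, ← h1 v]
  refine LinearMap.ext fun v => ?_
  rw [Module.End.mul_apply, Module.End.mul_apply, h S, h T v, h T (S v), h S v, smul_comm]

theorem opTrace_unit (c : ℝ) : opTrace (c • (1 : Module.End ℝ (Unit →₀ ℝ))) = c := by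
  rw [opTrace, tsum_fintype, Fintype.sum_unique, LinearMap.smul_apply, Finsupp.smul_apply,
    Module.End.one_apply]
  simp

theorem isTraceClass_unit (C : (Fin 0 → ℕ) → Submodule ℝ (Module.End ℝ (Unit →₀ ℝ))) :
    IsTraceClass C where
  summable _ _ _ := Summable.of_finite
  rotate x xs _ _ := by
    rw [List.map_cons, rowProd_cons, List.map_append, rowProd_append, end_unit_comm]
    rfl

theorem isTraceClass_opClass {q : ℝ} (hq0 : 0 < q) (hq1 : q < 1) (n : ℕ) :
    IsTraceClass (opClass q n) := by
  induction n with
  | zero => exact isTraceClass_unit _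
  | succ n ih => exact isTraceClass_next ih hq0 hq1

section Class

variable {q : ℝ} (hq0 : 0 < q) (hq1 : q < 1)

theorem zf_D_mem (n : ℕ) (α : Fin n → ℕ) : (zf hq0 hq1 n).D α ∈ opClass q n α := by
  induction n with
  | zero => exact Submodule.mem_top
  | succ n ih =>
    refine ⟨Pi.single 0 1, fun l _ => ?_, ?_⟩
    · by_cases h : l = 0
      · subst h
        rw [Pi.single_eq_same, ← (zf hq0 hq1 n).D_zero]
        exact ih 0
      · rw [Pi.single_eq_of_ne h]
        exact Submodule.zero_mem _
    · refine embed_ext fun s v => ?_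
      rw [entryOp_embed, Finset.sum_eq_single_of_mem 0 (Finset.mem_Iic.mpr zero_le)]
      · rw [Pi.single_eq_same, tsub_zero]
        exact (dOp_embed q α s v).symm
      · intro l _ h
        rw [Pi.single_eq_of_ne h, LinearMap.zero_apply, map_zero, smul_zero]

theorem entryOp_zf {n : ℕ} {ζ : ℝ} (hζ : ζ ≠ 0) (c : ℝ) (α : Fin (n + 1) → ℕ) :
    entryOp q α (fun l => (c * gCoeff q ζ l) • ((zf hq0 hq1 n).D l * (zf hq0 hq1 n).Z ζ)) =
      c • ((zf hq0 hq1 (n + 1)).D α * (zf hq0 hq1 (n + 1)).Z ζ) := by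
  have h : (fun l => (c * gCoeff q ζ l) • ((zf hq0 hq1 n).D l * (zf hq0 hq1 n).Z ζ)) =
      c • fun l => gCoeff q ζ l • ((zf hq0 hq1 n).D l * (zf hq0 hq1 n).Z ζ) := by
    funext l
    rw [Pi.smul_apply, mul_smul]
  rw [h, map_smul]
  congr 1
  refine embed_ext fun s v => ?_
  rw [entryOp_embed]
  exact (next_D_mul_Z_embed hq0 hq1 (zf hq0 hq1 n) hζ α s v).symm

theorem zf_D_mul_Z_mem {ζ : ℝ} (hζ : ζ ≠ 0) (n : ℕ) (α : Fin n → ℕ) :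
    (zf hq0 hq1 n).D α * (zf hq0 hq1 n).Z ζ ∈ opClass q n α := by
  induction n with
  | zero => exact Submodule.mem_top
  | succ n ih =>
    refine ⟨_, fun l _ => ?_, (entryOp_zf hq0 hq1 hζ 1 α).trans (one_smul ℝ _)⟩
    exact Submodule.smul_mem _ _ (ih l)

theorem zf_Z_mem {ζ : ℝ} (hζ : ζ ≠ 0) (n : ℕ) : (zf hq0 hq1 n).Z ζ ∈ opClass q n 0 := by
  have h := zf_D_mul_Z_mem hq0 hq1 hζ n 0
  rwa [ZFData.D_zero, one_mul] at h

/-- The inverse of `Z_0(ζ)` is not itself in the class of charge `0`, but it is a product of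
elements of it. -/
theorem zf_Zi_word (ζ : ℝ) (n : ℕ) : ∃ ws : List (Module.End ℝ (FockIdx n →₀ ℝ)),
    (∀ w ∈ ws, w ∈ opClass q n 0) ∧ rowProd ws = (zf hq0 hq1 n).Zi ζ := by
  induction n with
  | zero => exact ⟨[(zf hq0 hq1 0).Zi ζ], fun _ _ => Submodule.mem_top, one_mul _⟩
  | succ n ih =>
    obtain ⟨ws, hws, hprod⟩ := ih
    refine ⟨linSeries q 1 ζ⁻¹ (fun k => (zf hq0 hq1 n).D (Pi.single k 1)) :: ws.map lift, ?_, ?_⟩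
    · intro w hw
      rcases List.mem_cons.mp hw with rfl | hw
      · refine ⟨fun l => mCoeff q 1 ζ⁻¹ l • (zf hq0 hq1 n).D l,
          fun l _ => Submodule.smul_mem _ _ (zf_D_mem hq0 hq1 n l), embed_ext fun s v => ?_⟩
        rw [entryOp_embed]
        refine Eq.trans ?_ (linSeries_embed hq0 hq1 (zf hq0 hq1 n).D_zero
          (zf hq0 hq1 n).D_mul _ _ s v).symm
        refine Finset.sum_congr rfl fun l _ => ?_
        rw [wt_zero, one_smul, LinearMap.smul_apply, map_smul]
        rfl
      · obtain ⟨w', hw', rfl⟩ := List.mem_map.mp hw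
        refine ⟨Pi.single 0 w', fun l _ => ?_, embed_ext fun s v => ?_⟩
        · by_cases h : l = 0
          · subst h
            rw [Pi.single_eq_same]
            exact hws w' hw'
          · rw [Pi.single_eq_of_ne h]
            exact Submodule.zero_mem _
        · rw [entryOp_embed, Finset.sum_eq_single_of_mem 0 (Finset.mem_Iic.mpr zero_le)]
          · rw [Pi.single_eq_same, tsub_zero, wt_zero, one_smul, lift_embed]
            rfl
          · intro l _ h
            rw [Pi.single_eq_of_ne h, LinearMap.zero_apply, map_zero, smul_zero]
    · have h (ws : List (Module.End ℝ (FockIdx n →₀ ℝ))) : rowProd (ws.map lift) =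
          (lift (rowProd ws) : Module.End ℝ (FockIdx n × (Fin n → ℕ) →₀ ℝ)) := by
        induction ws with
        | nil => exact lift_one.symm
        | cons w ws ih => rw [List.map_cons, rowProd_cons, rowProd_cons, ih, lift_mul]
      refine Eq.trans (Eq.trans (rowProd_cons _ _) ?_) ((zf hq0 hq1 n).next_Zi hq0 hq1 ζ).symm
      rw [← hprod, ← h]
      rfl

include hq0 hq1 in
theorem gCoeff_pos {n : ℕ} {ζ : ℝ} (h0 : 0 < ζ) (h1 : ζ < 1) (l : Fin n → ℕ) :
    0 < gCoeff q ζ l :=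
  div_pos (mul_pos (inv_pos.mpr (pow_pos h0 _)) (qPoch_pos hq0 hq1 h1 _))
    (Finset.prod_pos fun _ _ => qPoch_pos hq0 hq1 hq1 _)

/-- Products of positive multiples of the operators `D_α Z_0(ζ)` have positive trace. -/
theorem opTrace_pos (n : ℕ) (xs : List (ℝ × (Fin n → ℕ) × ℝ))
    (hxs : ∀ x ∈ xs, 0 < x.1 ∧ 0 < x.2.2 ∧ x.2.2 < 1)
    (hb : ∀ a, 1 ≤ (xs.map fun x => x.2.1).sum a) :
    0 < opTrace (rowProd (xs.map fun x =>
      x.1 • ((zf hq0 hq1 n).D x.2.1 * (zf hq0 hq1 n).Z x.2.2))) := by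
  induction n with
  | zero =>
    have h : rowProd (xs.map fun x => x.1 • ((zf hq0 hq1 0).D x.2.1 * (zf hq0 hq1 0).Z x.2.2)) =
        (xs.map Prod.fst).prod • (1 : Module.End ℝ (FockIdx 0 →₀ ℝ)) := by
      clear hxs hb
      induction xs with
      | nil => exact (one_smul ℝ _).symm
      | cons x xs ih =>
        rw [List.map_cons, rowProd_cons, ih, List.map_cons, List.prod_cons, mul_smul_comm,
          smul_mul_assoc, smul_smul]
        rfl
    rw [h]
    have h1 : 0 < (xs.map Prod.fst).prod := List.prod_pos fun c hc => by
      obtain ⟨x, hx, rfl⟩ := List.mem_map.mp hc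
      exact (hxs x hx).1
    exact h1.trans_eq (opTrace_unit _).symm
  | succ n ih =>
    set ys : List (Entry (FockIdx n) n) := xs.map fun x => (x.2.1, fun l =>
      (x.1 * gCoeff q x.2.2 l) • ((zf hq0 hq1 n).D l * (zf hq0 hq1 n).Z x.2.2)) with hys
    have h1 : (xs.map fun x =>
        x.1 • ((zf hq0 hq1 (n + 1)).D x.2.1 * (zf hq0 hq1 (n + 1)).Z x.2.2)) =
        ys.map fun y => entryOp q y.1 y.2 := by
      rw [hys, List.map_map]
      refine List.map_congr_left fun x hx => ?_
      exact (entryOp_zf hq0 hq1 (hxs x hx).2.1.ne' x.1 x.2.1).symm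
    have h2 : ys.map Prod.fst = xs.map fun x => x.2.1 := by
      rw [hys, List.map_map]; rfl
    have hb' : ∀ a, 1 ≤ (ys.map Prod.fst).sum a := by rwa [h2]
    have hmem : ∀ y ∈ ys, ∀ l, y.2 l ∈ opClass q n l := by
      intro y hy l
      obtain ⟨x, hx, rfl⟩ := List.mem_map.mp hy
      exact Submodule.smul_mem _ _ (zf_D_mul_Z_mem hq0 hq1 (hxs x hx).2.1.ne' n l)
    have h3 := (hasSum_trace (isTraceClass_opClass hq0 hq1 n) hq0 hq1 hmem hb').tsum_eq
    have hterm (ls : List (Fin n → ℕ)) (hls : ls.length = ys.length) (hsum : ls.sum = charge ys) :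
        0 < opTrace (rowProd (pathOps ys ls)) * ∏ i, ∑' s, bosonWt q (pathWord i ys ls) s := by
      refine mul_pos ?_ (Finset.prod_pos fun i _ =>
        bosonWt_tsum_pos hq0 hq1 _ (pathWord_basic hb' hls i))
      have h4 : pathOps ys ls = (List.zipWith (fun x l => (x.1 * gCoeff q x.2.2 l, l, x.2.2))
          xs ls).map fun x => x.1 • ((zf hq0 hq1 n).D x.2.1 * (zf hq0 hq1 n).Z x.2.2) := by
        rw [pathOps, hys, List.zipWith_map_left, List.map_zipWith]
      have h5 : ((List.zipWith (fun x l => (x.1 * gCoeff q x.2.2 l, l, x.2.2)) xs ls).map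
          fun x => x.2.1) = ls := by
        rw [List.map_zipWith]
        refine List.ext_getElem ?_ fun i _ _ => by simp
        rw [List.length_zipWith, hls, hys, List.length_map, min_self]
      rw [h4]
      refine ih _ ?_ ?_
      · intro y hy
        obtain ⟨i, hi, rfl⟩ := List.mem_iff_getElem.mp hy
        rw [List.length_zipWith] at hi
        have hx := hxs _ (List.getElem_mem (l := xs) (n := i) (by omega))
        rw [List.getElem_zipWith]
        exact ⟨mul_pos hx.1 (gCoeff_pos hq0 hq1 hx.2.1 hx.2.2 _), hx.2⟩
      · intro a
        rw [h5, hsum, charge_apply]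
        exact hb' _
    rw [h1]
    refine lt_of_lt_of_eq ?_ h3.symm
    refine listSum_pos (fun ls hls => ?_)
      ⟨ys.map fun y => y.1 ∘ Fin.castSucc, List.length_map _, fun l hl => ?_, ?_⟩
    · split_ifs with h
      · exact (hterm ls hls h).le
      · exact le_rfl
    · exact Finset.mem_Iic.mpr (List.le_sum_of_mem hl)
    · exact lt_of_lt_of_eq (hterm _ (List.length_map _) rfl) (if_pos rfl).symm

end Class

/-! ### The operators `X_α(ζ)` as operators on row vectors -/

/-- The matrix of an operator on row vectors. -/
def opMat {I : Type} (T : Module.End ℝ (I →₀ ℝ)) (p r : I) : ℝ := T (Finsupp.single p 1) r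

theorem matMul_opMat {I : Type} (S T : Module.End ℝ (I →₀ ℝ)) :
    matMul (opMat T) (opMat S) = opMat (S * T) := by
  funext p r
  rw [matMul, opMat, Module.End.mul_apply]
  rw [finsum_eq_sum_of_support_subset (s := (T (Finsupp.single p 1)).support)]
  · conv_rhs => rw [← Finsupp.sum_single (T (Finsupp.single p 1)), Finsupp.sum, map_sum,
      Finset.sum_apply']
    refine Finset.sum_congr rfl fun s _ => ?_
    have h : Finsupp.single s (T (Finsupp.single p 1) s) =
        T (Finsupp.single p 1) s • Finsupp.single s (1 : ℝ) := by simp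
    rw [h, map_smul]
    rfl
  · intro s hs
    rw [Finset.mem_coe, Finsupp.mem_support_iff]
    exact left_ne_zero_of_mul hs

/-- The matrix of a product of operators on row vectors is the product of the matrices in the order
of the list. -/
theorem foldr_matMul_opMat {I : Type} (xs : List (Module.End ℝ (I →₀ ℝ))) :
    (xs.map opMat).foldr matMul matOne = opMat (rowProd xs) := by
  induction xs with
  | nil =>
    classical
    funext p r
    rw [rowProd_nil, opMat, Module.End.one_apply, List.map_nil, List.foldr_nil, matOne,
      Finsupp.single_apply]
  | cons x xs ih => rw [List.map_cons, List.foldr_cons, ih, rowProd_cons, matMul_opMat]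

section XOp

variable {q : ℝ} (hq0 : 0 < q) (hq1 : q < 1)

/-- The operators `D_α Z_0(ζ)` are the operators `Z_α(ζ)`. -/
theorem opMat_zf {ζ : ℝ} (hζ : ζ ≠ 0) (n : ℕ) (α : Fin n → ℕ) :
    opMat ((zf hq0 hq1 n).D α * (zf hq0 hq1 n).Z ζ) = zMat q ζ n α := by
  induction n with
  | zero =>
    funext p r
    exact Finsupp.single_eq_same
  | succ n ih =>
    funext ⟨p, s⟩ ⟨p', s'⟩
    have h := next_D_mul_Z_embed hq0 hq1 (zf hq0 hq1 n) hζ α s (Finsupp.single p 1)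
    rw [embed_single] at h
    refine (DFunLike.congr_fun h (p', s')).trans ?_
    rw [zMat, finsum_eq_sum_of_support_subset (s := Finset.Iic s), Finset.sum_apply']
    · refine Finset.sum_congr rfl fun l hl => ?_
      have hl' : l ≤ s := Finset.mem_Iic.mp hl
      have h2 : ((zf hq0 hq1 n).D l * (zf hq0 hq1 n).Z ζ) (Finsupp.single p 1) p' =
          zMat q ζ n l p p' := congrFun₂ (ih l) p p'
      rw [Finsupp.smul_apply, smul_eq_mul]
      by_cases hs : s' = s - l + α ∘ Fin.castSucc
      · rw [hs, embed_apply_same, LinearMap.smul_apply, Finsupp.smul_apply, smul_eq_mul, h2,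
          mul_comm]
        congr 1
        refine Finset.prod_congr rfl fun i _ => ?_
        have h3 : l i ≤ s i := hl' i
        rw [wordCoeff_eq, if_pos]
        · rfl
        · refine ⟨h3, ?_⟩
          simp only [Pi.add_apply, Pi.sub_apply, Function.comp_apply]
          omega
      · rw [embed_apply_ne hs, mul_zero]
        symm
        by_contra hc
        refine hs (funext fun i => ?_)
        have h3 := zMat_term_ne_zero hc i
        simp only [Pi.add_apply, Pi.sub_apply, Function.comp_apply]
        omega
    · intro l hl
      exact Finset.mem_coe.mpr (Finset.mem_Iic.mpr fun i => (zMat_term_ne_zero hl i).1)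

/-- The operator `X_α(ζ)` on row vectors. -/
def xOp (n : ℕ) (ζ : ℝ) (α : Fin n → ℕ) : Module.End ℝ (FockIdx n →₀ ℝ) :=
  gCoeff q ζ α • ((zf hq0 hq1 n).D α * (zf hq0 hq1 n).Z ζ)

theorem xOp_mem (n : ℕ) {ζ : ℝ} (hζ : ζ ≠ 0) (α : Fin n → ℕ) :
    xOp hq0 hq1 n ζ α ∈ opClass q n α :=
  Submodule.smul_mem _ _ (zf_D_mul_Z_mem hq0 hq1 hζ n α)

theorem opMat_xOp {n : ℕ} {ζ : ℝ} (hζ : ζ ≠ 0) (α : Fin n → ℕ) :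
    opMat (xOp hq0 hq1 n ζ α) = xMat q ζ n α := by
  funext p r
  rw [xMat, ← opMat_zf hq0 hq1 hζ]
  rfl

theorem xProd_eq {n L : ℕ} {mu : Fin L → ℝ} (hmu : ∀ i, mu i ≠ 0) (σ : State n L) :
    xProd q mu σ = opMat (rowProd (List.ofFn fun i => xOp hq0 hq1 n (mu i) (σ i))) := by
  rw [xProd, ← foldr_matMul_opMat, List.map_ofFn]
  congr 2
  funext i
  exact (opMat_xOp hq0 hq1 (hmu i) (σ i)).symm

theorem xTrace_eq {n L : ℕ} {mu : Fin L → ℝ} (hmu : ∀ i, mu i ≠ 0) (σ : State n L) :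
    xTrace q mu σ = opTrace (rowProd (List.ofFn fun i => xOp hq0 hq1 n (mu i) (σ i))) := by
  rw [xTrace, xProd_eq hq0 hq1 hmu]
  rfl

theorem basic_of_sector {n L : ℕ} {m : Fin n → ℕ} (hm : ∀ a, 1 ≤ m a) {σ : State n L}
    (hσ : σ ∈ sector L m) (a : Fin n) : 1 ≤ (List.ofFn σ).sum a := by
  have h : ∑ i, σ i = m := hσ
  rw [List.sum_ofFn, h]
  exact hm a

include hq0 hq1 in
theorem xProd_summable {n L : ℕ} {mu : Fin L → ℝ} (hmu : ∀ i, mu i ≠ 0) {m : Fin n → ℕ}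
    (hm : ∀ a, 1 ≤ m a) {σ : State n L} (hσ : σ ∈ sector L m) :
    Summable fun p => xProd q mu σ p p := by
  have h := (isTraceClass_opClass hq0 hq1 n).summable
    (List.ofFn fun i => (σ i, xOp hq0 hq1 n (mu i) (σ i))) (fun x hx => ?_) (fun a => ?_)
  · rw [List.map_ofFn] at h
    rw [xProd_eq hq0 hq1 hmu]
    exact h
  · obtain ⟨i, rfl⟩ := (List.mem_ofFn' _ _).mp hx
    exact xOp_mem hq0 hq1 n (hmu i) (σ i)
  · rw [List.map_ofFn]
    exact basic_of_sector hm hσ a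

include hq0 hq1 in
theorem xTrace_pos {n L : ℕ} {mu : Fin L → ℝ} (hmu0 : ∀ i, 0 < mu i) (hmu1 : ∀ i, mu i < 1)
    {m : Fin n → ℕ} (hm : ∀ a, 1 ≤ m a) {σ : State n L} (hσ : σ ∈ sector L m) :
    0 < xTrace q mu σ := by
  have h := opTrace_pos hq0 hq1 n
    (List.ofFn fun i => (gCoeff q (mu i) (σ i), σ i, mu i)) (fun x hx => ?_) (fun a => ?_)
  · rw [List.map_ofFn] at h
    rw [xTrace_eq hq0 hq1 fun i => (hmu0 i).ne']
    exact h
  · obtain ⟨i, rfl⟩ := (List.mem_ofFn' _ _).mp hx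
    exact ⟨gCoeff_pos hq0 hq1 (hmu0 i) (hmu1 i) _, hmu0 i, hmu1 i⟩
  · rw [List.map_ofFn]
    exact basic_of_sector hm hσ a

end XOp

/-! ### Lists of operators -/

theorem rowProd_eq_unop {R : Type*} [Monoid R] (xs : List R) :
    rowProd xs = (xs.map MulOpposite.op).prod.unop := by
  induction xs with
  | nil => rfl
  | cons x xs ih => rw [rowProd_cons, ih, List.map_cons, List.prod_cons]; rfl

/-- Distributivity: a product of sums is the sum of the products. -/
theorem rowProd_sum {R X : Type*} [Ring R] {L : ℕ} (B : Fin L → Finset X) (f : Fin L → X → R) :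
    rowProd (List.ofFn fun i => ∑ l ∈ B i, f i l) =
      ∑ γ ∈ Fintype.piFinset B, rowProd (List.ofFn fun i => f i (γ i)) := by
  have h := (MultilinearMap.mkPiAlgebraFin ℤ L Rᵐᵒᵖ).map_sum_finset
    (fun i l => MulOpposite.op (f i l)) B
  simp only [MultilinearMap.mkPiAlgebraFin_apply] at h
  rw [rowProd_eq_unop, List.map_ofFn]
  have h1 : (MulOpposite.op ∘ fun i => ∑ l ∈ B i, f i l) =
      fun i => ∑ l ∈ B i, MulOpposite.op (f i l) := by
    funext i
    simp
  rw [h1, h, Finset.unop_sum]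
  refine Finset.sum_congr rfl fun γ _ => ?_
  rw [rowProd_eq_unop, List.map_ofFn]
  rfl

theorem rowProd_smul {R : Type*} [Ring R] [Algebra ℝ R] {L : ℕ} (c : Fin L → ℝ) (f : Fin L → R) :
    rowProd (List.ofFn fun i => c i • f i) = (∏ i, c i) • rowProd (List.ofFn f) := by
  induction L with
  | zero => simp [rowProd_nil]
  | succ L ih =>
    rw [List.ofFn_succ, rowProd_cons, ih (fun i => c i.succ) fun i => f i.succ, List.ofFn_succ,
      rowProd_cons, Fin.prod_univ_succ, smul_mul_smul_comm, mul_comm (c 0)]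

theorem rowProd_conj {R : Type*} [Monoid R] {z zi : R} (h : zi * z = 1) (h' : z * zi = 1)
    (xs : List R) : rowProd (xs.map fun x => z * x * zi) = z * rowProd xs * zi := by
  induction xs with
  | nil => rw [List.map_nil, rowProd_nil, mul_one, h']
  | cons x xs ih =>
    rw [List.map_cons, rowProd_cons, rowProd_cons, ih]
    calc z * rowProd xs * zi * (z * x * zi) = z * rowProd xs * (zi * z) * x * zi := by
          simp only [mul_assoc]
      _ = _ := by rw [h, mul_one, mul_assoc z]

theorem rowProd_flatten_pair {R : Type*} [Monoid R] {L : ℕ} (x y : Fin L → R) :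
    rowProd (List.ofFn fun i => [x i, y i]).flatten = rowProd (List.ofFn fun i => y i * x i) := by
  induction L with
  | zero => simp
  | succ L ih =>
    rw [List.ofFn_succ, List.flatten_cons, rowProd_append, ih, List.ofFn_succ, rowProd_cons]
    simp [rowProd_cons, rowProd_nil]

theorem flatten_ofFn_shift {X : Type*} {N : ℕ} (x y : Fin (N + 1) → X) :
    (List.ofFn fun i => [y i, x i]).flatten =
      y 0 :: (List.ofFn fun j : Fin N => [x j.castSucc, y j.succ]).flatten ++ [x (Fin.last N)] := by
  induction N with
  | zero => simp
  | succ N ih =>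
    rw [List.ofFn_succ, List.flatten_cons, ih (fun i => x i.succ) fun i => y i.succ,
      List.ofFn_succ (n := N)]
    simp

/-- Rotating a product of pairs by half a pair. -/
theorem flatten_ofFn_rotate {X : Type*} {L : ℕ} (hL : 1 ≤ L) (x y : Fin L → X) :
    ∃ (u : X) (us : List X), (List.ofFn fun i => [y i, x i]).flatten = us ++ [u] ∧
      (List.ofFn fun i => [x ((finRotate L).symm i), y i]).flatten = [u] ++ us := by
  obtain ⟨N, rfl⟩ := Nat.exists_eq_add_of_le' hL
  refine ⟨_, _, flatten_ofFn_shift x y, ?_⟩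
  have h0 : (finRotate (N + 1)).symm 0 = Fin.last N := by
    rw [Equiv.symm_apply_eq, finRotate_last]
  have h1 (j : Fin N) : (finRotate (N + 1)).symm j.succ = j.castSucc := by
    rw [Equiv.symm_apply_eq]
    ext
    rw [coe_finRotate_of_ne_last (Fin.castSucc_lt_last j).ne]
    simp
  rw [List.ofFn_succ]
  simp only [h0, h1]
  simp

/-! ### Stationarity -/

theorem opTrace_smul {I : Type} (c : ℝ) (T : Module.End ℝ (I →₀ ℝ)) :
    opTrace (c • T) = c * opTrace T := by
  rw [opTrace, opTrace, ← tsum_mul_left]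
  rfl

theorem opTrace_sum {I X : Type} (B : Finset X) (T : X → Module.End ℝ (I →₀ ℝ))
    (h : ∀ x ∈ B, Summable fun p => T x (Finsupp.single p 1) p) :
    opTrace (∑ x ∈ B, T x) = ∑ x ∈ B, opTrace (T x) := by
  unfold opTrace
  rw [← Summable.tsum_finsetSum h]
  congr 1
  funext p
  rw [LinearMap.sum_apply, Finset.sum_apply']

theorem mCoeff_inv_inv {n : ℕ} {q lam mu : ℝ} (hmu : mu ≠ 0) (ε : Fin n → ℕ) :
    mCoeff q mu⁻¹ lam⁻¹ ε =
      (mu ^ size ε)⁻¹ * qPoch q (mu / lam) (size ε) / ∏ i, qPoch q q (ε i) := by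
  rw [mCoeff]
  congr 1
  rw [← inv_pow, qPoch]
  conv_rhs => rw [← Finset.card_range (size ε), ← Finset.prod_const, Finset.card_range]
  rw [← Finset.prod_mul_distrib]
  refine Finset.prod_congr rfl fun j _ => ?_
  field_simp

section

variable {q : ℝ} (hq0 : 0 < q) (hq1 : q < 1)

include hq0 hq1 in
/-- The weight `Φ` turns the normalization of `X_β(μ)` into that of `D_γ` and `D_{β - γ}`. -/
theorem Phi_mul_gCoeff {n : ℕ} {lam mu : ℝ} (hlam : lam ≠ 0) (hmu0 : 0 < mu) (hmu1 : mu < 1)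
    (γ ε : Fin n → ℕ) : Phi q lam mu γ (γ + ε) * gCoeff q mu (γ + ε) =
      mCoeff q lam⁻¹ 1 γ * (mCoeff q mu⁻¹ lam⁻¹ ε * q ^ phiForm ε γ) := by
  have h1 : (∏ i, qBinom q ((γ + ε) i) (γ i)) = (∏ i, qPoch q q ((γ + ε) i)) /
      ((∏ i, qPoch q q (γ i)) * ∏ i, qPoch q q (ε i)) := by
    rw [← Finset.prod_mul_distrib, ← Finset.prod_div_distrib]
    refine Finset.prod_congr rfl fun i _ => ?_
    rw [qBinom, Pi.add_apply, if_pos (Nat.le_add_right _ _), Nat.add_sub_cancel_left]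
  have h2 (β : Fin n → ℕ) : (∏ i, qPoch q q (β i)) ≠ 0 :=
    Finset.prod_ne_zero_iff.mpr fun i _ => qPoch_self_ne hq0 hq1 _
  have h3 := (qPoch_pos hq0 hq1 hmu1 (size (γ + ε))).ne'
  rw [Phi, h1, mCoeff_inv hlam, mCoeff_inv_inv hmu0.ne', gCoeff, gCoeff, add_tsub_cancel_left,
    size_add, Nat.add_sub_cancel_left, div_pow, pow_add]
  rw [size_add] at h3
  have h4 := h2 γ
  have h5 := h2 ε
  have h6 := h2 (γ + ε)
  have h7 := hmu0.ne'
  field_simp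

/-- The part of a summand of the transfer matrix that carries the edge variable `γ`. -/
def edgeOp (n : ℕ) (lam : ℝ) (γ : Fin n → ℕ) : Module.End ℝ (FockIdx n →₀ ℝ) :=
  mCoeff q lam⁻¹ 1 γ • (zf hq0 hq1 n).D γ

/-- The part of a summand of the transfer matrix that carries the particles `ε` that stay. -/
def stayOp (n : ℕ) (lam mu : ℝ) (ε : Fin n → ℕ) : Module.End ℝ (FockIdx n →₀ ℝ) :=
  mCoeff q mu⁻¹ lam⁻¹ ε • ((zf hq0 hq1 n).D ε * (zf hq0 hq1 n).Z mu)

theorem Phi_smul_xOp {n : ℕ} {lam mu : ℝ} (hlam : lam ≠ 0) (hmu0 : 0 < mu) (hmu1 : mu < 1)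
    (γ ε : Fin n → ℕ) : Phi q lam mu γ (γ + ε) • xOp hq0 hq1 n mu (γ + ε) =
      edgeOp hq0 hq1 n lam γ * stayOp hq0 hq1 n lam mu ε := by
  rw [xOp, smul_smul, Phi_mul_gCoeff hq0 hq1 hlam hmu0 hmu1, edgeOp, stayOp, smul_mul_smul_comm,
    ← mul_assoc, ← mul_assoc ((zf hq0 hq1 n).D γ), ZFData.D_mul, smul_mul_assoc, smul_smul,
    add_comm ε]

/-- The sum over the ways in which `α` particles at a site consist of `l` arrived and `α - l` stayed
ones, by the Zamolodchikov-Faddeev relation. -/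
theorem sum_stayOp_mul_edgeOp {n : ℕ} {lam mu : ℝ} (hmu : mu ≠ 0) (α : Fin n → ℕ) :
    ∑ l ∈ Finset.Iic α, stayOp hq0 hq1 n lam mu (α - l) * edgeOp hq0 hq1 n lam l =
      (zf hq0 hq1 n).Z lam * xOp hq0 hq1 n mu α * (zf hq0 hq1 n).Zi lam := by
  have h := (zf hq0 hq1 n).zf_relation hq0 hq1 lam mu α
  rw [mCoeff_inv hmu] at h
  rw [xOp, h, mul_assoc, ZFData.Z_mul_Zi, mul_one]
  exact Finset.sum_congr rfl fun l _ => smul_mul_smul_comm _ _ _ _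

theorem edgeOp_mem (n : ℕ) (lam : ℝ) (γ : Fin n → ℕ) :
    edgeOp hq0 hq1 n lam γ ∈ opClass q n γ :=
  Submodule.smul_mem _ _ (zf_D_mem hq0 hq1 n γ)

theorem stayOp_mem (n : ℕ) (lam : ℝ) {mu : ℝ} (hmu : mu ≠ 0) (ε : Fin n → ℕ) :
    stayOp hq0 hq1 n lam mu ε ∈ opClass q n ε :=
  Submodule.smul_mem _ _ (zf_D_mul_Z_mem hq0 hq1 hmu n ε)

/-- Conjugation by the invertible operator `Z_0(lam)` does not change the trace. -/
theorem opTrace_conj_Z {n L : ℕ} {lam : ℝ} {mu : Fin L → ℝ} (hlam : lam ≠ 0)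
    (hmu : ∀ i, mu i ≠ 0) {m : Fin n → ℕ} (hm : ∀ a, 1 ≤ m a) {σ : State n L}
    (hσ : σ ∈ sector L m) :
    opTrace (rowProd (List.ofFn fun i =>
      (zf hq0 hq1 n).Z lam * xOp hq0 hq1 n (mu i) (σ i) * (zf hq0 hq1 n).Zi lam)) =
      xTrace q mu σ := by
  obtain ⟨ws, hws, hprod⟩ := zf_Zi_word hq0 hq1 lam n
  set z := zf hq0 hq1 n
  set us : List ((Fin n → ℕ) × Module.End ℝ (FockIdx n →₀ ℝ)) :=
    ws.map fun w => ((0 : Fin n → ℕ), w) with hus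
  set vs : List ((Fin n → ℕ) × Module.End ℝ (FockIdx n →₀ ℝ)) :=
    (List.ofFn fun i => (σ i, xOp hq0 hq1 n (mu i) (σ i))) ++ [(0, z.Z lam)] with hvs
  have hu2 : us.map Prod.snd = ws := by
    rw [hus, List.map_map]
    exact List.map_id' ws
  have hu1 : (us.map Prod.fst).sum = 0 := by
    rw [hus, List.map_map]
    refine List.sum_eq_zero fun x hx => ?_
    obtain ⟨w, -, rfl⟩ := List.mem_map.mp hx
    rfl
  have hv2 : vs.map Prod.snd = (List.ofFn fun i => xOp hq0 hq1 n (mu i) (σ i)) ++ [z.Z lam] := by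
    rw [hvs, List.map_append, List.map_ofFn]
    rfl
  have hv1 : (vs.map Prod.fst).sum = (List.ofFn σ).sum := by
    rw [hvs, List.map_append, List.map_ofFn, List.sum_append, List.map_singleton,
      List.sum_singleton, add_zero]
    rfl
  have h := (isTraceClass_opClass hq0 hq1 n).rotate_append us vs (fun x hx => ?_) (fun a => ?_)
  · rw [List.map_append, hu2, hv2, List.map_append, hu2, hv2, rowProd_append, rowProd_append,
      rowProd_append, hprod, rowProd_cons, rowProd_nil, one_mul] at h
    have h1 := rowProd_conj (z.Zi_mul_Z lam) (z.Z_mul_Zi lam)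
      (List.ofFn fun i => xOp hq0 hq1 n (mu i) (σ i))
    rw [List.map_ofFn] at h1
    rw [xTrace_eq hq0 hq1 hmu]
    refine (congrArg opTrace h1).trans (h.trans ?_)
    rw [rowProd_append, rowProd_cons, rowProd_nil, one_mul, ← mul_assoc, z.Zi_mul_Z, one_mul]
  · rcases List.mem_append.mp hx with hx | hx
    · obtain ⟨w, hw, rfl⟩ := List.mem_map.mp hx
      exact hws w hw
    · rcases List.mem_append.mp hx with hx | hx
      · obtain ⟨i, rfl⟩ := (List.mem_ofFn' _ _).mp hx
        exact xOp_mem hq0 hq1 n (hmu i) (σ i)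
      · rw [List.mem_singleton.mp hx]
        exact zf_Z_mem hq0 hq1 hlam n
  · rw [List.map_append, List.sum_append, hu1, hv1, zero_add]
    exact basic_of_sector hm hσ a

/-- The summand of the transfer matrix with edge variables `γ`. The trace is rotated by one edge
operator, so that each edge operator moves to the next site. -/
theorem opTrace_edge {n L : ℕ} (hL : 1 ≤ L) {lam : ℝ} {mu : Fin L → ℝ} (hlam : lam ≠ 0)
    (hmu0 : ∀ i, 0 < mu i) (hmu1 : ∀ i, mu i < 1) {m : Fin n → ℕ} (hm : ∀ a, 1 ≤ m a)
    {γ ε : State n L} (hγ : γ + ε ∈ sector L m) :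
    (Summable fun p => rowProd (List.ofFn fun i => stayOp hq0 hq1 n lam (mu i) (ε i) *
      edgeOp hq0 hq1 n lam (γ ((finRotate L).symm i))) (Finsupp.single p 1) p) ∧
    opTrace (rowProd (List.ofFn fun i => stayOp hq0 hq1 n lam (mu i) (ε i) *
      edgeOp hq0 hq1 n lam (γ ((finRotate L).symm i)))) =
    xTrace q mu (γ + ε) * ∏ i, Phi q lam (mu i) (γ i) (γ i + ε i) := by
  set x : Fin L → (Fin n → ℕ) × Module.End ℝ (FockIdx n →₀ ℝ) := fun i =>
    (γ i, edgeOp hq0 hq1 n lam (γ i)) with hx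
  set y : Fin L → (Fin n → ℕ) × Module.End ℝ (FockIdx n →₀ ℝ) := fun i =>
    (ε i, stayOp hq0 hq1 n lam (mu i) (ε i)) with hy
  obtain ⟨u, us, h1, h2⟩ := flatten_ofFn_rotate hL x y
  have hsnd (x y : Fin L → (Fin n → ℕ) × Module.End ℝ (FockIdx n →₀ ℝ)) :
      rowProd ((List.ofFn fun i => [x i, y i]).flatten.map Prod.snd) =
        rowProd (List.ofFn fun i => (y i).2 * (x i).2) := by
    rw [← rowProd_flatten_pair, List.map_flatten, List.map_ofFn]
    rfl
  have hmem : ∀ w ∈ us ++ [u], w.2 ∈ opClass q n w.1 := by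
    intro w hw
    rw [← h1] at hw
    obtain ⟨l, hl, hw⟩ := List.mem_flatten.mp hw
    obtain ⟨i, rfl⟩ := (List.mem_ofFn' _ _).mp hl
    simp only [List.mem_cons, List.not_mem_nil, or_false] at hw
    rcases hw with rfl | rfl
    · exact stayOp_mem hq0 hq1 n lam (hmu0 i).ne' (ε i)
    · exact edgeOp_mem hq0 hq1 n lam (γ i)
  have hsum : ((us ++ [u]).map Prod.fst).sum = (List.ofFn (γ + ε)).sum := by
    rw [← h1, List.map_flatten, List.map_ofFn, List.sum_flatten, List.map_ofFn, List.sum_ofFn,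
      List.sum_ofFn]
    refine Finset.sum_congr rfl fun i _ => ?_
    simp [hx, hy, add_comm]
  have hb : ∀ a, 1 ≤ ((us ++ [u]).map Prod.fst).sum a := fun a => by
    rw [hsum]
    exact basic_of_sector hm hγ a
  have hrot : rowProd (([u] ++ us).map Prod.snd) = rowProd (List.ofFn fun i =>
      stayOp hq0 hq1 n lam (mu i) (ε i) * edgeOp hq0 hq1 n lam (γ ((finRotate L).symm i))) := by
    rw [← h2]
    exact hsnd (fun i => x ((finRotate L).symm i)) y
  constructor
  · rw [← hrot]
    refine (isTraceClass_opClass hq0 hq1 n).summable _ (fun w hw => hmem w ?_) fun a => ?_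
    · rw [List.mem_append] at hw ⊢
      exact hw.symm
    · rw [List.map_append, List.sum_append, add_comm, ← List.sum_append, ← List.map_append]
      exact hb a
  · rw [← hrot, ← (isTraceClass_opClass hq0 hq1 n).rotate_append us [u] hmem hb, ← h1, hsnd y x,
      xTrace_eq hq0 hq1 fun i => (hmu0 i).ne', mul_comm, ← opTrace_smul]
    refine congrArg opTrace (Eq.trans ?_ (rowProd_smul
      (R := Module.End ℝ (FockIdx n →₀ ℝ)) (fun i => Phi q lam (mu i) (γ i) (γ i + ε i))
      fun i => xOp hq0 hq1 n (mu i) ((γ + ε) i)))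
    congr 2
    funext i
    exact (Phi_smul_xOp hq0 hq1 hlam (hmu0 i) (hmu1 i) (γ i) (ε i)).symm

/-! ### The transfer matrix as a finite sum -/

theorem Phi_ne_zero_le {n : ℕ} {lam mu : ℝ} {γ β : Fin n → ℕ} (h : Phi q lam mu γ β ≠ 0) :
    γ ≤ β := fun a => by
  have h2 := Finset.prod_ne_zero_iff.mp (right_ne_zero_of_mul h) a (Finset.mem_univ a)
  exact of_not_not fun hc => h2 (if_neg hc)

theorem prod_stochR_ne_zero {n L : ℕ} {lam : ℝ} {mu : Fin L → ℝ} {α β γ : State n L}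
    (h : ∏ i, stochR q lam (mu i) (γ ((finRotate L).symm i)) (β i) (γ i) (α i) ≠ 0) (i : Fin L) :
    γ ((finRotate L).symm i) + β i = γ i + α i ∧ γ i ≤ β i := by
  have h1 := Finset.prod_ne_zero_iff.mp h i (Finset.mem_univ i)
  rw [stochR] at h1
  have h2 : γ ((finRotate L).symm i) + β i = γ i + α i := of_not_not fun hc => h1 (if_neg hc)
  rw [if_pos h2] at h1
  exact ⟨h2, Phi_ne_zero_le h1⟩

theorem prod_stochR_ne_zero_le {n L : ℕ} {lam : ℝ} {mu : Fin L → ℝ} {α β γ : State n L}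
    (h : ∏ i, stochR q lam (mu i) (γ ((finRotate L).symm i)) (β i) (γ i) (α i) ≠ 0) :
    (fun i => γ ((finRotate L).symm i)) ≤ α ∧
      β = γ + fun i => α i - γ ((finRotate L).symm i) := by
  have h1 (i : Fin L) (a : Fin n) := congrFun (prod_stochR_ne_zero h i).1 a
  have h2 (i : Fin L) (a : Fin n) : γ i a ≤ β i a := (prod_stochR_ne_zero h i).2 a
  simp only [Pi.add_apply] at h1
  constructor
  · intro i a
    have := h1 i a
    have := h2 i a
    change γ ((finRotate L).symm i) a ≤ α i a
    omega
  · funext i a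
    have := h1 i a
    have := h2 i a
    simp only [Pi.add_apply, Pi.sub_apply]
    omega

/-- The transfer matrix in terms of the edge variables attached to the next site. -/
theorem transfer_eq_sum {n L : ℕ} (lam : ℝ) (mu : Fin L → ℝ) (β α : State n L) :
    transfer q lam mu β α = ∑ γ ∈ Fintype.piFinset fun i => Finset.Iic (α i),
      ∏ i, stochR q lam (mu i) (γ i) (β i) (γ (finRotate L i)) (α i) := by
  have key (γ : State n L) (i : Fin L) :
      ((finRotate L).arrowCongr (Equiv.refl (Fin n → ℕ))).symm γ i = γ (finRotate L i) := rfl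
  rw [transfer, ← finsum_comp_equiv ((finRotate L).arrowCongr (Equiv.refl (Fin n → ℕ))).symm]
  rw [finsum_eq_sum_of_support_subset (s := Fintype.piFinset fun i => Finset.Iic (α i))]
  · refine Finset.sum_congr rfl fun γ _ => Finset.prod_congr rfl fun i _ => ?_
    simp only [key, Equiv.apply_symm_apply]
  · intro γ hγ
    have h1 := (prod_stochR_ne_zero_le hγ).1
    rw [Finset.mem_coe, Fintype.mem_piFinset]
    intro i
    rw [Finset.mem_Iic]
    have h2 := h1 i
    simp only [key, Equiv.apply_symm_apply] at h2
    exact h2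

theorem sum_finRotate {n L : ℕ} (γ : State n L) :
    ∑ i, γ ((finRotate L).symm i) = ∑ i, γ i :=
  Equiv.sum_comp (finRotate L).symm γ

theorem transfer_conserves {n L : ℕ} {lam : ℝ} {mu : Fin L → ℝ} {α β : State n L}
    (h : transfer q lam mu β α ≠ 0) : ∑ i, β i = ∑ i, α i := by
  obtain ⟨γ, hγ⟩ := exists_ne_zero_of_finsum_ne h
  have h1 := Finset.sum_congr rfl fun i (_ : i ∈ Finset.univ) => (prod_stochR_ne_zero hγ i).1
  rw [Finset.sum_add_distrib, Finset.sum_add_distrib, sum_finRotate] at h1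
  exact add_left_cancel h1

theorem sector_finite {n : ℕ} (L : ℕ) (m : Fin n → ℕ) : (sector L m).Finite := by
  refine (Set.finite_Iic fun _ : Fin L => m).subset fun σ hσ i => ?_
  have h : ∑ i, σ i = m := hσ
  rw [← h]
  exact Finset.single_le_sum (f := σ) (fun _ _ => zero_le) (Finset.mem_univ i)

include hq0 hq1 in
/-- The traces form a stationary vector. -/
theorem sum_xTrace_mul_transfer {n L : ℕ} (hL : 1 ≤ L) {lam : ℝ} {mu : Fin L → ℝ}
    (hlam : lam ≠ 0) (hmu0 : ∀ i, 0 < mu i) (hmu1 : ∀ i, mu i < 1) {m : Fin n → ℕ}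
    (hm : ∀ a, 1 ≤ m a) {α : State n L} (hα : α ∈ sector L m) :
    ∑ β ∈ (sector_finite L m).toFinset, xTrace q mu β * transfer q lam mu β α =
      xTrace q mu α := by
  have h1 (γ : State n L) (hγ : γ ∈ Fintype.piFinset fun i => Finset.Iic (α i)) :
      γ ∘ finRotate L + (fun i => α i - γ i) ∈ sector L m := by
    have h2 : ∀ i, γ i ≤ α i := fun i => Finset.mem_Iic.mp (Fintype.mem_piFinset.mp hγ i)
    have hα' : ∑ i, α i = m := hα
    change ∑ i, (γ (finRotate L i) + (α i - γ i)) = m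
    rw [Finset.sum_add_distrib, Equiv.sum_comp (finRotate L) γ, ← Finset.sum_add_distrib, ← hα']
    exact Finset.sum_congr rfl fun i _ => add_tsub_cancel_of_le (h2 i)
  have h3 (γ : State n L) (hγ : γ ∈ Fintype.piFinset fun i => Finset.Iic (α i)) :=
    opTrace_edge hq0 hq1 hL hlam hmu0 hmu1 hm (h1 γ hγ)
  rw [← opTrace_conj_Z hq0 hq1 hlam (fun i => (hmu0 i).ne') hm hα]
  simp only [← sum_stayOp_mul_edgeOp hq0 hq1 (hmu0 _).ne']
  rw [rowProd_sum (fun i => Finset.Iic (α i)) fun i l =>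
    stayOp hq0 hq1 n lam (mu i) (α i - l) * edgeOp hq0 hq1 n lam l, opTrace_sum]
  · simp only [transfer_eq_sum, Finset.mul_sum]
    rw [Finset.sum_comm]
    refine Finset.sum_congr rfl fun γ hγ => ?_
    have h4 := (h3 γ hγ).2
    simp only [Function.comp_apply, Equiv.apply_symm_apply] at h4
    rw [h4, Finset.sum_eq_single (γ ∘ finRotate L + fun i => α i - γ i)]
    · congr 1
      refine Finset.prod_congr rfl fun i _ => ?_
      rw [stochR, if_pos]
      · rfl
      · have h2 : γ i ≤ α i := Finset.mem_Iic.mp (Fintype.mem_piFinset.mp hγ i)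
        change γ i + (γ (finRotate L i) + (α i - γ i)) = _
        rw [add_left_comm, add_tsub_cancel_of_le h2]
    · intro β _ hβ
      by_contra hc
      refine hβ ?_
      have h5 := right_ne_zero_of_mul hc
      have h6 := prod_stochR_ne_zero_le (q := q) (lam := lam) (mu := mu) (α := α) (β := β)
        (γ := γ ∘ finRotate L) (by simpa only [Function.comp_apply, Equiv.apply_symm_apply] using h5)
      simpa only [Function.comp_apply, Equiv.apply_symm_apply] using h6.2
    · intro h
      exact absurd ((sector_finite L m).mem_toFinset.mpr (h1 γ hγ)) h
  · intro γ hγ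
    have h4 := (h3 γ hγ).1
    simp only [Function.comp_apply, Equiv.apply_symm_apply] at h4
    exact h4

end

/-! ### Uniqueness -/

/-- The uniqueness half of the Perron-Frobenius theorem: a positive fixed vector `w` of a
nonnegative matrix spans the fixed vectors, if only the empty set and the whole index set are
closed under predecessors. -/
theorem exists_eq_mul_of_fixed {X : Type*} {S : Finset X} {T : X → X → ℝ} {w P : X → ℝ}
    (hT : ∀ β α, 0 ≤ T β α) (hw : ∀ α ∈ S, 0 < w α)
    (hwT : ∀ α ∈ S, ∑ β ∈ S, w β * T β α = w α) (hPT : ∀ α ∈ S, ∑ β ∈ S, P β * T β α = P α)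
    (hconn : ∀ Q : X → Prop, (∃ α ∈ S, Q α) →
      (∀ α ∈ S, ∀ β ∈ S, Q α → 0 < T β α → Q β) → ∀ α ∈ S, Q α) :
    ∃ c : ℝ, ∀ α ∈ S, P α = c * w α := by
  rcases S.eq_empty_or_nonempty with rfl | hS
  · exact ⟨0, by simp⟩
  -- subtract the largest multiple of `w` that leaves a nonnegative vector; it has a zero
  obtain ⟨α₀, hα₀, hmin⟩ := S.exists_min_image (fun α => P α / w α) hS
  set c := P α₀ / w α₀
  have hnonneg : ∀ α ∈ S, 0 ≤ P α - c * w α := fun α hα => by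
    have h := (le_div_iff₀ (hw α hα)).mp (hmin α hα)
    linarith
  refine ⟨c, hconn (fun α => P α = c * w α) ⟨α₀, hα₀, ?_⟩ ?_⟩
  · exact (div_mul_cancel₀ _ (hw α₀ hα₀).ne').symm
  · intro α hα β hβ h0 hpos
    have hfix : ∑ β ∈ S, (P β - c * w β) * T β α = 0 := by
      simp only [sub_mul, Finset.sum_sub_distrib, hPT α hα, mul_assoc, ← Finset.mul_sum, hwT α hα]
      linarith
    have h1 := (Finset.sum_eq_zero_iff_of_nonneg fun β hβ =>
      mul_nonneg (hnonneg β hβ) (hT β α)).mp hfix β hβ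
    rcases mul_eq_zero.mp h1 with h2 | h2
    · exact sub_eq_zero.mp h2
    · exact absurd h2 hpos.ne'

/-- The transitions that the dynamics allows; `γ i` are the particles that arrive at site `i`. -/
def Step {n L : ℕ} (β α : State n L) : Prop :=
  ∃ γ : State n L, ∀ i, γ i + β i = γ (finRotate L i) + α i ∧ γ (finRotate L i) ≤ β i

section

variable {q lam : ℝ} (hq0 : 0 < q) (hq1 : q < 1)

include hq0 hq1 in
theorem Phi_pos {n : ℕ} {mu : ℝ} (hmu0 : 0 < mu) (hmu : mu < lam) (hlam : lam < 1)
    {γ β : Fin n → ℕ} (h : γ ≤ β) : 0 < Phi q lam mu γ β := by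
  have h0 : 0 < lam := hmu0.trans hmu
  refine mul_pos (mul_pos (mul_pos (pow_pos hq0 _) (pow_pos (div_pos hmu0 h0) _))
    (div_pos (mul_pos (qPoch_pos hq0 hq1 hlam _) (qPoch_pos hq0 hq1 ((div_lt_one h0).mpr hmu) _))
      (qPoch_pos hq0 hq1 (hmu.trans hlam) _))) (Finset.prod_pos fun i _ => ?_)
  rw [qBinom, if_pos (h i)]
  exact div_pos (qPoch_pos hq0 hq1 hq1 _) (mul_pos (qPoch_pos hq0 hq1 hq1 _)
    (qPoch_pos hq0 hq1 hq1 _))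

include hq0 hq1 in
theorem stochR_nonneg {n : ℕ} {mu : ℝ} (hmu0 : 0 < mu) (hmu : mu < lam) (hlam : lam < 1)
    (α β γ δ : Fin n → ℕ) : 0 ≤ stochR q lam mu α β γ δ := by
  rw [stochR]
  split_ifs
  · by_contra hc
    exact hc (Phi_pos hq0 hq1 hmu0 hmu hlam (Phi_ne_zero_le (ne_of_not_ge hc))).le
  · exact le_rfl

variable {n L : ℕ} {mu : Fin L → ℝ} (hmu0 : ∀ i, 0 < mu i) (hmu : ∀ i, mu i < lam)
  (hlam : lam < 1)

include hq0 hq1 hmu0 hmu hlam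

theorem transfer_nonneg (β α : State n L) : 0 ≤ transfer q lam mu β α :=
  finsum_nonneg fun _ => Finset.prod_nonneg fun i _ =>
    stochR_nonneg hq0 hq1 (hmu0 i) (hmu i) hlam _ _ _ _

/-- An allowed transition has positive probability. -/
theorem transfer_pos {β α : State n L} (h : Step β α) : 0 < transfer q lam mu β α := by
  obtain ⟨γ, hγ⟩ := h
  rw [transfer_eq_sum]
  refine Finset.sum_pos' (fun γ _ => Finset.prod_nonneg fun i _ =>
    stochR_nonneg hq0 hq1 (hmu0 i) (hmu i) hlam _ _ _ _) ⟨γ, ?_, Finset.prod_pos fun i _ => ?_⟩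
  · rw [Fintype.mem_piFinset]
    intro i
    rw [Finset.mem_Iic]
    intro a
    have h1 := congrFun (hγ i).1 a
    have h2 : γ (finRotate L i) a ≤ β i a := (hγ i).2 a
    simp only [Pi.add_apply] at h1
    change γ i a ≤ α i a
    omega
  · rw [stochR, if_pos (hγ i).1]
    exact Phi_pos hq0 hq1 (hmu0 i) (hmu i) hlam (hγ i).2

end

theorem Step.sum_eq {n L : ℕ} {β α : State n L} (h : Step β α) : ∑ i, β i = ∑ i, α i := by
  obtain ⟨γ, hγ⟩ := h
  have h1 := Finset.sum_congr rfl fun i (_ : i ∈ Finset.univ) => (hγ i).1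
  rw [Finset.sum_add_distrib, Finset.sum_add_distrib, Equiv.sum_comp (finRotate L) γ] at h1
  exact add_left_cancel h1

theorem finRotate_val_of_lt {N : ℕ} {i : Fin (N + 1)} (h : i.val < N) :
    (finRotate (N + 1) i).val = i.val + 1 :=
  coe_finRotate_of_ne_last fun hi => by simp [hi] at h

section Reach

variable {n N : ℕ} {m : Fin n → ℕ}

theorem eq_single_of_sum {α : State n (N + 1)} (hα : ∑ i, α i = m)
    (h : ∀ i : Fin (N + 1), 0 < i.val → α i = 0) : α = Pi.single 0 m := by
  have h0 : α 0 = m := by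
    rw [← hα, Finset.sum_eq_single 0 (fun i _ hi => h i (Fin.pos_iff_ne_zero.mpr hi)) (by simp)]
  funext i
  by_cases hi : i = 0
  · rw [hi, Pi.single_eq_same, h0]
  · rw [Pi.single_eq_of_ne hi, h i (Fin.pos_iff_ne_zero.mpr hi)]

/-- Every state is reached from the state with all particles at site `0`: its particles are
pulled back, one site in each step, until they arrive there. -/
theorem reach_from_single (k : ℕ) (α : State n (N + 1)) (hα : ∑ i, α i = m)
    (h : ∀ i : Fin (N + 1), k < i.val → α i = 0) :
    Relation.ReflTransGen Step (Pi.single 0 m) α := by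
  induction k generalizing α with
  | zero => rw [eq_single_of_sum hα h]
  | succ k ih =>
    set γ : State n (N + 1) := fun i => if i = 0 then 0 else α i with hγ
    have hstep : Step (fun i => γ (finRotate _ i) + if i = 0 then α 0 else 0) α := by
      refine ⟨γ, fun i => ⟨?_, le_add_of_nonneg_right zero_le⟩⟩
      rw [add_left_comm]
      congr 1
      by_cases hi : i = 0
      · simp [hγ, hi]
      · simp [hγ, hi]
    refine Relation.ReflTransGen.tail (ih _ (hstep.sum_eq.trans hα) fun i hi => ?_) hstep
    have hi0 : i ≠ 0 := Fin.pos_iff_ne_zero.mp (Nat.zero_lt_of_lt hi)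
    rw [if_neg hi0, add_zero, hγ]
    dsimp only
    split_ifs with h1
    · rfl
    · refine h _ ?_
      have h2 : i.val < N := by
        by_contra hc
        have h3 : i = Fin.last N := Fin.ext (by have := i.isLt; simp; omega)
        rw [h3, finRotate_last] at h1
        exact h1 rfl
      rw [finRotate_val_of_lt h2]
      omega

/-- The state with all particles at site `0` is reached from every state: all particles that are
not at site `0` move on in each step. -/
theorem reach_single (k : ℕ) (β : State n (N + 1)) (hβ : ∑ i, β i = m)
    (h : ∀ i : Fin (N + 1), 0 < i.val → i.val + k ≤ N → β i = 0) :
    Relation.ReflTransGen Step β (Pi.single 0 m) := by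
  induction k generalizing β with
  | zero => rw [eq_single_of_sum hβ fun i hi => h i hi (by omega)]
  | succ k ih =>
    set γ : State n (N + 1) := fun i => if (finRotate _).symm i = 0 then 0 else
      β ((finRotate _).symm i) with hγ
    have hstep : Step β (fun i => γ i + if i = 0 then β 0 else 0) := by
      refine ⟨γ, fun i => ?_⟩
      have h1 : γ (finRotate _ i) = if i = 0 then 0 else β i := by
        rw [hγ]
        simp only [Equiv.symm_apply_apply]
      rw [h1]
      by_cases hi : i = 0
      · simp [hi]
      · simp [hi, add_comm]
    refine Relation.ReflTransGen.head hstep (ih _ (hstep.sum_eq.symm.trans hβ) fun i hi hk => ?_)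
    rw [if_neg (Fin.pos_iff_ne_zero.mp hi), add_zero, hγ]
    dsimp only
    obtain ⟨j, rfl⟩ := (finRotate (N + 1)).surjective i
    rw [Equiv.symm_apply_apply]
    split_ifs with h1
    · rfl
    · have h2 : j.val < N := by
        by_contra hc
        have h3 : j = Fin.last N := Fin.ext (by have := j.isLt; simp; omega)
        rw [h3, finRotate_last] at hi
        exact hi.ne rfl
      rw [finRotate_val_of_lt h2] at hk
      exact h j (Fin.pos_iff_ne_zero.mpr h1) (by omega)

end Reach

theorem reach_of_mem_sector {n L : ℕ} (hL : 1 ≤ L) {m : Fin n → ℕ} {α β : State n L}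
    (hα : α ∈ sector L m) (hβ : β ∈ sector L m) : Relation.ReflTransGen Step β α := by
  obtain ⟨N, rfl⟩ := Nat.exists_eq_add_of_le' hL
  exact (reach_single N β hβ fun i hi hk => absurd hk (by omega)).trans
    (reach_from_single N α hα fun i hi => absurd i.isLt (by omega))

theorem sum_eq_sum_sector {n L : ℕ} {m : Fin n → ℕ} {P : State n L →₀ ℝ}
    (hP : ∀ σ, σ ∉ sector L m → P σ = 0) (f : State n L → ℝ) :
    (P.sum fun β x => x * f β) = ∑ β ∈ (sector_finite L m).toFinset, P β * f β :=
  Finsupp.sum_of_support_subset P (fun σ hσ => (sector_finite L m).mem_toFinset.mpr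
    (of_not_not fun hc => Finsupp.mem_support_iff.mp hσ (hP σ hc))) _ fun _ _ => zero_mul _

end ZRP

end

theorem theorem3 (n L : ℕ) (hn : 1 ≤ n) (hL : 1 ≤ L) (q lam : ℝ) (mu : Fin L → ℝ)
    (hq0 : 0 < q) (hq1 : q < 1) (hmu0 : ∀ i, 0 < mu i) (hmu : ∀ i, mu i < lam) (hlam : lam < 1)
    (m : Fin n → ℕ) (hm : ∀ a, 1 ≤ m a) :
    (∀ σ ∈ ZRP.sector L m, Summable fun p : ZRP.FockIdx n => ZRP.xProd q mu σ p p) ∧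
    (∀ σ ∈ ZRP.sector L m, 0 < ZRP.xTrace q mu σ) ∧
    (∀ P : ZRP.State n L →₀ ℝ, (∀ σ, σ ∉ ZRP.sector L m → P σ = 0) →
      (ZRP.IsStationary q lam mu P ↔
        ∃ c : ℝ, ∀ σ ∈ ZRP.sector L m, P σ = c * ZRP.xTrace q mu σ)) := by
  have hmu1 : ∀ i, mu i < 1 := fun i => (hmu i).trans hlam
  have hlam0 : lam ≠ 0 := ((hmu0 ⟨0, hL⟩).trans (hmu ⟨0, hL⟩)).ne'
  have hmem (σ : ZRP.State n L) :
      σ ∈ (ZRP.sector_finite L m).toFinset ↔ σ ∈ ZRP.sector L m :=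
    (ZRP.sector_finite L m).mem_toFinset
  have hpos : ∀ σ ∈ ZRP.sector L m, 0 < ZRP.xTrace q mu σ :=
    fun σ hσ => ZRP.xTrace_pos hq0 hq1 hmu0 hmu1 hm hσ
  refine ⟨fun σ hσ => ZRP.xProd_summable hq0 hq1 (fun i => (hmu0 i).ne') hm hσ, hpos,
    fun P hP => ⟨fun hstat => ?_, ?_⟩⟩
  · obtain ⟨c, hc⟩ := ZRP.exists_eq_mul_of_fixed (S := (ZRP.sector_finite L m).toFinset)
      (T := ZRP.transfer q lam mu) (w := ZRP.xTrace q mu) (P := P)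
      (fun β α => ZRP.transfer_nonneg hq0 hq1 hmu0 hmu hlam β α)
      (fun α hα => hpos α ((hmem α).mp hα))
      (fun α hα => ZRP.sum_xTrace_mul_transfer hq0 hq1 hL hlam0 hmu0 hmu1 hm ((hmem α).mp hα))
      (fun α _ => (ZRP.sum_eq_sum_sector hP fun β => ZRP.transfer q lam mu β α).symm.trans
        (hstat α))
      (fun Q ⟨α, hα, hQ⟩ hclosed β hβ => by
        have h := ZRP.reach_of_mem_sector hL ((hmem α).mp hα) ((hmem β).mp hβ)
        suffices key : Q β ∧ β ∈ ZRP.sector L m from key.1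
        clear hβ
        induction h using Relation.ReflTransGen.head_induction_on with
        | refl => exact ⟨hQ, (hmem α).mp hα⟩
        | head hstep _ ih =>
          have h1 := hstep.sum_eq.trans ih.2
          exact ⟨hclosed _ ((hmem _).mpr ih.2) _ ((hmem _).mpr h1) ih.1
            (ZRP.transfer_pos hq0 hq1 hmu0 hmu hlam hstep), h1⟩)
    exact ⟨c, fun σ hσ => hc σ ((hmem σ).mpr hσ)⟩
  · rintro ⟨c, hc⟩ α
    rw [ZRP.sum_eq_sum_sector hP fun β => ZRP.transfer q lam mu β α]
    by_cases hα : α ∈ ZRP.sector L m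
    · rw [hc α hα, ← ZRP.sum_xTrace_mul_transfer hq0 hq1 hL hlam0 hmu0 hmu1 hm hα,
        Finset.mul_sum]
      refine Finset.sum_congr rfl fun β hβ => ?_
      rw [hc β ((hmem β).mp hβ), mul_assoc]
    · rw [hP α hα]
      refine Finset.sum_eq_zero fun β hβ => ?_
      have h : ZRP.transfer q lam mu β α = 0 := by
        by_contra hne
        exact hα ((ZRP.transfer_conserves hne).symm.trans ((hmem β).mp hβ))
      rw [h, mul_zero]
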